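/- Let $\Gamma$ be a finite group. **Bundles.** For a space $X$, a $\Gamma$-bundle on $X$ is a functor $\rho:\Pi_1(X)\to\Gamma$ from the fundamental groupoid; a morphism $\rho\to\rho'$ is a map $\eta:X\to\Gamma$ with $\rho'(\gamma)=\eta(\gamma(1))\rho(\gamma)\eta(\gamma(0))^{-1}$ for all paths $\gamma$. For a groupoid $\mathcal G$ with finitely many isomorphism classes and finite automorphism groups write $\int_{\mathcal G}F=\sum_{[\rho]\in\pi_0(\mathcal G)}F(\rho)/\#\mathrm{Aut}(\rho)$. **Categories.** For a finite set $J$, $\mathcal E^{\boxtimes J}$ is the category of finite-dimensional inner product spaces $U=\bigoplus_{x\in\Gamma^J}U_x$ with a unitary action of $\Gamma^J$ such that $g(U_x)=U_{gxg^{-1}}$; morphisms are the linear maps that respect the grading and the action. $U\boxtimes U'$ denotes the external tensor product, an object of $\mathcal E^{\boxtimes(J\sqcup J')}$ with $(U\boxtimes U')_{(x,x')}=U_x\otimes U'_{x'}$. **Surfaces.** A surface $B$ is a compact smooth surface whose boundary circles are divided into incoming ones (indexed by $J$) and outgoing ones (indexed by $K$), each parametrized by the standard circle with base point $1$. For $x\in\Gamma^J$,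 $y\in\Gamma^K$ let $\mathfrak B_{x,y}(B)$ be the groupoid of $\Gamma$-bundles on $B$ with holonomies $x$ and $y$ along the parametrized incoming and outgoing circles, and of morphisms that are trivial at the base points of these circles. The functor $\hat Z(B):\mathcal E^{\boxtimes J}\to\mathcal E^{\boxtimes K}$ is $\hat Z(B)(U)_y=\big(\bigoplus_{x}U_x\otimes\mathbb C[\pi_0\mathfrak B_{x,y}(B)]\big)^{\Gamma^J}$; its elements are families $u_x(\rho)\in U_x$ depending only on the class of $\rho\in\mathfrak B_{x,y}(B)$ and invariant under $\Gamma^J$ (the inner product is $\langle u,v\rangle=(\#\Gamma)^{-\#J}\sum_x\int_{\mathfrak B_{x,y}(B)}\langle u_x(\rho),v_x(\rho)\rangle$). A diffeomorphism $f:B\to B'$ preserving the parametrizations induces a natural transformation $f_*:\hat Z(B)\to\hat Z(B')$ by pulling back bundles. If $B_2\cup B_1$ is obtained by gluing the outgoing circles of $B_1$ to the incoming circles of $B_2$, restriction of bundles gives a natural transformation $\hat Z(B_2)\circ\hat Z(B_1)\to\hat Z(B_2\cup B_1)$, and for disjoint unions it gives a morphism $\hat Z(B)(U)\boxtimes\hat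 Z(B')(U')\to\hat Z(B\sqcup B')(U\boxtimes U')$. **3-manifolds.** A $\langle2\rangle$-3-manifold is a compact smooth 3-manifold $C$ with corners whose boundary is the union of two disjoint horizontal faces $B_{h,1}:A_{d,1}\to A_{d,2}$, $B_{h,2}:A_{u,1}\to A_{u,2}$ and two disjoint vertical faces $B_{v,1}:A_{d,1}\to A_{u,1}$, $B_{v,2}:A_{d,2}\to A_{u,2}$, which are surfaces as above from their incoming to their outgoing parametrized circles; horizontal and vertical faces meet exactly in the circles of $A_{d,1},A_{d,2},A_{u,1},A_{u,2}$, which form the corners of $C$. All these pieces may be empty. For bundles $\phi,\psi,\phi',\psi'$ on $B_{h,1},B_{v,2},B_{v,1},B_{h,2}$ with matching holonomies along the common circles, let $\mathfrak B^{\phi',\psi'}_{\phi,\psi}(C)$ be the groupoid of $\Gamma$-bundles on $C$ together with an isomorphism of the restriction to $\partial C$ with the bundle given by $\phi,\psi,\phi',\psi'$ (morphisms compatible with these isomorphisms), and let $Y(C)^{\phi',\psi'}_{\phi,\psi}=\int_{\mathfrak B^{\phi',\psi'}_{\phi,\psi}(C)}1$; this is $\#\pi_0$ if $C$ has no closed components.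 The invariant of $C$ is the natural transformation $Z(C):\hat Z(B_{v,2})\circ\hat Z(B_{h,1})\to\hat Z(B_{h,2})\circ\hat Z(B_{v,1})$ with $$\big(Z(C)_U f\big)(\psi')(\phi')=\frac1{(\#\Gamma)^{q}}\sum_{y\in\Gamma^{q}}\int_{\phi}\int_{\psi}Y(C)^{\phi',\psi'}_{\phi,\psi}\,f(\psi)(\phi),\qquad q=\#\pi_0(A_{d,2}),$$ where $y$ is the holonomy along $A_{d,2}$. A diffeomorphism of $\langle2\rangle$-3-manifolds is a diffeomorphism of manifolds with corners that maps each face to the corresponding face and preserves the parametrizations of the circles. **Theorem.** (a) (Functoriality) For each diffeomorphism $F:C\to C'$ of $\langle2\rangle$-3-manifolds one has $(\partial F)_*\circ Z(C)=Z(C')\circ(\partial F)_*$ as natural transformations $\hat Z(B_{v,2})\circ\hat Z(B_{h,1})\to\hat Z(B'_{h,2})\circ\hat Z(B'_{v,1})$, where $(\partial F)_*$ is the horizontal composite of the natural transformations induced by the restrictions of $F$ to the two faces involved. (b) (Multiplicativity) For two $\langle2\rangle$-3-manifolds $C$ and $C'$ one has $Z(C\sqcup C')=Z(C)\boxtimes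 Z(C')$. That is, the morphisms from $\hat Z(B_{v,2})\hat Z(B_{h,1})(U)\boxtimes\hat Z(B'_{v,2})\hat Z(B'_{h,1})(U')$ to $\hat Z(B_{v,2}\sqcup B'_{v,2})\hat Z(B_{h,1}\sqcup B'_{h,1})(U\boxtimes U')$, and similarly for $\hat Z(B_{h,2})\hat Z(B_{v,1})$, are isomorphisms for all $U,U'$, and they identify $Z(C)_U\boxtimes Z(C')_{U'}$ with $Z(C\sqcup C')_{U\boxtimes U'}$. (c) (Gluing) Let $C$ and $C'$ be $\langle2\rangle$-3-manifolds with faces $B_{h,i},B_{v,i}$ and $B'_{h,i},B'_{v,i}$. (i) If $B_{h,2}=B'_{h,1}$ and $C_v$ is obtained by gluing $C$ and $C'$ along $B_{h,2}$, then for all $U\in\mathcal E^{\boxtimes\pi_0(A_{d,1})}$ $$Z(C_v)_U=Z(C')_{\hat Z(B_{v,1})(U)}\circ\hat Z(B'_{v,2})(Z(C)_U):\ \hat Z(B'_{v,2}\cup B_{v,2})\hat Z(B_{h,1})(U)\to\hat Z(B'_{h,2})\hat Z(B'_{v,1}\cup B_{v,1})(U).$$ (ii) If $B_{v,2}=B'_{v,1}$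 and $C_h$ is obtained by gluing $C$ and $C'$ along $B_{v,2}$, then for all $U\in\mathcal E^{\boxtimes\pi_0(A_{d,1})}$ $$Z(C_h)_U=\hat Z(B'_{h,2})(Z(C)_U)\circ Z(C')_{\hat Z(B_{h,1})(U)}:\ \hat Z(B'_{v,2})\hat Z(B'_{h,1}\cup B_{h,1})(U)\to\hat Z(B'_{h,2}\cup B_{h,2})\hat Z(B_{v,1})(U).$$ In (i) and (ii) the maps $\hat Z(B_2)\circ\hat Z(B_1)\to\hat Z(B_2\cup B_1)$ for the glued faces are isomorphisms, and the equations are read through them. -/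

import Mathlib

open CategoryTheory Topology Set
open scoped Manifold ContDiff TensorProduct

namespace DW

/-! ### Sums over a groupoid -/

/-- The sum of `F` over the isomorphism classes of objects of the groupoid `G`, each class weighted
by the inverse of the order of its automorphism group. -/
noncomputable def gsum (G : Type*) [Groupoid G] {M : Type*} [AddCommMonoid M] [Module ℂ M]
    (F : G → M) : M :=
  ∑ᶠ c : Quotient (isIsomorphicSetoid G), ((Nat.card (c.out ⟶ c.out) : ℂ)⁻¹) • F c.out

lemma gsum_congr {G H : Type*} [Groupoid G] [Groupoid H] {M : Type*} [AddCommMonoid M] [Module ℂ M]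
    (Φ : G → H) (e : ∀ a b, (a ⟶ b) ≃ (Φ a ⟶ Φ b)) (surj : ∀ b, ∃ a, Nonempty (Φ a ⟶ b))
    (F : G → M) (F' : H → M) (h : ∀ a b, Nonempty (Φ a ⟶ b) → F' b = F a) :
    gsum H F' = gsum G F := by
  have toIso : ∀ {a b : H}, Nonempty (a ⟶ b) → IsIsomorphic a b :=
    fun ⟨f⟩ => ⟨⟨f, Groupoid.inv f, by simp, by simp⟩⟩
  have toIso' : ∀ {a b : G}, Nonempty (a ⟶ b) → IsIsomorphic a b :=
    fun ⟨f⟩ => ⟨⟨f, Groupoid.inv f, by simp, by simp⟩⟩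
  let q : Quotient (isIsomorphicSetoid G) → Quotient (isIsomorphicSetoid H) :=
    Quotient.map Φ (fun a b hab => toIso ⟨e a b hab.some.hom⟩)
  have hq : ∀ c, Nonempty (Φ c.out ⟶ (q c).out) := by
    intro c
    have h1 : q c = Quotient.mk (isIsomorphicSetoid H) (Φ c.out) := by
      conv_lhs => rw [← Quotient.out_eq c]
      rfl
    rw [h1]
    have h2 := Quotient.mk_out (s := isIsomorphicSetoid H) (Φ c.out)
    exact ⟨h2.some.inv⟩
  refine (finsum_eq_of_bijective q ⟨?_, ?_⟩ ?_).symm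
  · intro c c'
    refine Quotient.inductionOn₂ c c' ?_
    intro a b hab
    have := Quotient.exact hab
    exact Quotient.sound (toIso' ⟨(e a b).symm this.some.hom⟩)
  · intro d
    refine Quotient.inductionOn d ?_
    intro b
    obtain ⟨a, ha⟩ := surj b
    exact ⟨Quotient.mk _ a, Quotient.sound (toIso ha)⟩
  · intro c
    obtain ⟨f⟩ := hq c
    rw [h c.out (q c).out ⟨f⟩]
    congr 3
    refine Nat.card_congr ((e _ _).trans ⟨fun g => Groupoid.inv f ≫ g ≫ f,
      fun g => f ≫ g ≫ Groupoid.inv f, ?_, ?_⟩)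
    · intro g; simp
    · intro g; simp

/-! ### Flat bundles -/

/-- A `Γ`-bundle on `X`: a functor from the fundamental groupoid of `X` to the group `Γ`, regarded
as a groupoid with one object. -/
abbrev Bundle (Γ : Type) [Group Γ] (X : Type) [TopologicalSpace X] : Type :=
  FundamentalGroupoid X ⥤ SingleObj Γ

section Bundle

variable {Γ : Type} [Group Γ] {X Y : Type} [TopologicalSpace X] [TopologicalSpace Y]

/-- The holonomy of a bundle along a homotopy class of paths. -/
noncomputable def hol (ρ : Bundle Γ X) {x y : FundamentalGroupoid X} (p : x ⟶ y) : Γ := ρ.map p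

lemma hol_comp (ρ : Bundle Γ X) {x y z : FundamentalGroupoid X} (p : x ⟶ y) (q : y ⟶ z) :
    hol ρ (p ≫ q) = hol ρ q * hol ρ p := ρ.map_comp p q

lemma hol_id (ρ : Bundle Γ X) (x : FundamentalGroupoid X) : hol ρ (𝟙 x) = 1 := ρ.map_id x

lemma hol_inv (ρ : Bundle Γ X) {x y : FundamentalGroupoid X} (p : x ⟶ y) :
    hol ρ (Groupoid.inv p) = (hol ρ p)⁻¹ := by
  rw [eq_inv_iff_mul_eq_one, ← hol_comp]; simp [hol_id]

/-- `η : X → Γ` is a morphism of bundles `ρ ⟶ ρ'`. -/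
def IsGauge (η : X → Γ) (ρ ρ' : Bundle Γ X) : Prop :=
  ∀ ⦃x y : FundamentalGroupoid X⦄ (p : x ⟶ y), hol ρ' p = η y.as * hol ρ p * (η x.as)⁻¹

lemma IsGauge.refl (ρ : Bundle Γ X) : IsGauge 1 ρ ρ := fun x y p => by simp

lemma IsGauge.trans {η η' : X → Γ} {ρ ρ' ρ'' : Bundle Γ X} (h : IsGauge η ρ ρ')
    (h' : IsGauge η' ρ' ρ'') : IsGauge (η' * η) ρ ρ'' := fun x y p => by
  rw [h' p, h p]; simp [mul_assoc]

lemma IsGauge.symm {η : X → Γ} {ρ ρ' : Bundle Γ X} (h : IsGauge η ρ ρ') : IsGauge η⁻¹ ρ' ρ :=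
  fun x y p => by rw [h p]; simp [mul_assoc]

/-- The bundle `η · ρ`. -/
noncomputable def gauge (η : X → Γ) (ρ : Bundle Γ X) : Bundle Γ X where
  obj _ := SingleObj.star Γ
  map {x y} p := (η y.as * hol ρ p * (η x.as)⁻¹ : Γ)
  map_id x := by rw [hol_id]; simp; rfl
  map_comp p q := by rw [hol_comp, SingleObj.comp_as_mul]; simp [mul_assoc]

lemma isGauge_gauge (η : X → Γ) (ρ : Bundle Γ X) : IsGauge η ρ (gauge η ρ) := fun _ _ _ => rfl

/-- The pullback of a bundle along a continuous map. -/
noncomputable def pull (f : C(X, Y)) (ρ : Bundle Γ Y) : Bundle Γ X := FundamentalGroupoid.map f ⋙ ρ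

lemma IsGauge.pull {η : Y → Γ} {ρ ρ' : Bundle Γ Y} (h : IsGauge η ρ ρ') (f : C(X, Y)) :
    IsGauge (fun x => η (f x)) (pull f ρ) (pull f ρ') :=
  fun _ _ p => h ((FundamentalGroupoid.map f).map p)

/-- The standard loop of the circle, based at `1` and running once around counterclockwise. -/
noncomputable def circleLoop : Path (1 : Circle) 1 where
  toFun t := Circle.exp (2 * Real.pi * t)
  continuous_toFun := by fun_prop
  source' := by simp
  target' := by simp

/-- The holonomy of a bundle on `X` along the loop in `X` given by a map `a` from the circle. -/
noncomputable def loopHol (a : C(Circle, X)) (ρ : Bundle Γ X) : Γ :=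
  hol (pull a ρ) (FundamentalGroupoid.fromPath (Path.Homotopic.Quotient.mk circleLoop))

lemma IsGauge.loopHol {η : X → Γ} {ρ ρ' : Bundle Γ X} (h : IsGauge η ρ ρ') (a : C(Circle, X)) :
    loopHol a ρ' = η (a 1) * loopHol a ρ * (η (a 1))⁻¹ :=
  h.pull a _

lemma loopHol_pull (f : C(X, Y)) (a : C(Circle, X)) (ρ : Bundle Γ Y) :
    loopHol a (pull f ρ) = loopHol (f.comp a) ρ := rfl

/-! ### Finiteness of the set of bundles on a compact, locally contractible space -/

lemma homotopic_of_range_subset {U : Set X} [ContractibleSpace U] {a b : X} (p q : Path a b)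
    (hp : range p ⊆ U) (hq : range q ⊆ U) : p.Homotopic q := by
  have ha : a ∈ U := hp ⟨0, by simp⟩
  have hb : b ∈ U := hp ⟨1, by simp⟩
  let lift (r : Path a b) (hr : range r ⊆ U) : Path (⟨a, ha⟩ : U) ⟨b, hb⟩ :=
    { toFun := fun t => ⟨r t, hr ⟨t, rfl⟩⟩
      continuous_toFun := by fun_prop
      source' := by simp
      target' := by simp }
  have := SimplyConnectedSpace.paths_homotopic (lift p hp) (lift q hq)
  exact this.map ⟨Subtype.val, continuous_subtype_val⟩

/-- The class of a path, as a morphism of the fundamental groupoid. -/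
abbrev cls {a b : X} (p : Path a b) : FundamentalGroupoid.mk a ⟶ FundamentalGroupoid.mk b :=
  FundamentalGroupoid.fromPath (Path.Homotopic.Quotient.mk p)

lemma cls_trans {a b c : X} (p : Path a b) (q : Path b c) : cls (p.trans q) = cls p ≫ cls q := rfl

lemma exists_finite_cover (X : Type) [TopologicalSpace X] [CompactSpace X] [T2Space X]
    [StronglyLocallyContractibleSpace X] :
    ∃ (t : Finset X) (W : X → Set X), (∀ w, w ∈ W w) ∧ (∀ w, IsPathConnected (W w)) ∧
      (∀ x, ∃ w : t, x ∈ interior (W w)) ∧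
      ∀ w w' : X, (W w ∩ W w').Nonempty → ∀ {a b : X} (p q : Path a b),
        range p ⊆ W w ∪ W w' → range q ⊆ W w ∪ W w' → p.Homotopic q := by
  let _ : UniformSpace X := uniformSpaceOfCompactR1
  have h1 : ∀ x : X, ∃ U ∈ 𝓝 x, ContractibleSpace U := fun x => by
    obtain ⟨U, hU, -⟩ := (contractible_basis x).mem_iff.1 (Filter.univ_mem (f := 𝓝 x))
    exact ⟨U, hU⟩
  choose U hU hUc using h1
  obtain ⟨V, hV, hVU⟩ := lebesgue_number_lemma_nhds (isCompact_univ (X := X)) (fun x _ => hU x)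
  obtain ⟨V1, hV1, hV1s, hV1V⟩ := comp_symm_mem_uniformity_sets hV
  obtain ⟨V2, hV2, hV2s, hV2V⟩ := comp_symm_mem_uniformity_sets hV1
  have h2 : ∀ x : X, ∃ W ∈ 𝓝 x, ContractibleSpace W ∧ W ⊆ UniformSpace.ball x V2 := fun x => by
    obtain ⟨W, ⟨hW, hWc⟩, h⟩ :=
      (contractible_basis x).mem_iff.1 (UniformSpace.ball_mem_nhds x hV2)
    exact ⟨W, hW, hWc, h⟩
  choose W hW hWc hWV using h2
  obtain ⟨t, ht⟩ := isCompact_univ.elim_finite_subcover (fun x => interior (W x))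
    (fun _ => isOpen_interior) (fun x _ => mem_iUnion.2 ⟨x, mem_interior_iff_mem_nhds.2 (hW x)⟩)
  refine ⟨t, W, fun w => mem_of_mem_nhds (hW w), fun w => ?_, fun x => ?_, ?_⟩
  · rw [isPathConnected_iff_pathConnectedSpace]; infer_instance
  · obtain ⟨w, hw⟩ := mem_iUnion.1 (ht (mem_univ x))
    obtain ⟨hw, hx⟩ := mem_iUnion.1 hw
    exact ⟨⟨w, hw⟩, hx⟩
  · rintro w w' ⟨z, hz, hz'⟩ a b p q hp hq
    obtain ⟨y, hy⟩ := hVU w (mem_univ w)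
    have hsub : W w ∪ W w' ⊆ U y := by
      refine Subset.trans ?_ hy
      have hb : ∀ {u v : X}, v ∈ W u → (u, v) ∈ V2 := fun h => hWV _ h
      have h12 : ∀ {u v : X}, (u, v) ∈ V2 → (u, v) ∈ V1 := fun {u v} h =>
        hV2V ⟨v, h, refl_mem_uniformity hV2⟩
      have h1V : ∀ {u v : X}, (u, v) ∈ V1 → (u, v) ∈ V := fun {u v} h =>
        hV1V ⟨v, h, refl_mem_uniformity hV1⟩
      rintro v (hv | hv)
      · exact h1V (h12 (hb hv))
      · refine hV1V ⟨w', hV2V ⟨z, hb hz, ?_⟩, h12 (hb hv)⟩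
        exact hV2s.symm _ _ (hb hz')
    exact homotopic_of_range_subset p q (hp.trans hsub) (hq.trans hsub)

/-- On a compact, locally contractible space finitely many holonomies determine a bundle up to a
morphism that is trivial at prescribed points. -/
lemma exists_finite_test (X : Type) [TopologicalSpace X] [CompactSpace X] [T2Space X]
    [StronglyLocallyContractibleSpace X] (P : Set X) (hP : P.Finite) :
    ∃ (T : Type) (_ : Finite T) (s t : T → FundamentalGroupoid X) (p : ∀ i, s i ⟶ t i),
      ∀ ρ ρ' : Bundle Γ X, (∀ i, hol ρ (p i) = hol ρ' (p i)) →
        ∃ η : X → Γ, IsGauge η ρ ρ' ∧ ∀ x ∈ P, η x = 1 := by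
  obtain ⟨t, W, hmem, hpc, hcov, hhom⟩ := exists_finite_cover X
  choose i hi using hcov
  have hs : ∀ x, ∃ p : Path (i x : X) x, range p ⊆ W (i x) := fun x => by
    obtain ⟨p, hp⟩ := (hpc (i x)).joinedIn _ (hmem _) _ (interior_subset (hi x))
    exact ⟨p, range_subset_iff.2 hp⟩
  choose s hs using hs
  have hr : ∀ r : {r : t × t // (W r.1 ∩ W r.2).Nonempty},
      ∃ p : Path (r.1.1 : X) r.1.2, range p ⊆ W r.1.1 ∪ W r.1.2 := fun r => by
    obtain ⟨z, hz, hz'⟩ := r.2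
    obtain ⟨p, hp⟩ := ((hpc r.1.1).union (hpc r.1.2) ⟨z, hz, hz'⟩).joinedIn _ (Or.inl (hmem _))
      _ (Or.inr (hmem _))
    exact ⟨p, range_subset_iff.2 hp⟩
  choose r hr using hr
  have : Finite P := hP
  refine ⟨{r : t × t // (W r.1 ∩ W r.2).Nonempty} ⊕ P, inferInstance,
    Sum.elim (fun r => ⟨r.1.1⟩) (fun x => ⟨i x⟩), Sum.elim (fun r => ⟨r.1.2⟩) (fun x => ⟨x⟩),
    fun j => match j with
      | .inl j => cls (r j)
      | .inr x => cls (s x), fun ρ ρ' h => ?_⟩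
  let η : X → Γ := fun x => hol ρ' (cls (s x)) * (hol ρ (cls (s x)))⁻¹
  have key : ∀ (k : t) (a : X) (p : Path (k : X) a), range p ⊆ W k →
      hol ρ' (cls p) = η a * hol ρ (cls p) := fun k a p hp => by
    have hne : (W (i a) ∩ W k).Nonempty := ⟨a, interior_subset (hi a), hp ⟨1, by simp⟩⟩
    have h1 : cls (s a) = cls ((r ⟨(i a, k), hne⟩).trans p) := by
      refine Quotient.sound (hhom _ _ hne _ _ ((hs a).trans subset_union_left) ?_)
      rw [Path.trans_range]
      exact union_subset (hr ⟨(i a, k), hne⟩) (hp.trans subset_union_right)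
    have h2 := h (.inl ⟨(i a, k), hne⟩)
    simp only [η]
    rw [h1, cls_trans, hol_comp, hol_comp]
    change _ = _ * (hol ρ (cls p) * hol ρ (cls (r ⟨(i a, k), hne⟩)))⁻¹ * _
    change hol ρ (cls (r ⟨(i a, k), hne⟩)) = hol ρ' (cls (r ⟨(i a, k), hne⟩)) at h2
    rw [h2]; simp [mul_assoc]
  have key2 : ∀ (k : t) (a b : X) (γ : Path a b), range γ ⊆ W k →
      hol ρ' (cls γ) = η b * hol ρ (cls γ) * (η a)⁻¹ := fun k a b γ hγ => by
    obtain ⟨p, hp⟩ := (hpc k).joinedIn _ (hmem _) a (hγ ⟨0, by simp⟩)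
    have hp' : range p ⊆ W k := range_subset_iff.2 hp
    have h1 := key k a p hp'
    have h2 := key k b (p.trans γ) (by rw [Path.trans_range]; exact union_subset hp' hγ)
    rw [cls_trans, hol_comp, hol_comp, h1] at h2
    have h3 : hol ρ' (cls γ) * η a = η b * hol ρ (cls γ) := by
      have := congrArg (· * (hol ρ (cls p))⁻¹) h2
      simpa [mul_assoc] using this
    rw [← h3]; simp
  refine ⟨η, ?_, fun x hx => ?_⟩
  · rintro ⟨a⟩ ⟨b⟩ p
    obtain ⟨γ, rfl⟩ := Path.Homotopic.Quotient.mk_surjective p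
    change hol ρ' (cls γ) = η b * hol ρ (cls γ) * (η a)⁻¹
    obtain ⟨u, hu0, hum, ⟨n, hn⟩, hu⟩ := exists_monotone_Icc_subset_open_cover_unitInterval
      (c := fun k : t => γ ⁻¹' interior (W k)) (fun k => isOpen_interior.preimage γ.continuous)
      (fun x _ => mem_iUnion.2 ⟨i (γ x), hi (γ x)⟩)
    have ind : ∀ m : ℕ, hol ρ' (cls (γ.subpath (u 0) (u m))) =
        η (γ (u m)) * hol ρ (cls (γ.subpath (u 0) (u m))) * (η (γ (u 0)))⁻¹ := by
      intro m
      induction m with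
      | zero =>
        rw [Path.subpath_self]
        change hol ρ' (𝟙 _) = _ * hol ρ (𝟙 _) * _
        simp [hol_id]
      | succ m ih =>
        obtain ⟨k, hk⟩ := hu m
        have h1 : cls (γ.subpath (u 0) (u (m + 1))) =
            cls (γ.subpath (u 0) (u m)) ≫ cls (γ.subpath (u m) (u (m + 1))) :=
          (Path.Homotopic.Quotient.eq.2
            ⟨Path.Homotopy.subpathTransSubpath γ (u 0) (u m) (u (m + 1))⟩).symm
        have h2 := key2 k _ _ (γ.subpath (u m) (u (m + 1))) (by
          rw [Path.range_subpath_of_le _ _ _ (hum (Nat.le_succ m))]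
          rintro _ ⟨x, hx, rfl⟩
          exact interior_subset (hk hx))
        rw [h1, hol_comp, hol_comp, ih, h2]; simp [mul_assoc]
    have h := ind n
    rw [hu0, hn n le_rfl, Path.subpath_zero_one] at h
    have e0 : γ 0 = a := γ.source
    have e1 : γ 1 = b := γ.target
    have gen : ∀ (a' b' : X) (ha : a' = a) (hb : b' = b), hol ρ' (cls (γ.cast ha hb)) =
        η b' * hol ρ (cls (γ.cast ha hb)) * (η a')⁻¹ →
        hol ρ' (cls γ) = η b * hol ρ (cls γ) * (η a)⁻¹ := by
      rintro _ _ rfl rfl h; exact h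
    exact gen _ _ e0 e1 h
  · have h2 : hol ρ (cls (s x)) = hol ρ' (cls (s x)) := h (.inr ⟨x, hx⟩)
    simp [η, h2]

/-- A morphism of bundles is determined by its values at finitely many points. -/
lemma exists_finite_points (X : Type) [TopologicalSpace X] [CompactSpace X] [T2Space X]
    [StronglyLocallyContractibleSpace X] :
    ∃ S : Finset X, ∀ (ρ ρ' : Bundle Γ X) (η η' : X → Γ), IsGauge η ρ ρ' → IsGauge η' ρ ρ' →
      (∀ x ∈ S, η x = η' x) → η = η' := by
  obtain ⟨t, W, hmem, hpc, hcov, -⟩ := exists_finite_cover X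
  refine ⟨t, fun ρ ρ' η η' h h' hS => funext fun x => ?_⟩
  obtain ⟨w, hw⟩ := hcov x
  obtain ⟨p, -⟩ := (hpc w).joinedIn _ (hmem _) _ (interior_subset hw)
  have h1 := (h (cls p)).symm.trans (h' (cls p))
  simpa [hS w w.2] using h1

end Bundle

/-! ### Local contractibility of manifolds -/

lemma halfSpace_slc (n : ℕ) [NeZero n] : StronglyLocallyContractibleSpace (EuclideanHalfSpace n) where
  contractible_basis x := by
    rw [Filter.hasBasis_self]
    intro N hN
    obtain ⟨N', hN', hsub⟩ := mem_nhds_induced Subtype.val x N |>.1 hN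
    obtain ⟨r, hr, hball⟩ := Metric.mem_nhds_iff.1 hN'
    refine ⟨Subtype.val ⁻¹' Metric.ball x.1 r, ?_, ?_, (preimage_mono hball).trans hsub⟩
    · exact continuous_subtype_val.continuousAt.preimage_mem_nhds (Metric.ball_mem_nhds _ hr)
    · have hconv := ((convex_ball x.1 r).inter (EuclideanHalfSpace.convex (n := n)))
      have hc := hconv.contractibleSpace ⟨x.1, Metric.mem_ball_self hr, x.2⟩
      let e : (Subtype.val ⁻¹' Metric.ball x.1 r : Set (EuclideanHalfSpace n)) ≃ₜ
          (Metric.ball x.1 r ∩ {y : EuclideanSpace ℝ (Fin n) | 0 ≤ y 0} : Set _) :=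
        { toFun := fun y => ⟨y.1.1, y.2, y.1.2⟩
          invFun := fun y => ⟨⟨y.1, y.2.2⟩, y.2.1⟩
          left_inv := fun _ => rfl
          right_inv := fun _ => rfl
          continuous_toFun := Continuous.subtype_mk (continuous_subtype_val.comp continuous_subtype_val) _
          continuous_invFun :=
            Continuous.subtype_mk (Continuous.subtype_mk continuous_subtype_val _) _ }
      exact e.contractibleSpace_iff.2 hc

lemma chartedSpace_slc (H : Type) [TopologicalSpace H] [StronglyLocallyContractibleSpace H]
    (M : Type) [TopologicalSpace M] [ChartedSpace H M] : StronglyLocallyContractibleSpace M where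
  contractible_basis x := by
    rw [Filter.hasBasis_self]
    intro N hN
    let e := chartAt H x
    have h1 : StronglyLocallyContractibleSpace e.target :=
      e.open_target.stronglyLocallyContractibleSpace
    have h2 : StronglyLocallyContractibleSpace e.source :=
      e.toHomeomorphSourceTarget.isOpenEmbedding.stronglyLocallyContractibleSpace
    have hx : x ∈ e.source := mem_chart_source H x
    have hN' : (Subtype.val ⁻¹' N : Set e.source) ∈ 𝓝 (⟨x, hx⟩ : e.source) :=
      continuous_subtype_val.continuousAt.preimage_mem_nhds hN
    obtain ⟨s, ⟨hs, hsc⟩, hsub⟩ := (contractible_basis (⟨x, hx⟩ : e.source)).mem_iff.1 hN'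
    refine ⟨Subtype.val '' s, e.open_source.isOpenEmbedding_subtypeVal.image_mem_nhds.2 hs, ?_, ?_⟩
    · exact (IsEmbedding.subtypeVal.homeomorphImage s).contractibleSpace_iff.1 hsc
    · rintro _ ⟨y, hy, rfl⟩; exact hsub hy

/-! ### Surfaces with labelled boundary circles -/

/-- Smooth injective immersions; for a compact source these are the smooth embeddings. -/
def IsSmoothEmb {E H M E' H' M' : Type} [NormedAddCommGroup E] [NormedSpace ℝ E]
    [TopologicalSpace H] [TopologicalSpace M] [ChartedSpace H M]
    [NormedAddCommGroup E'] [NormedSpace ℝ E'] [TopologicalSpace H'] [TopologicalSpace M']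
    [ChartedSpace H' M'] (I : ModelWithCorners ℝ E H) (I' : ModelWithCorners ℝ E' H')
    (f : M → M') : Prop :=
  ContMDiff I I' ∞ f ∧ Function.Injective f ∧ ∀ x, Function.Injective (mfderiv I I' f x)

/-- A compact smooth surface with boundary, regarded as a cobordism: its boundary circles are
divided into incoming ones, indexed by `ι`, and outgoing ones, indexed by `κ`, and each of them is
labelled, that is, parametrized by the standard circle. The surface may be disconnected or closed
or empty. -/
structure Surface (ι κ : Type) where
  carrier : Type
  [top : TopologicalSpace carrier]
  [t2 : T2Space carrier]
  [secondCountable : SecondCountableTopology carrier]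
  [compact : CompactSpace carrier]
  [charted : ChartedSpace (EuclideanHalfSpace 2) carrier]
  [smooth : IsManifold (𝓡∂ 2) ∞ carrier]
  /-- The inverses of the labels. -/
  lab : ι ⊕ κ → C(Circle, carrier)
  lab_emb : ∀ s, IsSmoothEmb (𝓡 1) (𝓡∂ 2) (lab s)
  lab_inj : ∀ s s' z z', lab s z = lab s' z' → s = s'
  lab_range : ⋃ s, range (lab s) = (𝓡∂ 2).boundary carrier

attribute [instance] Surface.top Surface.t2 Surface.secondCountable Surface.compact Surface.charted
  Surface.smooth

namespace Surface

variable {ι κ : Type} (B : Surface ι κ)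

/-- The incoming boundary circles. -/
abbrev inc (i : ι) : C(Circle, B.carrier) := B.lab (.inl i)

/-- The outgoing boundary circles. -/
abbrev out (j : κ) : C(Circle, B.carrier) := B.lab (.inr j)

instance : StronglyLocallyContractibleSpace B.carrier :=
  have := halfSpace_slc 2
  chartedSpace_slc (EuclideanHalfSpace 2) B.carrier

lemma base_inj : Function.Injective (fun s => B.lab s 1) := fun _ _ h => B.lab_inj _ _ _ _ h

end Surface

section BundleCat

variable {Γ : Type} [Group Γ] {ι κ : Type}

/-- The category of bundles on the surface `B` with holonomies `x` along the incoming and `y` along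
the outgoing circles, all circles being traversed in the direction given by their labels (for an
incoming circle this is the opposite of the boundary orientation). -/
structure BunCat (B : Surface ι κ) (x : ι → Γ) (y : κ → Γ) where
  ρ : Bundle Γ B.carrier
  hol_inc : ∀ i, loopHol (B.inc i) ρ = x i
  hol_out : ∀ j, loopHol (B.out j) ρ = y j

/-- Morphisms are the morphisms of bundles that are trivial at the base points of all boundary
circles. -/
@[ext]
structure BunCat.Hom {B : Surface ι κ} {x : ι → Γ} {y : κ → Γ} (ρ ρ' : BunCat B x y) where
  η : B.carrier → Γ
  isGauge : IsGauge η ρ.ρ ρ'.ρ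
  base : ∀ s, η (B.lab s 1) = 1

instance (B : Surface ι κ) (x : ι → Γ) (y : κ → Γ) : Groupoid (BunCat B x y) where
  Hom := BunCat.Hom
  id ρ := ⟨1, .refl _, fun _ => rfl⟩
  comp f g := ⟨g.η * f.η, f.isGauge.trans g.isGauge, fun s => by simp [f.base, g.base]⟩
  inv f := ⟨f.η⁻¹, f.isGauge.symm, fun s => by simp [f.base]⟩
  id_comp f := BunCat.Hom.ext (mul_one f.η)
  comp_id f := BunCat.Hom.ext (one_mul f.η)
  assoc f g h := BunCat.Hom.ext (mul_assoc h.η g.η f.η).symm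
  inv_comp f := BunCat.Hom.ext (mul_inv_cancel f.η)
  comp_inv f := BunCat.Hom.ext (inv_mul_cancel f.η)

variable {B : Surface ι κ} {x x' : ι → Γ} {y y' : κ → Γ}

/-- There is a morphism of bundles from `ρ` to `ρ'` that takes the values `g` and `h` at the base
points of the incoming and the outgoing circles; in other words, `(g, h)` sends the class of `ρ` to
the class of `ρ'`. -/
def Moves (g : ι → Γ) (h : κ → Γ) (ρ : BunCat B x y) (ρ' : BunCat B x' y') : Prop :=
  ∃ η : B.carrier → Γ, IsGauge η ρ.ρ ρ'.ρ ∧ (∀ i, η (B.inc i 1) = g i) ∧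
    ∀ j, η (B.out j 1) = h j

lemma moves_one {ρ ρ' : BunCat B x y} : Moves 1 1 ρ ρ' ↔ Nonempty (ρ ⟶ ρ') :=
  ⟨fun ⟨η, h, h1, h2⟩ => ⟨⟨η, h, fun s => by cases s <;> simp_all⟩⟩,
    fun ⟨f⟩ => ⟨f.η, f.isGauge, fun _ => f.base _, fun _ => f.base _⟩⟩

lemma Moves.trans {x'' : ι → Γ} {y'' : κ → Γ} {ρ : BunCat B x y} {ρ' : BunCat B x' y'}
    {ρ'' : BunCat B x'' y''} {g g' : ι → Γ} {h h' : κ → Γ} (m : Moves g h ρ ρ')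
    (m' : Moves g' h' ρ' ρ'') : Moves (g' * g) (h' * h) ρ ρ'' := by
  obtain ⟨η, h1, h2, h3⟩ := m
  obtain ⟨η', h1', h2', h3'⟩ := m'
  exact ⟨η' * η, h1.trans h1', fun i => by simp [h2, h2'], fun j => by simp [h3, h3']⟩

lemma Moves.symm {ρ : BunCat B x y} {ρ' : BunCat B x' y'} {g : ι → Γ} {h : κ → Γ}
    (m : Moves g h ρ ρ') : Moves g⁻¹ h⁻¹ ρ' ρ := by
  obtain ⟨η, h1, h2, h3⟩ := m
  exact ⟨η⁻¹, h1.symm, fun i => by simp [h2], fun j => by simp [h3]⟩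

/-- The map `B → Γ` that takes the values `g` and `h` at the base points of the incoming and the
outgoing circles and `1` elsewhere. -/
noncomputable def bdryGauge (B : Surface ι κ) (g : ι → Γ) (h : κ → Γ) : B.carrier → Γ :=
  Function.extend (fun s => B.lab s 1) (Sum.elim g h) 1

lemma bdryGauge_apply (g : ι → Γ) (h : κ → Γ) (s) :
    bdryGauge B g h (B.lab s 1) = Sum.elim g h s := B.base_inj.extend_apply _ _ s

/-- The action of `(g, h)` on bundles. -/
noncomputable def BunCat.shift (g : ι → Γ) (h : κ → Γ) (hx : x' = g * x * g⁻¹)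
    (hy : y' = h * y * h⁻¹) (ρ : BunCat B x y) : BunCat B x' y' where
  ρ := gauge (bdryGauge B g h) ρ.ρ
  hol_inc i := by
    rw [(isGauge_gauge _ ρ.ρ).loopHol, bdryGauge_apply, ρ.hol_inc, hx]; rfl
  hol_out j := by
    rw [(isGauge_gauge _ ρ.ρ).loopHol, bdryGauge_apply, ρ.hol_out, hy]; rfl

lemma moves_shift (g : ι → Γ) (h : κ → Γ) (hx : x' = g * x * g⁻¹) (hy : y' = h * y * h⁻¹)
    (ρ : BunCat B x y) : Moves g h ρ (ρ.shift g h hx hy) :=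
  ⟨_, isGauge_gauge _ _, fun _ => bdryGauge_apply _ _ _, fun _ => bdryGauge_apply _ _ _⟩

lemma gsum_shift {M : Type*} [AddCommMonoid M] [Module ℂ M] (g : ι → Γ) (h : κ → Γ)
    (hx : x' = g * x * g⁻¹) (hy : y' = h * y * h⁻¹) (F : BunCat B x y → M)
    (F' : BunCat B x' y' → M) (H : ∀ ρ ρ', Moves g h ρ ρ' → F' ρ' = F ρ) :
    gsum (BunCat B x' y') F' = gsum (BunCat B x y) F := by
  refine gsum_congr (BunCat.shift g h hx hy) (fun a b => ?_) (fun b => ?_) F F' ?_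
  · have ma : IsGauge (bdryGauge B g h) a.ρ (a.shift g h hx hy).ρ := isGauge_gauge _ _
    have mb : IsGauge (bdryGauge B g h) b.ρ (b.shift g h hx hy).ρ := isGauge_gauge _ _
    exact
      { toFun := fun f => ⟨bdryGauge B g h * f.η * (bdryGauge B g h)⁻¹, by
            simpa [mul_assoc] using ma.symm.trans (f.isGauge.trans mb), fun s => by
            simp [f.base]⟩
        invFun := fun f => ⟨(bdryGauge B g h)⁻¹ * f.η * bdryGauge B g h, by
            simpa [mul_assoc] using ma.trans (f.isGauge.trans mb.symm), fun s => by
            simp [f.base]⟩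
        left_inv := fun f => BunCat.Hom.ext (by simp [mul_assoc])
        right_inv := fun f => BunCat.Hom.ext (by simp [mul_assoc]) }
  · have hx' : x = g⁻¹ * x' * g⁻¹⁻¹ := by rw [hx]; simp [mul_assoc]
    have hy' : y = h⁻¹ * y' * h⁻¹⁻¹ := by rw [hy]; simp [mul_assoc]
    refine ⟨b.shift g⁻¹ h⁻¹ hx' hy', moves_one.1 ?_⟩
    simpa using ((moves_shift g⁻¹ h⁻¹ hx' hy' b).trans (moves_shift g h hx hy _)).symm
  · intro a b hab
    refine H a b ?_
    simpa using (moves_shift g h hx hy a).trans (moves_one.2 hab)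

variable [Finite Γ] [Finite ι] [Finite κ]

instance : Finite (Quotient (isIsomorphicSetoid (BunCat B x y))) := by
  obtain ⟨T, hT, s, t, p, hp⟩ := exists_finite_test (Γ := Γ) B.carrier
    (range fun s => B.lab s 1) (finite_range _)
  refine Finite.of_injective
    (fun (c : Quotient (isIsomorphicSetoid (BunCat B x y))) (i : T) => hol c.out.ρ (p i)) ?_
  intro c c' h
  obtain ⟨η, h1, h2⟩ := hp c.out.ρ c'.out.ρ (fun i => congrFun h i)
  rw [← Quotient.out_eq c, ← Quotient.out_eq c']
  let f : c.out ⟶ c'.out := ⟨η, h1, fun s => h2 _ ⟨s, rfl⟩⟩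
  exact Quotient.sound ⟨⟨f, Groupoid.inv f, by simp, by simp⟩⟩


instance (ρ ρ' : BunCat B x y) : Finite (ρ ⟶ ρ') := by
  obtain ⟨S, hS⟩ := exists_finite_points (Γ := Γ) B.carrier
  refine Finite.of_injective (fun (f : ρ ⟶ ρ') (p : S) => BunCat.Hom.η f p) ?_
  intro f f' h
  exact BunCat.Hom.ext (hS _ _ _ _ f.isGauge f'.isGauge fun p hp => congrFun h ⟨p, hp⟩)

end BundleCat

/-! ### The categories `ℰ^{⊠ ι}` -/

/-- An object of `ℰ^{⊠ ι}`: a finite-dimensional inner product space graded by `Γ^ι`, with a unitary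
action of `Γ^ι` such that `g` maps the summand of degree `x` to that of degree `g x g⁻¹`. -/
structure GrObj (Γ : Type) [Group Γ] (ι : Type) where
  V : (ι → Γ) → Type
  [acg : ∀ x, AddCommGroup (V x)]
  [mod : ∀ x, Module ℂ (V x)]
  [fd : ∀ x, FiniteDimensional ℂ (V x)]
  /-- The inner product. -/
  ip : ∀ x, InnerProductSpace.Core ℂ (V x)
  act : ∀ (g : ι → Γ) {x y : ι → Γ}, y = g * x * g⁻¹ → (V x →ₗ[ℂ] V y)
  act_one : ∀ {x : ι → Γ} (h : x = 1 * x * 1⁻¹) (v : V x), act 1 h v = v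
  act_mul : ∀ (g g' : ι → Γ) {x y z : ι → Γ} (h : y = g * x * g⁻¹) (h' : z = g' * y * g'⁻¹)
    (h'' : z = (g' * g) * x * (g' * g)⁻¹) (v : V x), act g' h' (act g h v) = act (g' * g) h'' v
  act_ip : ∀ (g : ι → Γ) {x y : ι → Γ} (h : y = g * x * g⁻¹) (u v : V x),
    (ip y).inner (act g h u) (act g h v) = (ip x).inner u v

attribute [instance] GrObj.acg GrObj.mod GrObj.fd

section GrObj

variable {Γ : Type} [Group Γ] {ι κ : Type}

/-- Morphisms are the families of linear maps that commute with the action. -/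
@[ext]
structure GrObj.Hom (U U' : GrObj Γ ι) where
  app : ∀ x, U.V x →ₗ[ℂ] U'.V x
  comm : ∀ (g : ι → Γ) {x y : ι → Γ} (h : y = g * x * g⁻¹) (v : U.V x),
    app y (U.act g h v) = U'.act g h (app x v)

instance : Category (GrObj Γ ι) where
  Hom := GrObj.Hom
  id U := ⟨fun _ => LinearMap.id, fun _ _ _ _ _ => rfl⟩
  comp f f' := ⟨fun x => f'.app x ∘ₗ f.app x, fun g x y h v => by
    simp [f.comm, f'.comm]⟩

lemma GrObj.comp_app {U U' U'' : GrObj Γ ι} (f : U ⟶ U') (f' : U' ⟶ U'') (x : ι → Γ) (v : U.V x) :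
    (f ≫ f').app x v = f'.app x (f.app x v) := rfl

lemma GrObj.id_app (U : GrObj Γ ι) (x : ι → Γ) (v : U.V x) : GrObj.Hom.app (𝟙 U) x v = v := rfl

/-! ### The functor of a surface -/

lemma Moves.inc_eq {B : Surface ι κ} {x x' : ι → Γ} {y y' : κ → Γ} {g : ι → Γ} {h : κ → Γ}
    {ρ : BunCat B x y} {ρ' : BunCat B x' y'} (m : Moves g h ρ ρ') : x' = g * x * g⁻¹ := by
  obtain ⟨η, h1, h2, -⟩ := m
  funext i
  have := h1.loopHol (B.inc i)
  rwa [ρ.hol_inc, ρ'.hol_inc, h2] at this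

lemma Moves.out_eq {B : Surface ι κ} {x x' : ι → Γ} {y y' : κ → Γ} {g : ι → Γ} {h : κ → Γ}
    {ρ : BunCat B x y} {ρ' : BunCat B x' y'} (m : Moves g h ρ ρ') : y' = h * y * h⁻¹ := by
  obtain ⟨η, h1, -, h2⟩ := m
  funext i
  have := h1.loopHol (B.out i)
  rwa [ρ.hol_out, ρ'.hol_out, h2] at this

/-- The vector space `(⨁ₓ Uₓ ⊗ ℂ[π₀(BunCat B x y)])` of `Γ^ι`-invariants: its elements are
written as families of vectors `u x ρ ∈ Uₓ`, the coefficient of the class of `ρ`. The condition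
says (for `g = 1`) that `u x ρ` depends only on the class of `ρ` and (for general `g`) that `u` is
invariant. -/
def Sect (B : Surface ι κ) (U : GrObj Γ ι) (y : κ → Γ) :
    Submodule ℂ (∀ x : ι → Γ, BunCat B x y → U.V x) where
  carrier := {u | ∀ (g : ι → Γ) {x x' : ι → Γ} (hx : x' = g * x * g⁻¹) (ρ : BunCat B x y)
    (ρ' : BunCat B x' y), Moves g 1 ρ ρ' → u x' ρ' = U.act g hx (u x ρ)}
  add_mem' hu hv g x x' hx ρ ρ' m := by simp [hu g hx ρ ρ' m, hv g hx ρ ρ' m]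
  zero_mem' g x x' hx ρ ρ' m := by simp
  smul_mem' a u hu g x x' hx ρ ρ' m := by simp [hu g hx ρ ρ' m]

variable {B : Surface ι κ} {U U' : GrObj Γ ι} {x x' : ι → Γ} {y y' : κ → Γ}

lemma Sect.eq_of_iso (u : Sect B U y) {ρ ρ' : BunCat B x y} (h : Nonempty (ρ ⟶ ρ')) :
    u.1 x ρ' = u.1 x ρ := by
  rw [u.2 1 (by simp) ρ ρ' (moves_one.2 h), U.act_one]

/-- The action of `h ∈ Γ^κ` on the family `Sect B U`. -/
noncomputable def Sect.act (h : κ → Γ) (hy : y' = h * y * h⁻¹) : Sect B U y →ₗ[ℂ] Sect B U y' where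
  toFun u := ⟨fun x ρ => u.1 x (ρ.shift 1 h⁻¹ (by simp) (by rw [hy]; simp [mul_assoc])), by
    intro g x x' hx ρ ρ' m
    refine u.2 g hx _ _ ?_
    have hy' : y = h⁻¹ * y' * h⁻¹⁻¹ := by rw [hy]; simp [mul_assoc]
    simpa using ((moves_shift 1 h⁻¹ (by simp) hy' ρ).symm.trans m).trans
      (moves_shift 1 h⁻¹ (by simp) hy' ρ')⟩
  map_add' _ _ := rfl
  map_smul' _ _ := rfl

lemma Sect.act_apply (h : κ → Γ) (hy : y' = h * y * h⁻¹) (u : Sect B U y) {g : ι → Γ}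
    (hx : x' = g * x * g⁻¹) {ρ : BunCat B x y} {ρ' : BunCat B x' y'} (m : Moves g h ρ ρ') :
    (Sect.act h hy u).1 x' ρ' = U.act g hx (u.1 x ρ) := by
  have hy' : y = h⁻¹ * y' * h⁻¹⁻¹ := by rw [hy]; simp [mul_assoc]
  refine u.2 g hx _ _ ?_
  simpa using m.trans (moves_shift 1 h⁻¹ (by simp) hy' ρ')

variable [Finite Γ] [Finite ι] [Finite κ]

/-- The inner product on `Sect B U y`: the sum over the degrees `x` and over the classes of
bundles, with the factor `1 / #Γ^ι` and, for surfaces with closed components, with each class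
weighted by the inverse of the order of its automorphism group. -/
@[reducible]
noncomputable def Sect.ip (B : Surface ι κ) (U : GrObj Γ ι) (y : κ → Γ) :
    InnerProductSpace.Core ℂ (Sect B U y) where
  inner u v := (Nat.card (ι → Γ) : ℂ)⁻¹ *
    ∑ᶠ x, gsum (BunCat B x y) fun ρ => (U.ip x).inner (u.1 x ρ) (v.1 x ρ)
  conj_inner_symm u v := by
    classical
    simp only [gsum, map_mul, map_inv₀, Complex.conj_natCast]
    congr 1
    let _ := Fintype.ofFinite (ι → Γ)
    rw [finsum_eq_sum_of_fintype, finsum_eq_sum_of_fintype, map_sum]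
    refine Finset.sum_congr rfl fun x _ => ?_
    let _ := Fintype.ofFinite (Quotient (isIsomorphicSetoid (BunCat B x y)))
    rw [finsum_eq_sum_of_fintype, finsum_eq_sum_of_fintype, map_sum]
    refine Finset.sum_congr rfl fun c _ => ?_
    simp [(U.ip x).conj_inner_symm]
  re_inner_nonneg u := by
    let _ := Fintype.ofFinite (ι → Γ)
    rw [finsum_eq_sum_of_fintype]
    have h1 : ((Nat.card (ι → Γ) : ℂ)⁻¹) = (((Nat.card (ι → Γ) : ℝ)⁻¹ : ℝ) : ℂ) := by simp
    rw [h1]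
    change 0 ≤ Complex.re _
    rw [Complex.re_ofReal_mul, Complex.re_sum]
    refine mul_nonneg (by positivity) (Finset.sum_nonneg fun x _ => ?_)
    rw [gsum]
    let _ := Fintype.ofFinite (Quotient (isIsomorphicSetoid (BunCat B x y)))
    rw [finsum_eq_sum_of_fintype, Complex.re_sum]
    refine Finset.sum_nonneg fun c _ => ?_
    have h2 : ((Nat.card (c.out ⟶ c.out) : ℂ)⁻¹) =
      (((Nat.card (c.out ⟶ c.out) : ℝ)⁻¹ : ℝ) : ℂ) := by simp
    rw [h2, smul_eq_mul, Complex.re_ofReal_mul]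
    exact mul_nonneg (by positivity) ((U.ip x).re_inner_nonneg _)
  add_left u v w := by
    rw [← mul_add]
    congr 1
    let _ := Fintype.ofFinite (ι → Γ)
    rw [finsum_eq_sum_of_fintype, finsum_eq_sum_of_fintype, finsum_eq_sum_of_fintype,
      ← Finset.sum_add_distrib]
    refine Finset.sum_congr rfl fun x _ => ?_
    let _ := Fintype.ofFinite (Quotient (isIsomorphicSetoid (BunCat B x y)))
    rw [gsum, gsum, gsum, finsum_eq_sum_of_fintype, finsum_eq_sum_of_fintype,
      finsum_eq_sum_of_fintype, ← Finset.sum_add_distrib]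
    refine Finset.sum_congr rfl fun c _ => ?_
    simp [(U.ip x).add_left, mul_add]
  smul_left u v r := by
    rw [mul_left_comm]
    congr 1
    let _ := Fintype.ofFinite (ι → Γ)
    rw [finsum_eq_sum_of_fintype, finsum_eq_sum_of_fintype, Finset.mul_sum]
    refine Finset.sum_congr rfl fun x _ => ?_
    let _ := Fintype.ofFinite (Quotient (isIsomorphicSetoid (BunCat B x y)))
    rw [gsum, gsum, finsum_eq_sum_of_fintype, finsum_eq_sum_of_fintype, Finset.mul_sum]
    refine Finset.sum_congr rfl fun c _ => ?_
    simp [(U.ip x).smul_left, mul_left_comm]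
  definite u hu := by
    let _ := Fintype.ofFinite (ι → Γ)
    have hre : ∀ x (v : U.V x), (U.ip x).inner v v = (((U.ip x).inner v v).re : ℂ) := fun x v =>
      (Complex.conj_eq_iff_real.1 ((U.ip x).conj_inner_symm v v)).elim fun r hr => by
        rw [hr, Complex.ofReal_re]
    have hN : (Nat.card (ι → Γ) : ℂ)⁻¹ ≠ 0 := by simp
    have h0 := (mul_eq_zero.1 hu).resolve_left hN
    rw [finsum_eq_sum_of_fintype] at h0
    have hterm : ∀ x, 0 ≤ (gsum (BunCat B x y) fun ρ => (U.ip x).inner (u.1 x ρ) (u.1 x ρ)).re ∧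
        ((gsum (BunCat B x y) fun ρ => (U.ip x).inner (u.1 x ρ) (u.1 x ρ)).re = 0 →
          ∀ ρ, u.1 x ρ = 0) := by
      intro x
      let _ := Fintype.ofFinite (Quotient (isIsomorphicSetoid (BunCat B x y)))
      rw [gsum, finsum_eq_sum_of_fintype, Complex.re_sum]
      have hc : ∀ c : Quotient (isIsomorphicSetoid (BunCat B x y)),
          (((Nat.card (c.out ⟶ c.out) : ℂ)⁻¹) • (U.ip x).inner (u.1 x c.out) (u.1 x c.out)).re =
          (Nat.card (c.out ⟶ c.out) : ℝ)⁻¹ * ((U.ip x).inner (u.1 x c.out) (u.1 x c.out)).re := by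
        intro c
        have h2 : ((Nat.card (c.out ⟶ c.out) : ℂ)⁻¹) =
          (((Nat.card (c.out ⟶ c.out) : ℝ)⁻¹ : ℝ) : ℂ) := by simp
        rw [h2, smul_eq_mul, Complex.re_ofReal_mul]
      have hnn : ∀ c : Quotient (isIsomorphicSetoid (BunCat B x y)),
          0 ≤ (((Nat.card (c.out ⟶ c.out) : ℂ)⁻¹) •
            (U.ip x).inner (u.1 x c.out) (u.1 x c.out)).re := fun c => by
        rw [hc]; exact mul_nonneg (by positivity) ((U.ip x).re_inner_nonneg _)
      refine ⟨Finset.sum_nonneg fun c _ => hnn c, fun h ρ => ?_⟩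
      have h3 := (Finset.sum_eq_zero_iff_of_nonneg fun c _ => hnn c).1 h
        (Quotient.mk _ ρ) (Finset.mem_univ _)
      rw [hc] at h3
      set c : Quotient (isIsomorphicSetoid (BunCat B x y)) := Quotient.mk _ ρ with hcdef
      have hne : Nonempty (c.out ⟶ c.out) := ⟨𝟙 _⟩
      have h4 := (mul_eq_zero.1 h3).resolve_left (by simp [Nat.card_pos.ne'])
      have h5 : u.1 x c.out = 0 := (U.ip x).definite _ (by rw [hre, h4]; simp)
      have h6 := Quotient.mk_out (s := isIsomorphicSetoid (BunCat B x y)) ρ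
      rw [Sect.eq_of_iso u ⟨h6.some.hom⟩, h5]
    have h7 := congrArg Complex.re h0
    rw [Complex.re_sum, Complex.zero_re,
      Finset.sum_eq_zero_iff_of_nonneg fun x _ => (hterm x).1] at h7
    ext x ρ
    exact (hterm x).2 (h7 x (Finset.mem_univ _)) ρ

instance : FiniteDimensional ℂ (Sect B U y) := by
  let _ := Fintype.ofFinite (ι → Γ)
  let _ := fun x => Fintype.ofFinite (Quotient (isIsomorphicSetoid (BunCat B x y)))
  let f : Sect B U y →ₗ[ℂ]
      (∀ x, Quotient (isIsomorphicSetoid (BunCat B x y)) → U.V x) :=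
    { toFun := fun u x c => u.1 x c.out
      map_add' := fun _ _ => rfl
      map_smul' := fun _ _ => rfl }
  refine FiniteDimensional.of_injective f fun u v h => ?_
  ext x ρ
  have h6 := Quotient.mk_out (s := isIsomorphicSetoid (BunCat B x y)) ρ
  rw [Sect.eq_of_iso u ⟨h6.some.hom⟩, Sect.eq_of_iso v ⟨h6.some.hom⟩]
  exact congrFun (congrFun h x) _

/-- The object `Ẑ(B)(U)` of `ℰ^{⊠ κ}`. -/
noncomputable def ZhatObj (B : Surface ι κ) (U : GrObj Γ ι) : GrObj Γ κ where
  V y := Sect B U y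
  ip y := Sect.ip B U y
  act h _ _ hy := Sect.act h hy
  act_one {y} hy u := by
    ext x ρ
    rw [Sect.act_apply 1 hy u (g := 1) (by simp) (moves_one.2 ⟨𝟙 ρ⟩), U.act_one]
  act_mul h h' {y y' y''} hy hy' hy'' u := by
    ext x ρ
    have e1 : y' = h'⁻¹ * y'' * h'⁻¹⁻¹ := by rw [hy']; simp [mul_assoc]
    have e2 : y = h⁻¹ * y' * h⁻¹⁻¹ := by rw [hy]; simp [mul_assoc]
    have e3 : x = 1 * x * 1⁻¹ := by simp
    have m1 := (moves_shift 1 h'⁻¹ e3 e1 ρ).symm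
    have m2 := (moves_shift 1 h⁻¹ e3 e2 (ρ.shift 1 h'⁻¹ e3 e1)).symm
    simp only [inv_one, inv_inv] at m1 m2
    rw [Sect.act_apply h' hy' _ e3 m1, Sect.act_apply h hy _ e3 m2,
      Sect.act_apply (h' * h) hy'' _ e3 (by simpa using m2.trans m1), U.act_one]
  act_ip h {y y'} hy u v := by
    change _ * _ = _ * _
    congr 1
    refine finsum_congr fun x => ?_
    refine gsum_shift 1 h (by simp) hy _ _ fun ρ ρ' m => ?_
    rw [Sect.act_apply h hy u (by simp) m, Sect.act_apply h hy v (by simp) m, U.act_ip]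

/-- The morphism `Ẑ(B)(f)`. -/
noncomputable def ZhatMap (B : Surface ι κ) (f : U ⟶ U') : ZhatObj B U ⟶ ZhatObj B U' where
  app y :=
    { toFun := fun (u : Sect B U y) => (⟨fun x ρ => f.app x (u.1 x ρ), fun g x x' hx ρ ρ' m => by
        rw [← f.comm, ← u.2 g hx ρ ρ' m]⟩ : Sect B U' y)
      map_add' := fun u v => Subtype.ext (by funext x ρ; exact map_add _ _ _)
      map_smul' := fun r u => Subtype.ext (by funext x ρ; exact map_smul _ _ _) }
  comm _ _ _ _ _ := rfl

/-- The functor `Ẑ(B) : ℰ^{⊠ ι} ⥤ ℰ^{⊠ κ}` of the surface `B`. -/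
noncomputable def Zhat (Γ : Type) [Group Γ] [Finite Γ] (B : Surface ι κ) :
    GrObj Γ ι ⥤ GrObj Γ κ where
  obj U := ZhatObj B U
  map f := ZhatMap B f
  map_id _ := rfl
  map_comp _ _ := rfl

end GrObj

/-! ### `⟨2⟩`-3-manifolds -/

/-- A `⟨2⟩`-3-manifold: a compact smooth 3-manifold with corners whose boundary is decomposed into
two horizontal faces `h1 : A_{d,1} → A_{d,2}`, `h2 : A_{u,1} → A_{u,2}` and two vertical faces
`v1 : A_{d,1} → A_{u,1}`, `v2 : A_{d,2} → A_{u,2}`, where the components of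
`A_{d,1}, A_{d,2}, A_{u,1}, A_{u,2}` are indexed by `a, b, c, d`. -/
structure CornerMfd {a b c d : Type} (h1 : Surface a b) (h2 : Surface c d) (v1 : Surface a c)
    (v2 : Surface b d) where
  carrier : Type
  [top : TopologicalSpace carrier]
  [t2 : T2Space carrier]
  [secondCountable : SecondCountableTopology carrier]
  [compact : CompactSpace carrier]
  [charted : ChartedSpace (EuclideanQuadrant 3) carrier]
  [smooth : IsManifold (modelWithCornersEuclideanQuadrant 3) ∞ carrier]
  /-- The inclusions of the faces. -/
  ih1 : C(h1.carrier, carrier)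
  ih2 : C(h2.carrier, carrier)
  iv1 : C(v1.carrier, carrier)
  iv2 : C(v2.carrier, carrier)
  ih1_emb : IsSmoothEmb (𝓡∂ 2) (modelWithCornersEuclideanQuadrant 3) ih1
  ih2_emb : IsSmoothEmb (𝓡∂ 2) (modelWithCornersEuclideanQuadrant 3) ih2
  iv1_emb : IsSmoothEmb (𝓡∂ 2) (modelWithCornersEuclideanQuadrant 3) iv1
  iv2_emb : IsSmoothEmb (𝓡∂ 2) (modelWithCornersEuclideanQuadrant 3) iv2
  /-- The two horizontal faces are disjoint, and so are the two vertical ones. -/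
  h_disjoint : ∀ p q, ih1 p ≠ ih2 q
  v_disjoint : ∀ p q, iv1 p ≠ iv2 q
  /-- A horizontal and a vertical face share the labelled circles of `A_{d,1}`, `A_{d,2}`,
  `A_{u,1}` and `A_{u,2}`, respectively, ... -/
  d1 : ∀ i z, ih1 (h1.inc i z) = iv1 (v1.inc i z)
  d2 : ∀ i z, ih1 (h1.out i z) = iv2 (v2.inc i z)
  u1 : ∀ i z, ih2 (h2.inc i z) = iv1 (v1.out i z)
  u2 : ∀ i z, ih2 (h2.out i z) = iv2 (v2.out i z)
  /-- ... and nothing else. -/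
  d1_only : ∀ p q, ih1 p = iv1 q → ∃ i z, p = h1.inc i z ∧ q = v1.inc i z
  d2_only : ∀ p q, ih1 p = iv2 q → ∃ i z, p = h1.out i z ∧ q = v2.inc i z
  u1_only : ∀ p q, ih2 p = iv1 q → ∃ i z, p = h2.inc i z ∧ q = v1.out i z
  u2_only : ∀ p q, ih2 p = iv2 q → ∃ i z, p = h2.out i z ∧ q = v2.out i z
  /-- In suitable smooth charts with values in `[0, ∞)³` the horizontal faces are given by the
  vanishing of the first coordinate, the vertical faces by the vanishing of the second one, and
  there are no other boundary points. -/
  faces : ∀ p : carrier,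
    ∃ e ∈ IsManifold.maximalAtlas (modelWithCornersEuclideanQuadrant 3) ∞ carrier,
      p ∈ e.source ∧ ∀ q ∈ e.source,
        (q ∈ range ih1 ∪ range ih2 ↔ (e q).1 0 = 0) ∧
        (q ∈ range iv1 ∪ range iv2 ↔ (e q).1 1 = 0) ∧ 0 < (e q).1 2

attribute [instance] CornerMfd.top CornerMfd.t2 CornerMfd.secondCountable CornerMfd.compact
  CornerMfd.charted CornerMfd.smooth

section Invariant

variable {Γ : Type} [Group Γ] {a b c d : Type} {h1 : Surface a b} {h2 : Surface c d}
  {v1 : Surface a c} {v2 : Surface b d}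

/-- The category of bundles on `C` with prescribed restriction to the boundary: the objects are
bundles `ρ` on `C` together with an isomorphism of the restriction of `ρ` to `∂ C` with the bundle
that is `φ` on `h1`, `ψ` on `v2`, `φ'` on `v1` and `ψ'` on `h2`. The four parts of that isomorphism
agree at the base points of the circles along which the four faces meet. -/
structure Filling (C : CornerMfd h1 h2 v1 v2) {x : a → Γ} {y : b → Γ} {y' : c → Γ} {z : d → Γ}
    (φ : BunCat h1 x y) (ψ : BunCat v2 y z) (φ' : BunCat v1 x y') (ψ' : BunCat h2 y' z) where
  ρ : Bundle Γ C.carrier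
  θh1 : h1.carrier → Γ
  θv2 : v2.carrier → Γ
  θv1 : v1.carrier → Γ
  θh2 : h2.carrier → Γ
  gh1 : IsGauge θh1 (pull C.ih1 ρ) φ.ρ
  gv2 : IsGauge θv2 (pull C.iv2 ρ) ψ.ρ
  gv1 : IsGauge θv1 (pull C.iv1 ρ) φ'.ρ
  gh2 : IsGauge θh2 (pull C.ih2 ρ) ψ'.ρ
  d1 : ∀ i, θh1 (h1.inc i 1) = θv1 (v1.inc i 1)
  d2 : ∀ i, θh1 (h1.out i 1) = θv2 (v2.inc i 1)
  u1 : ∀ i, θh2 (h2.inc i 1) = θv1 (v1.out i 1)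
  u2 : ∀ i, θh2 (h2.out i 1) = θv2 (v2.out i 1)

variable {C : CornerMfd h1 h2 v1 v2} {x x' : a → Γ} {y y₁ : b → Γ} {y' y₁' : c → Γ} {z z' : d → Γ}

/-- Morphisms are the morphisms of bundles on `C` that are compatible with the isomorphisms on the
boundary. -/
@[ext]
structure Filling.Hom {φ : BunCat h1 x y} {ψ : BunCat v2 y z} {φ' : BunCat v1 x y'}
    {ψ' : BunCat h2 y' z} (P Q : Filling C φ ψ φ' ψ') where
  η : C.carrier → Γ
  isGauge : IsGauge η P.ρ Q.ρ
  ch1 : ∀ p, Q.θh1 p * η (C.ih1 p) = P.θh1 p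
  cv2 : ∀ p, Q.θv2 p * η (C.iv2 p) = P.θv2 p
  cv1 : ∀ p, Q.θv1 p * η (C.iv1 p) = P.θv1 p
  ch2 : ∀ p, Q.θh2 p * η (C.ih2 p) = P.θh2 p

instance (φ : BunCat h1 x y) (ψ : BunCat v2 y z) (φ' : BunCat v1 x y') (ψ' : BunCat h2 y' z) :
    Groupoid (Filling C φ ψ φ' ψ') where
  Hom := Filling.Hom
  id P := ⟨1, .refl _, fun _ => mul_one _, fun _ => mul_one _, fun _ => mul_one _,
    fun _ => mul_one _⟩
  comp f g := ⟨g.η * f.η, f.isGauge.trans g.isGauge,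
    fun p => by rw [← f.ch1, ← g.ch1]; exact (mul_assoc _ _ _).symm,
    fun p => by rw [← f.cv2, ← g.cv2]; exact (mul_assoc _ _ _).symm,
    fun p => by rw [← f.cv1, ← g.cv1]; exact (mul_assoc _ _ _).symm,
    fun p => by rw [← f.ch2, ← g.ch2]; exact (mul_assoc _ _ _).symm⟩
  inv f := ⟨f.η⁻¹, f.isGauge.symm, fun p => by simp [← f.ch1], fun p => by simp [← f.cv2],
    fun p => by simp [← f.cv1], fun p => by simp [← f.ch2]⟩
  id_comp f := Filling.Hom.ext (mul_one f.η)
  comp_id f := Filling.Hom.ext (one_mul f.η)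
  assoc f g h := Filling.Hom.ext (mul_assoc h.η g.η f.η).symm
  inv_comp f := Filling.Hom.ext (mul_inv_cancel f.η)
  comp_inv f := Filling.Hom.ext (inv_mul_cancel f.η)

/-- The number of isomorphism classes of fillings; if `C` has closed components, then fillings may
have nontrivial automorphisms, and each class counts with the inverse of the order of its
automorphism group. -/
noncomputable def Y (C : CornerMfd h1 h2 v1 v2) (φ : BunCat h1 x y) (ψ : BunCat v2 y z)
    (φ' : BunCat v1 x y') (ψ' : BunCat h2 y' z) : ℂ :=
  gsum (Filling C φ ψ φ' ψ') fun _ => 1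

lemma Y_congr {φ : BunCat h1 x y} {ψ : BunCat v2 y z} {φ' : BunCat v1 x y'} {ψ' : BunCat h2 y' z}
    {φ₁ : BunCat h1 x' y₁} {ψ₁ : BunCat v2 y₁ z'} {φ₁' : BunCat v1 x' y₁'} {ψ₁' : BunCat h2 y₁' z'}
    {g : a → Γ} {k : b → Γ} {m : c → Γ} {l : d → Γ} (hφ : Moves g k φ φ₁) (hψ : Moves k l ψ ψ₁)
    (hφ' : Moves g m φ' φ₁') (hψ' : Moves m l ψ' ψ₁') : Y C φ₁ ψ₁ φ₁' ψ₁' = Y C φ ψ φ' ψ' := by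
  obtain ⟨α, α1, α2, α3⟩ := hφ
  obtain ⟨β, β1, β2, β3⟩ := hψ
  obtain ⟨α', α1', α2', α3'⟩ := hφ'
  obtain ⟨β', β1', β2', β3'⟩ := hψ'
  let Φ : Filling C φ ψ φ' ψ' → Filling C φ₁ ψ₁ φ₁' ψ₁' := fun P =>
    { ρ := P.ρ
      θh1 := α * P.θh1
      θv2 := β * P.θv2
      θv1 := α' * P.θv1
      θh2 := β' * P.θh2
      gh1 := P.gh1.trans α1
      gv2 := P.gv2.trans β1
      gv1 := P.gv1.trans α1'
      gh2 := P.gh2.trans β1'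
      d1 := fun i => by simp [P.d1, α2, α2']
      d2 := fun i => by simp [P.d2, α3, β2]
      u1 := fun i => by simp [P.u1, β2', α3']
      u2 := fun i => by simp [P.u2, β3', β3] }
  refine gsum_congr Φ (fun P Q => ?_) (fun Q => ?_) _ _ fun _ _ _ => rfl
  · exact
      { toFun := fun f => ⟨f.η, f.isGauge, fun p => by simp [Φ, ← f.ch1, mul_assoc],
          fun p => by simp [Φ, ← f.cv2, mul_assoc], fun p => by simp [Φ, ← f.cv1, mul_assoc],
          fun p => by simp [Φ, ← f.ch2, mul_assoc]⟩
        invFun := fun f => ⟨f.η, f.isGauge, fun p => by simpa [Φ, mul_assoc] using f.ch1 p,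
          fun p => by simpa [Φ, mul_assoc] using f.cv2 p,
          fun p => by simpa [Φ, mul_assoc] using f.cv1 p,
          fun p => by simpa [Φ, mul_assoc] using f.ch2 p⟩
        left_inv := fun _ => rfl
        right_inv := fun _ => rfl }
  · refine ⟨
      { ρ := Q.ρ
        θh1 := α⁻¹ * Q.θh1
        θv2 := β⁻¹ * Q.θv2
        θv1 := α'⁻¹ * Q.θv1
        θh2 := β'⁻¹ * Q.θh2
        gh1 := Q.gh1.trans α1.symm
        gv2 := Q.gv2.trans β1.symm
        gv1 := Q.gv1.trans α1'.symm
        gh2 := Q.gh2.trans β1'.symm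
        d1 := fun i => by simp [Q.d1, α2, α2']
        d2 := fun i => by simp [Q.d2, α3, β2]
        u1 := fun i => by simp [Q.u1, β2', α3']
        u2 := fun i => by simp [Q.u2, β3', β3] }, ⟨⟨1, .refl _, ?_, ?_, ?_, ?_⟩⟩⟩ <;>
    · intro p; simp [Φ]

/-- The value of the invariant of `C` on `f`: the coefficient of `(φ', ψ')`. The sum extends over
the classes of pairs `(φ, ψ)` up to the action of `Γ^b`, which is expressed by a sum over all
`y`, `[φ]`, `[ψ]` and the factor `1 / #Γ^b`. -/
noncomputable def dwVal (C : CornerMfd h1 h2 v1 v2) {U : GrObj Γ a}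
    [Finite Γ] [Finite a] [Finite b] (f : Sect v2 (ZhatObj h1 U) z)
    (φ' : BunCat v1 x y') (ψ' : BunCat h2 y' z) : U.V x :=
  (Nat.card (b → Γ) : ℂ)⁻¹ • ∑ᶠ y : b → Γ, gsum (BunCat h1 x y) fun φ =>
    gsum (BunCat v2 y z) fun ψ => Y C φ ψ φ' ψ' • (f.1 y ψ).1 x φ

variable [Finite Γ] [Finite a] [Finite b] [Finite c] [Finite d] {U U' : GrObj Γ a}

lemma gsum_map {B : Surface a b} {M N : Type*} [AddCommGroup M] [Module ℂ M] [AddCommGroup N]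
    [Module ℂ N] (f : M →ₗ[ℂ] N) (F : BunCat B x y → M) :
    f (gsum _ F) = gsum _ fun ρ => f (F ρ) := by
  let _ := Fintype.ofFinite (Quotient (isIsomorphicSetoid (BunCat B x y)))
  rw [gsum, gsum, finsum_eq_sum_of_fintype, finsum_eq_sum_of_fintype, map_sum]
  simp

lemma gsum_add {B : Surface a b} {M : Type*} [AddCommGroup M] [Module ℂ M]
    (F G : BunCat B x y → M) : gsum _ (fun ρ => F ρ + G ρ) = gsum _ F + gsum _ G := by
  let _ := Fintype.ofFinite (Quotient (isIsomorphicSetoid (BunCat B x y)))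
  rw [gsum, gsum, gsum, finsum_eq_sum_of_fintype, finsum_eq_sum_of_fintype,
    finsum_eq_sum_of_fintype, ← Finset.sum_add_distrib]
  simp

lemma dwVal_map {U : GrObj Γ a} {W : Type} [AddCommGroup W] [Module ℂ W] (L : U.V x →ₗ[ℂ] W)
    (f : Sect v2 (ZhatObj h1 U) z) (φ' : BunCat v1 x y') (ψ' : BunCat h2 y' z) :
    L (dwVal C f φ' ψ') = (Nat.card (b → Γ) : ℂ)⁻¹ • ∑ᶠ y : b → Γ, gsum (BunCat h1 x y) fun φ =>
      gsum (BunCat v2 y z) fun ψ => Y C φ ψ φ' ψ' • L ((f.1 y ψ).1 x φ) := by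
  let _ := Fintype.ofFinite (b → Γ)
  rw [dwVal, map_smul, finsum_eq_sum_of_fintype, finsum_eq_sum_of_fintype, map_sum]
  simp only [gsum_map, map_smul]

lemma dwVal_rel {f : Sect v2 (ZhatObj h1 U) z} {f₁ : Sect v2 (ZhatObj h1 U) z'} {l : d → Γ}
    (hz : z' = l * z * l⁻¹)
    (hf : ∀ (y : b → Γ) (ψ : BunCat v2 y z) (ψ₁ : BunCat v2 y z'), Moves 1 l ψ ψ₁ →
      f₁.1 y ψ₁ = f.1 y ψ)
    {g : a → Γ} {m : c → Γ} (hx : x' = g * x * g⁻¹) {φ' : BunCat v1 x y'} {φ₁' : BunCat v1 x' y₁'}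
    {ψ' : BunCat h2 y' z} {ψ₁' : BunCat h2 y₁' z'} (hφ' : Moves g m φ' φ₁')
    (hψ' : Moves m l ψ' ψ₁') : dwVal C f₁ φ₁' ψ₁' = U.act g hx (dwVal C f φ' ψ') := by
  rw [dwVal_map, dwVal]
  congr 1
  refine finsum_congr fun y => ?_
  refine gsum_shift g 1 hx (by simp) _ _ fun φ φ₁ mφ => ?_
  refine gsum_shift 1 l (by simp) hz _ _ fun ψ ψ₁ mψ => ?_
  rw [Y_congr mφ mψ hφ' hψ', hf y ψ ψ₁ mψ, (f.1 y ψ).2 g hx φ φ₁ mφ]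

lemma Sect.move_out (f : Sect v2 (ZhatObj h1 U) z) (l : d → Γ) (hz : z' = l * z * l⁻¹)
    {y : b → Γ} {ψ : BunCat v2 y z} {ψ₁ : BunCat v2 y z'} (m : Moves 1 l ψ ψ₁) :
    (Sect.act l hz f).1 y ψ₁ = f.1 y ψ := by
  rw [Sect.act_apply l hz f (by simp) m, GrObj.act_one]

/-- The value of `Z(C)` on `f` at `ψ'`, an element of `Ẑ(v1)(U)`. -/
noncomputable def dwInner (C : CornerMfd h1 h2 v1 v2) (f : Sect v2 (ZhatObj h1 U) z)
    (ψ' : BunCat h2 y' z) : Sect v1 U y' :=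
  ⟨fun _ φ' => dwVal C f φ' ψ', fun _ _ _ hx _ _ m => dwVal_rel (l := 1) (by simp)
    (fun _ _ _ mψ => Sect.eq_of_iso f (moves_one.1 mψ)) hx m (moves_one.2 ⟨𝟙 ψ'⟩)⟩

/-- The linear map given by `Z(C)` in degree `z`. -/
noncomputable def dwApp (C : CornerMfd h1 h2 v1 v2) (U : GrObj Γ a) (z : d → Γ) :
    Sect v2 (ZhatObj h1 U) z →ₗ[ℂ] Sect h2 (ZhatObj v1 U) z where
  toFun f := ⟨fun _ ψ' => dwInner C f ψ', fun m y' y₁' hy' ψ' ψ₁' hm => Subtype.ext (by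
    funext x φ₁'
    have e1 : y' = m⁻¹ * y₁' * m⁻¹⁻¹ := by rw [hy']; simp [mul_assoc]
    have e2 : x = 1 * x * 1⁻¹ := by simp
    have h := (moves_shift 1 m⁻¹ e2 e1 φ₁').symm
    rw [inv_one, inv_inv] at h
    exact (dwVal_rel (l := 1) (by simp) (fun y ψ ψ₁ mψ => Sect.eq_of_iso f (moves_one.1 mψ))
      e2 h hm).trans (Sect.act_apply m hy' (dwInner C f ψ') e2 h).symm)⟩
  map_add' f f' := Subtype.ext (by
    funext y' ψ'
    refine Subtype.ext ?_
    funext x φ'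
    change dwVal C (f + f') φ' ψ' = dwVal C f φ' ψ' + dwVal C f' φ' ψ'
    let _ := Fintype.ofFinite (b → Γ)
    unfold dwVal
    rw [← smul_add, finsum_eq_sum_of_fintype, finsum_eq_sum_of_fintype,
      finsum_eq_sum_of_fintype, ← Finset.sum_add_distrib]
    simp only [← gsum_add, ← smul_add]
    rfl)
  map_smul' r f := Subtype.ext (by
    funext y' ψ'
    refine Subtype.ext ?_
    funext x φ'
    exact (dwVal_map (C := C) (r • LinearMap.id : U.V x →ₗ[ℂ] U.V x) f φ' ψ').symm)

/-- The Dijkgraaf-Witten invariant of `C`, a natural transformation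
`Z(C) : Ẑ(v2) ∘ Ẑ(h1) ⟶ Ẑ(h2) ∘ Ẑ(v1)`. -/
noncomputable def dw (Γ : Type) [Group Γ] [Finite Γ] (C : CornerMfd h1 h2 v1 v2) :
    Zhat Γ h1 ⋙ Zhat Γ v2 ⟶ Zhat Γ v1 ⋙ Zhat Γ h2 where
  app U :=
    { app := fun z => dwApp C U z
      comm := fun l {z z'} hz f => Subtype.ext (by
        funext y' ψ₁'
        refine Subtype.ext ?_
        funext x φ'
        have e1 : z = l⁻¹ * z' * l⁻¹⁻¹ := by rw [hz]; simp [mul_assoc]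
        have e2 : y' = 1 * y' * 1⁻¹ := by simp
        have h := (moves_shift 1 l⁻¹ e2 e1 ψ₁').symm
        rw [inv_one, inv_inv] at h
        have e3 : x = 1 * x * 1⁻¹ := by simp
        refine (dwVal_rel (f := f) (f₁ := Sect.act l hz f) hz
          (fun y ψ ψ₁ mψ => Sect.move_out f l hz mψ) e3 (moves_one.2 ⟨𝟙 φ'⟩) h).trans ?_
        exact U.act_one e3 _) }
  naturality U U' F := by
    apply GrObj.Hom.ext
    funext z
    refine LinearMap.ext fun f => Subtype.ext ?_
    funext y' ψ'
    refine Subtype.ext ?_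
    funext x φ'
    exact (dwVal_map (C := C) (F.app x) f φ' ψ').symm

end Invariant

/-! ### Restriction of bundles to pieces -/

section Restrict

variable {Γ : Type} [Group Γ] {ι κ ι' κ' : Type} {B : Surface ι κ} {W : Surface ι' κ'}

/-- The pullback of a bundle on `W` along a map `B → W`, with the resulting holonomies. -/
noncomputable def restrict (f : C(B.carrier, W.carrier)) {x : ι → Γ} {y : κ → Γ}
    (ρ : Bundle Γ W.carrier) (hx : ∀ i, loopHol (f.comp (B.inc i)) ρ = x i)
    (hy : ∀ j, loopHol (f.comp (B.out j)) ρ = y j) : BunCat B x y :=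
  ⟨pull f ρ, hx, hy⟩

lemma moves_restrict (f : C(B.carrier, W.carrier)) {x x₁ : ι → Γ} {y y₁ : κ → Γ}
    {ρ ρ₁ : Bundle Γ W.carrier} {η : W.carrier → Γ} (h : IsGauge η ρ ρ₁)
    (hx : ∀ i, loopHol (f.comp (B.inc i)) ρ = x i) (hy : ∀ j, loopHol (f.comp (B.out j)) ρ = y j)
    (hx₁ : ∀ i, loopHol (f.comp (B.inc i)) ρ₁ = x₁ i)
    (hy₁ : ∀ j, loopHol (f.comp (B.out j)) ρ₁ = y₁ j) :
    Moves (fun i => η (f (B.inc i 1))) (fun j => η (f (B.out j 1))) (restrict f ρ hx hy)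
      (restrict f ρ₁ hx₁ hy₁) :=
  ⟨fun p => η (f p), h.pull f, fun _ => rfl, fun _ => rfl⟩

lemma Moves.of_eq {x x₁ : ι → Γ} {y y₁ : κ → Γ} {ρ : BunCat B x y} {ρ₁ : BunCat B x₁ y₁}
    {g g' : ι → Γ} {h h' : κ → Γ} (m : Moves g h ρ ρ₁) (hg : ∀ i, g i = g' i)
    (hh : ∀ j, h j = h' j) : Moves g' h' ρ ρ₁ := by
  obtain rfl : g = g' := funext hg
  obtain rfl : h = h' := funext hh
  exact m

end Restrict

/-! ### Diffeomorphisms -/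

/-- A diffeomorphism of surfaces that preserves the labels of the boundary circles. -/
structure SurfDiffeo {ι κ : Type} (B B' : Surface ι κ) where
  toDiffeo : B.carrier ≃ₘ⟮𝓡∂ 2, 𝓡∂ 2⟯ B'.carrier
  lab : ∀ s z, toDiffeo (B.lab s z) = B'.lab s z

namespace SurfDiffeo

variable {Γ : Type} [Group Γ] {ι κ : Type} {B B' : Surface ι κ} (f : SurfDiffeo B B')

/-- The underlying continuous map. -/
noncomputable def toMap : C(B.carrier, B'.carrier) := ⟨f.toDiffeo, f.toDiffeo.continuous⟩

lemma comp_lab (s) : f.toMap.comp (B.lab s) = B'.lab s := ContinuousMap.ext (f.lab s)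

/-- The pullback of bundles along `f`. -/
noncomputable def pullback {x : ι → Γ} {y : κ → Γ} (ρ : BunCat B' x y) : BunCat B x y :=
  restrict f.toMap ρ.ρ (fun i => by rw [f.comp_lab]; exact ρ.hol_inc i)
    (fun j => by rw [f.comp_lab]; exact ρ.hol_out j)

lemma moves_pullback {x x' : ι → Γ} {y y' : κ → Γ} {ρ : BunCat B' x y} {ρ' : BunCat B' x' y'}
    {g : ι → Γ} {h : κ → Γ} (m : Moves g h ρ ρ') : Moves g h (f.pullback ρ) (f.pullback ρ') := by
  obtain ⟨η, h1, h2, h3⟩ := m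
  refine (moves_restrict f.toMap h1 _ _ _ _).of_eq (fun i => ?_) (fun j => ?_)
  · rw [← h2]; exact congrArg η (f.lab _ _)
  · rw [← h3]; exact congrArg η (f.lab _ _)

variable [Finite Γ] [Finite ι] [Finite κ]

/-- The natural transformation `f_* : Ẑ(B) ⟶ Ẑ(B')` induced by a diffeomorphism `f : B → B'`. -/
noncomputable def push (Γ : Type) [Group Γ] [Finite Γ] (f : SurfDiffeo B B') :
    Zhat Γ B ⟶ Zhat Γ B' where
  app U :=
    { app := fun y =>
        { toFun := fun (u : Sect B U y) => (⟨fun x ρ => u.1 x (f.pullback ρ),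
            fun g _ _ hx _ _ m => u.2 g hx _ _ (f.moves_pullback m)⟩ : Sect B' U y)
          map_add' := fun _ _ => rfl
          map_smul' := fun _ _ => rfl }
      comm := fun h {y y'} hy u => Subtype.ext (by
        funext x ρ
        have e1 : y = h⁻¹ * y' * h⁻¹⁻¹ := by rw [hy]; simp [mul_assoc]
        have e2 : x = 1 * x * 1⁻¹ := by simp
        have m := (moves_shift 1 h⁻¹ e2 e1 ρ).symm
        rw [inv_one, inv_inv] at m
        exact (Sect.act_apply h hy u e2 (f.moves_pullback m)).trans (U.act_one e2 _)) }
  naturality _ _ _ := rfl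

end SurfDiffeo

/-- A diffeomorphism of `⟨2⟩`-3-manifolds: a diffeomorphism of manifolds with corners that maps
each face to the corresponding face and preserves the labels. -/
structure CornerDiffeo {a b c d : Type} {h1 h1' : Surface a b} {h2 h2' : Surface c d}
    {v1 v1' : Surface a c} {v2 v2' : Surface b d} (C : CornerMfd h1 h2 v1 v2)
    (C' : CornerMfd h1' h2' v1' v2') where
  toDiffeo : C.carrier ≃ₘ⟮modelWithCornersEuclideanQuadrant 3,
    modelWithCornersEuclideanQuadrant 3⟯ C'.carrier
  /-- The restrictions to the faces. -/
  fh1 : SurfDiffeo h1 h1'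
  fh2 : SurfDiffeo h2 h2'
  fv1 : SurfDiffeo v1 v1'
  fv2 : SurfDiffeo v2 v2'
  ch1 : ∀ p, toDiffeo (C.ih1 p) = C'.ih1 (fh1.toDiffeo p)
  ch2 : ∀ p, toDiffeo (C.ih2 p) = C'.ih2 (fh2.toDiffeo p)
  cv1 : ∀ p, toDiffeo (C.iv1 p) = C'.iv1 (fv1.toDiffeo p)
  cv2 : ∀ p, toDiffeo (C.iv2 p) = C'.iv2 (fv2.toDiffeo p)

/-! ### Gluing -/

/-- `W` is obtained by gluing `B₁` and `B₂` along the outgoing circles of `B₁`, which are the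
incoming circles of `B₂`. -/
structure SurfGluing {a b c : Type} (B₁ : Surface a b) (B₂ : Surface b c) (W : Surface a c) where
  i₁ : C(B₁.carrier, W.carrier)
  i₂ : C(B₂.carrier, W.carrier)
  emb₁ : IsSmoothEmb (𝓡∂ 2) (𝓡∂ 2) i₁
  emb₂ : IsSmoothEmb (𝓡∂ 2) (𝓡∂ 2) i₂
  cover : range i₁ ∪ range i₂ = univ
  glue : ∀ j z, i₁ (B₁.out j z) = i₂ (B₂.inc j z)
  glue_only : ∀ p q, i₁ p = i₂ q → ∃ j z, p = B₁.out j z ∧ q = B₂.inc j z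
  inc : ∀ i z, i₁ (B₁.inc i z) = W.inc i z
  out : ∀ k z, i₂ (B₂.out k z) = W.out k z

namespace SurfGluing

variable {Γ : Type} [Group Γ] {a b c : Type} {B₁ : Surface a b} {B₂ : Surface b c}
  {W : Surface a c} (g : SurfGluing B₁ B₂ W)

/-- The holonomies along the circles along which `B₁` and `B₂` are glued. -/
noncomputable def mid {x : a → Γ} {z : c → Γ} (τ : BunCat W x z) : b → Γ :=
  fun j => loopHol (g.i₁.comp (B₁.out j)) τ.ρ

/-- The restriction to `B₁`. -/
noncomputable def res₁ {x : a → Γ} {z : c → Γ} (τ : BunCat W x z) : BunCat B₁ x (g.mid τ) :=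
  restrict g.i₁ τ.ρ (fun i => by
    rw [show g.i₁.comp (B₁.inc i) = W.inc i from ContinuousMap.ext (g.inc i)]
    exact τ.hol_inc i) (fun _ => rfl)

/-- The restriction to `B₂`. -/
noncomputable def res₂ {x : a → Γ} {z : c → Γ} (τ : BunCat W x z) : BunCat B₂ (g.mid τ) z :=
  restrict g.i₂ τ.ρ (fun j => by
    rw [show g.i₂.comp (B₂.inc j) = g.i₁.comp (B₁.out j) from
      ContinuousMap.ext fun z => (g.glue j z).symm]
    rfl) (fun k => by
    rw [show g.i₂.comp (B₂.out k) = W.out k from ContinuousMap.ext (g.out k)]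
    exact τ.hol_out k)

lemma moves_res {x x' : a → Γ} {z z' : c → Γ} {τ : BunCat W x z} {τ' : BunCat W x' z'}
    {h : a → Γ} {l : c → Γ} (m : Moves h l τ τ') :
    ∃ k : b → Γ, Moves h k (g.res₁ τ) (g.res₁ τ') ∧ Moves k l (g.res₂ τ) (g.res₂ τ') := by
  obtain ⟨η, h1, h2, h3⟩ := m
  refine ⟨fun j => η (g.i₁ (B₁.out j 1)), ?_, ?_⟩
  · refine (moves_restrict g.i₁ h1 _ _ _ _).of_eq (fun i => ?_) (fun j => rfl)
    rw [← h2, g.inc]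
  · refine (moves_restrict g.i₂ h1 _ _ _ _).of_eq (fun i => ?_) (fun j => ?_)
    · rw [g.glue]
    · rw [← h3, g.out]

variable [Finite Γ] [Finite a] [Finite b] [Finite c]

/-- The natural transformation `Ẑ(B₂) ∘ Ẑ(B₁) ⟶ Ẑ(W)` for `W = B₂ ∪ B₁`. -/
noncomputable def glueMap (Γ : Type) [Group Γ] [Finite Γ] (g : SurfGluing B₁ B₂ W) :
    Zhat Γ B₁ ⋙ Zhat Γ B₂ ⟶ Zhat Γ W where
  app U :=
    { app := fun z =>
        { toFun := fun (f : Sect B₂ (ZhatObj B₁ U) z) =>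
            (⟨fun x τ => (f.1 (g.mid τ) (g.res₂ τ)).1 x (g.res₁ τ), fun h x x' hx τ τ' m => by
              obtain ⟨k, m₁, m₂⟩ := g.moves_res m
              exact (congrArg (fun s : Sect B₁ U (g.mid τ') => s.1 x' (g.res₁ τ'))
                (f.2 k m₁.out_eq _ _ m₂)).trans (Sect.act_apply k m₁.out_eq _ hx m₁)⟩ : Sect W U z)
          map_add' := fun _ _ => rfl
          map_smul' := fun _ _ => rfl }
      comm := fun l {z z'} hz f => Subtype.ext (by
        funext x τ
        have e1 : z = l⁻¹ * z' * l⁻¹⁻¹ := by rw [hz]; simp [mul_assoc]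
        have e2 : x = 1 * x * 1⁻¹ := by simp
        have m := (moves_shift 1 l⁻¹ e2 e1 τ).symm
        rw [inv_one, inv_inv] at m
        obtain ⟨k, m₁, m₂⟩ := g.moves_res m
        have h1 := Sect.act_apply (U := ZhatObj B₁ U) l hz f m₁.out_eq m₂
        exact (congrArg (fun s : Sect B₁ U (g.mid τ) => s.1 x (g.res₁ τ)) h1).trans
          ((Sect.act_apply k m₁.out_eq _ e2 m₁).trans (U.act_one e2 _))) }
  naturality _ _ _ := rfl

end SurfGluing

/-- `E` is obtained by gluing `C'` on top of `C`, along the horizontal face `h2` that they share. -/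
structure VGluing {a b c d e f : Type} {h1 : Surface a b} {h2 : Surface c d} {v1 : Surface a c}
    {v2 : Surface b d} {h2' : Surface e f} {v1' : Surface c e} {v2' : Surface d f}
    {w1 : Surface a e} {w2 : Surface b f} (C : CornerMfd h1 h2 v1 v2)
    (C' : CornerMfd h2 h2' v1' v2') (E : CornerMfd h1 h2' w1 w2) where
  g1 : SurfGluing v1 v1' w1
  g2 : SurfGluing v2 v2' w2
  i : C(C.carrier, E.carrier)
  i' : C(C'.carrier, E.carrier)
  emb : IsSmoothEmb (modelWithCornersEuclideanQuadrant 3) (modelWithCornersEuclideanQuadrant 3) i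
  emb' : IsSmoothEmb (modelWithCornersEuclideanQuadrant 3) (modelWithCornersEuclideanQuadrant 3) i'
  cover : range i ∪ range i' = univ
  glue : ∀ s, i (C.ih2 s) = i' (C'.ih1 s)
  glue_only : ∀ p q, i p = i' q → ∃ s, p = C.ih2 s ∧ q = C'.ih1 s
  ch1 : ∀ p, i (C.ih1 p) = E.ih1 p
  ch2 : ∀ p, i' (C'.ih2 p) = E.ih2 p
  cv1 : ∀ p, i (C.iv1 p) = E.iv1 (g1.i₁ p)
  cv1' : ∀ p, i' (C'.iv1 p) = E.iv1 (g1.i₂ p)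
  cv2 : ∀ p, i (C.iv2 p) = E.iv2 (g2.i₁ p)
  cv2' : ∀ p, i' (C'.iv2 p) = E.iv2 (g2.i₂ p)

/-- `E` is obtained by gluing `C` and `C'` along the vertical face `v2` that they share. -/
structure HGluing {a b c d e f : Type} {h1 : Surface a b} {h2 : Surface c d} {v1 : Surface a c}
    {v2 : Surface b d} {h1' : Surface b e} {h2' : Surface d f} {v2' : Surface e f}
    {w1 : Surface a e} {w2 : Surface c f} (C : CornerMfd h1 h2 v1 v2)
    (C' : CornerMfd h1' h2' v2 v2') (E : CornerMfd w1 w2 v1 v2') where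
  g1 : SurfGluing h1 h1' w1
  g2 : SurfGluing h2 h2' w2
  i : C(C.carrier, E.carrier)
  i' : C(C'.carrier, E.carrier)
  emb : IsSmoothEmb (modelWithCornersEuclideanQuadrant 3) (modelWithCornersEuclideanQuadrant 3) i
  emb' : IsSmoothEmb (modelWithCornersEuclideanQuadrant 3) (modelWithCornersEuclideanQuadrant 3) i'
  cover : range i ∪ range i' = univ
  glue : ∀ s, i (C.iv2 s) = i' (C'.iv1 s)
  glue_only : ∀ p q, i p = i' q → ∃ s, p = C.iv2 s ∧ q = C'.iv1 s
  cv1 : ∀ p, i (C.iv1 p) = E.iv1 p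
  cv2 : ∀ p, i' (C'.iv2 p) = E.iv2 p
  ch1 : ∀ p, i (C.ih1 p) = E.ih1 (g1.i₁ p)
  ch1' : ∀ p, i' (C'.ih1 p) = E.ih1 (g1.i₂ p)
  ch2 : ∀ p, i (C.ih2 p) = E.ih2 (g2.i₁ p)
  ch2' : ∀ p, i' (C'.ih2 p) = E.ih2 (g2.i₂ p)

/-! ### Disjoint unions and external tensor products -/

section TensorCore

variable {V W V' W' : Type} [AddCommGroup V] [Module ℂ V] [AddCommGroup W] [Module ℂ W]
  [AddCommGroup V'] [Module ℂ V'] [AddCommGroup W'] [Module ℂ W']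

/-- The inner product on a tensor product, `⟪v ⊗ w, v' ⊗ w'⟫ = ⟪v, v'⟫ ⟪w, w'⟫`. -/
@[reducible]
noncomputable def tensorCore (cV : InnerProductSpace.Core ℂ V) (cW : InnerProductSpace.Core ℂ W) :
    InnerProductSpace.Core ℂ (V ⊗[ℂ] W) :=
  letI := cV.toNormedAddCommGroup
  letI := InnerProductSpace.ofCore cV.toCore
  letI := cW.toNormedAddCommGroup
  letI := InnerProductSpace.ofCore cW.toCore
  (inferInstance : InnerProductSpace ℂ (V ⊗[ℂ] W)).toCore

lemma tensorCore_tmul (cV : InnerProductSpace.Core ℂ V) (cW : InnerProductSpace.Core ℂ W)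
    (v v' : V) (w w' : W) : (tensorCore cV cW).inner (v ⊗ₜ w) (v' ⊗ₜ w') =
      cV.inner v v' * cW.inner w w' := rfl

lemma core_add_right (c : InnerProductSpace.Core ℂ V) (u v w : V) :
    c.inner u (v + w) = c.inner u v + c.inner u w := by
  rw [← c.conj_inner_symm, c.add_left, map_add, c.conj_inner_symm, c.conj_inner_symm]

lemma core_zero_left (c : InnerProductSpace.Core ℂ V) (u : V) : c.inner 0 u = 0 := by
  have := c.smul_left 0 u 0
  simpa using this

lemma core_zero_right (c : InnerProductSpace.Core ℂ V) (u : V) : c.inner u 0 = 0 := by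
  rw [← c.conj_inner_symm, core_zero_left, map_zero]

lemma tensorCore_map (cV : InnerProductSpace.Core ℂ V) (cW : InnerProductSpace.Core ℂ W)
    (cV' : InnerProductSpace.Core ℂ V') (cW' : InnerProductSpace.Core ℂ W') (f : V →ₗ[ℂ] V')
    (g : W →ₗ[ℂ] W') (hf : ∀ u v, cV'.inner (f u) (f v) = cV.inner u v)
    (hg : ∀ u v, cW'.inner (g u) (g v) = cW.inner u v) (s t : V ⊗[ℂ] W) :
    (tensorCore cV' cW').inner (TensorProduct.map f g s) (TensorProduct.map f g t) =
      (tensorCore cV cW).inner s t := by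
  induction s with
  | zero => rw [map_zero, core_zero_left, core_zero_left]
  | add s s' hs hs' =>
    rw [map_add, (tensorCore cV' cW').add_left, hs, hs', (tensorCore cV cW).add_left]
  | tmul v w =>
    induction t with
    | zero => rw [map_zero, core_zero_right, core_zero_right]
    | add t t' ht ht' => rw [map_add, core_add_right, ht, ht', core_add_right]
    | tmul v' w' =>
      rw [TensorProduct.map_tmul, TensorProduct.map_tmul, tensorCore_tmul, tensorCore_tmul, hf, hg]

end TensorCore

section External

variable {Γ : Type} [Group Γ] {a b a' b' : Type}

lemma conj_inl {x y g : a ⊕ a' → Γ} (h : y = g * x * g⁻¹) :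
    y ∘ Sum.inl = (g ∘ Sum.inl) * (x ∘ Sum.inl) * (g ∘ Sum.inl)⁻¹ := by subst h; rfl

lemma conj_inr {x y g : a ⊕ a' → Γ} (h : y = g * x * g⁻¹) :
    y ∘ Sum.inr = (g ∘ Sum.inr) * (x ∘ Sum.inr) * (g ∘ Sum.inr)⁻¹ := by subst h; rfl

/-- The external tensor product `U ⊠ U'`. -/
noncomputable def extProd (U : GrObj Γ a) (U' : GrObj Γ a') : GrObj Γ (a ⊕ a') where
  V x := U.V (x ∘ Sum.inl) ⊗[ℂ] U'.V (x ∘ Sum.inr)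
  ip x := tensorCore (U.ip _) (U'.ip _)
  act g _ _ h := TensorProduct.map (U.act (g ∘ Sum.inl) (conj_inl h))
    (U'.act (g ∘ Sum.inr) (conj_inr h))
  act_one h v := by
    induction v with
    | zero => simp
    | add v w hv hw => rw [map_add, hv, hw]
    | tmul v w => exact congrArg₂ (fun v w => v ⊗ₜ[ℂ] w) (U.act_one (conj_inl h) v) (U'.act_one (conj_inr h) w)
  act_mul g g' {x y z} h h' h'' v := by
    induction v with
    | zero => simp
    | add v w hv hw => rw [map_add, map_add, map_add, hv, hw]
    | tmul v w =>
      exact congrArg₂ (fun v w => v ⊗ₜ[ℂ] w) (U.act_mul _ _ (conj_inl h) (conj_inl h') (conj_inl h'') v)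
        (U'.act_mul _ _ (conj_inr h) (conj_inr h') (conj_inr h'') w)
  act_ip g {x y} h u v := tensorCore_map _ _ _ _ _ _ (U.act_ip _ _) (U'.act_ip _ _) u v

lemma tensor_eq {V W X : Type} [AddCommGroup V] [Module ℂ V] [AddCommGroup W] [Module ℂ W]
    [AddCommGroup X] [Module ℂ X] (P Q : V ⊗[ℂ] W →ₗ[ℂ] X)
    (h : ∀ v w, P (v ⊗ₜ w) = Q (v ⊗ₜ w)) (s : V ⊗[ℂ] W) : P s = Q s :=
  LinearMap.congr_fun (TensorProduct.ext' h) s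

/-- The external tensor product `f ⊠ f'` of morphisms. -/
noncomputable def extProdMap {U₁ U₂ : GrObj Γ a} {U₁' U₂' : GrObj Γ a'} (f : U₁ ⟶ U₂)
    (f' : U₁' ⟶ U₂') : extProd U₁ U₁' ⟶ extProd U₂ U₂' where
  app x := TensorProduct.map (f.app (x ∘ Sum.inl)) (f'.app (x ∘ Sum.inr))
  comm _ x _ h v :=
    tensor_eq (V := U₁.V (x ∘ Sum.inl)) (W := U₁'.V (x ∘ Sum.inr))
      (TensorProduct.map (f.app _) (f'.app _) ∘ₗ
        TensorProduct.map (U₁.act _ (conj_inl h)) (U₁'.act _ (conj_inr h)))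
      (TensorProduct.map (U₂.act _ (conj_inl h)) (U₂'.act _ (conj_inr h)) ∘ₗ
        TensorProduct.map (f.app _) (f'.app _))
      (fun v w => congrArg₂ (fun v w => v ⊗ₜ[ℂ] w) (f.comm _ (conj_inl h) v)
        (f'.comm _ (conj_inr h) w)) v

end External

/-- `W` is the disjoint union of `B` and `B'`. -/
structure SurfSum {a b a' b' : Type} (B : Surface a b) (B' : Surface a' b')
    (W : Surface (a ⊕ a') (b ⊕ b')) where
  i : C(B.carrier, W.carrier)
  i' : C(B'.carrier, W.carrier)
  emb : IsSmoothEmb (𝓡∂ 2) (𝓡∂ 2) i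
  emb' : IsSmoothEmb (𝓡∂ 2) (𝓡∂ 2) i'
  cover : range i ∪ range i' = univ
  disjoint : ∀ p q, i p ≠ i' q
  inc : ∀ k z, i (B.inc k z) = W.inc (.inl k) z
  out : ∀ k z, i (B.out k z) = W.out (.inl k) z
  inc' : ∀ k z, i' (B'.inc k z) = W.inc (.inr k) z
  out' : ∀ k z, i' (B'.out k z) = W.out (.inr k) z

namespace SurfSum

variable {Γ : Type} [Group Γ] {a b a' b' : Type} {B : Surface a b} {B' : Surface a' b'}
  {W : Surface (a ⊕ a') (b ⊕ b')} (s : SurfSum B B' W)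

/-- The restriction to `B`. -/
noncomputable def res {x : a ⊕ a' → Γ} {y : b ⊕ b' → Γ} (τ : BunCat W x y) :
    BunCat B (x ∘ Sum.inl) (y ∘ Sum.inl) :=
  restrict s.i τ.ρ (fun k => by
    rw [show s.i.comp (B.inc k) = W.inc (.inl k) from ContinuousMap.ext (s.inc k)]
    exact τ.hol_inc _) (fun k => by
    rw [show s.i.comp (B.out k) = W.out (.inl k) from ContinuousMap.ext (s.out k)]
    exact τ.hol_out _)

/-- The restriction to `B'`. -/
noncomputable def res' {x : a ⊕ a' → Γ} {y : b ⊕ b' → Γ} (τ : BunCat W x y) :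
    BunCat B' (x ∘ Sum.inr) (y ∘ Sum.inr) :=
  restrict s.i' τ.ρ (fun k => by
    rw [show s.i'.comp (B'.inc k) = W.inc (.inr k) from ContinuousMap.ext (s.inc' k)]
    exact τ.hol_inc _) (fun k => by
    rw [show s.i'.comp (B'.out k) = W.out (.inr k) from ContinuousMap.ext (s.out' k)]
    exact τ.hol_out _)

lemma moves_res {x x₁ : a ⊕ a' → Γ} {y y₁ : b ⊕ b' → Γ} {τ : BunCat W x y} {τ₁ : BunCat W x₁ y₁}
    {g : a ⊕ a' → Γ} {h : b ⊕ b' → Γ} (m : Moves g h τ τ₁) :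
    Moves (g ∘ Sum.inl) (h ∘ Sum.inl) (s.res τ) (s.res τ₁) := by
  obtain ⟨η, h1, h2, h3⟩ := m
  refine (moves_restrict s.i h1 _ _ _ _).of_eq (fun k => ?_) (fun k => ?_)
  · rw [s.inc, h2]; rfl
  · rw [s.out, h3]; rfl

lemma moves_res' {x x₁ : a ⊕ a' → Γ} {y y₁ : b ⊕ b' → Γ} {τ : BunCat W x y} {τ₁ : BunCat W x₁ y₁}
    {g : a ⊕ a' → Γ} {h : b ⊕ b' → Γ} (m : Moves g h τ τ₁) :
    Moves (g ∘ Sum.inr) (h ∘ Sum.inr) (s.res' τ) (s.res' τ₁) := by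
  obtain ⟨η, h1, h2, h3⟩ := m
  refine (moves_restrict s.i' h1 _ _ _ _).of_eq (fun k => ?_) (fun k => ?_)
  · rw [s.inc', h2]; rfl
  · rw [s.out', h3]; rfl

variable [Finite Γ] [Finite a] [Finite b] [Finite a'] [Finite b']

/-- The section `u ⊠ u'` over `W` defined by sections over `B` and `B'`. -/
noncomputable def extSect {U : GrObj Γ a} {U' : GrObj Γ a'} {y : b ⊕ b' → Γ}
    (u : Sect B U (y ∘ Sum.inl)) (u' : Sect B' U' (y ∘ Sum.inr)) : Sect W (extProd U U') y :=
  ⟨fun x τ => (u.1 (x ∘ Sum.inl) (s.res τ) ⊗ₜ[ℂ] u'.1 (x ∘ Sum.inr) (s.res' τ)),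
    fun g x x' hx τ τ' m => by
      exact congrArg₂ (fun v w => v ⊗ₜ[ℂ] w)
        (u.2 (g ∘ Sum.inl) (conj_inl hx) _ _ (s.moves_res m))
        (u'.2 (g ∘ Sum.inr) (conj_inr hx) _ _ (s.moves_res' m))⟩

/-- The linear map `Ẑ(B)(U)_y ⊗ Ẑ(B')(U')_{y'} → Ẑ(B ⊔ B')(U ⊠ U')_{(y, y')}`. -/
noncomputable def extLin (U : GrObj Γ a) (U' : GrObj Γ a') (y : b ⊕ b' → Γ) :
    Sect B U (y ∘ Sum.inl) ⊗[ℂ] Sect B' U' (y ∘ Sum.inr) →ₗ[ℂ] Sect W (extProd U U') y :=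
  TensorProduct.lift (LinearMap.mk₂ ℂ (fun u u' => s.extSect u u')
    (fun _ _ _ => Subtype.ext (by funext x τ; exact TensorProduct.add_tmul _ _ _))
    (fun _ _ _ => Subtype.ext (by funext x τ; exact TensorProduct.smul_tmul' _ _ _))
    (fun _ _ _ => Subtype.ext (by funext x τ; exact TensorProduct.tmul_add _ _ _))
    (fun _ _ _ => Subtype.ext (by funext x τ; exact TensorProduct.tmul_smul _ _ _)))

/-- The morphism `Ẑ(B)(U) ⊠ Ẑ(B')(U') ⟶ Ẑ(B ⊔ B')(U ⊠ U')`. -/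
noncomputable def extMap (U : GrObj Γ a) (U' : GrObj Γ a') :
    extProd ((Zhat Γ B).obj U) ((Zhat Γ B').obj U') ⟶ (Zhat Γ W).obj (extProd U U') where
  app y := s.extLin U U' y
  comm h {y y'} hy v :=
    tensor_eq (V := Sect B U (y ∘ Sum.inl)) (W := Sect B' U' (y ∘ Sum.inr))
      (s.extLin U U' y' ∘ₗ TensorProduct.map (Sect.act _ (conj_inl hy)) (Sect.act _ (conj_inr hy)))
      (Sect.act h hy ∘ₗ s.extLin U U' y)
      (fun u u' => Subtype.ext (by
        funext x τ
        have e1 : y = h⁻¹ * y' * h⁻¹⁻¹ := by rw [hy]; simp [mul_assoc]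
        have e2 : x = 1 * x * 1⁻¹ := by simp
        have m := (moves_shift 1 h⁻¹ e2 e1 τ).symm
        rw [inv_one, inv_inv] at m
        have h1 := Sect.act_apply (h ∘ Sum.inl) (conj_inl hy) u (conj_inl e2) (s.moves_res m)
        have h2 := Sect.act_apply (h ∘ Sum.inr) (conj_inr hy) u' (conj_inr e2) (s.moves_res' m)
        exact congrArg₂ (fun v w => v ⊗ₜ[ℂ] w) (h1.trans (U.act_one (conj_inl e2) _))
          (h2.trans (U'.act_one (conj_inr e2) _)))) v

end SurfSum

/-- `E` is the disjoint union of `C` and `C'`. -/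
structure CornerSum {a b c d a' b' c' d' : Type} {h1 : Surface a b} {h2 : Surface c d}
    {v1 : Surface a c} {v2 : Surface b d} {h1' : Surface a' b'} {h2' : Surface c' d'}
    {v1' : Surface a' c'} {v2' : Surface b' d'} {wh1 : Surface (a ⊕ a') (b ⊕ b')}
    {wh2 : Surface (c ⊕ c') (d ⊕ d')} {wv1 : Surface (a ⊕ a') (c ⊕ c')}
    {wv2 : Surface (b ⊕ b') (d ⊕ d')} (C : CornerMfd h1 h2 v1 v2)
    (C' : CornerMfd h1' h2' v1' v2') (E : CornerMfd wh1 wh2 wv1 wv2) where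
  sh1 : SurfSum h1 h1' wh1
  sh2 : SurfSum h2 h2' wh2
  sv1 : SurfSum v1 v1' wv1
  sv2 : SurfSum v2 v2' wv2
  i : C(C.carrier, E.carrier)
  i' : C(C'.carrier, E.carrier)
  emb : IsSmoothEmb (modelWithCornersEuclideanQuadrant 3) (modelWithCornersEuclideanQuadrant 3) i
  emb' : IsSmoothEmb (modelWithCornersEuclideanQuadrant 3) (modelWithCornersEuclideanQuadrant 3) i'
  cover : range i ∪ range i' = univ
  disjoint : ∀ p q, i p ≠ i' q
  ch1 : ∀ p, i (C.ih1 p) = E.ih1 (sh1.i p)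
  ch1' : ∀ p, i' (C'.ih1 p) = E.ih1 (sh1.i' p)
  ch2 : ∀ p, i (C.ih2 p) = E.ih2 (sh2.i p)
  ch2' : ∀ p, i' (C'.ih2 p) = E.ih2 (sh2.i' p)
  cv1 : ∀ p, i (C.iv1 p) = E.iv1 (sv1.i p)
  cv1' : ∀ p, i' (C'.iv1 p) = E.iv1 (sv1.i' p)
  cv2 : ∀ p, i (C.iv2 p) = E.iv2 (sv2.i p)
  cv2' : ∀ p, i' (C'.iv2 p) = E.iv2 (sv2.i' p)

section Composite

variable {Γ : Type} [Group Γ] [Finite Γ] {a b c a' b' c' : Type} [Finite a] [Finite b] [Finite c]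
  [Finite a'] [Finite b'] [Finite c'] {B : Surface a b} {B' : Surface a' b'}
  {W : Surface (a ⊕ a') (b ⊕ b')} {D : Surface b c} {D' : Surface b' c'}
  {X : Surface (b ⊕ b') (c ⊕ c')}

/-- The morphism `Ẑ(D)Ẑ(B)(U) ⊠ Ẑ(D')Ẑ(B')(U') ⟶ Ẑ(D ⊔ D')Ẑ(B ⊔ B')(U ⊠ U')`. -/
noncomputable def extMap₂ (s : SurfSum B B' W) (t : SurfSum D D' X) (U : GrObj Γ a)
    (U' : GrObj Γ a') :
    extProd ((Zhat Γ B ⋙ Zhat Γ D).obj U) ((Zhat Γ B' ⋙ Zhat Γ D').obj U') ⟶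
      (Zhat Γ W ⋙ Zhat Γ X).obj (extProd U U') :=
  t.extMap ((Zhat Γ B).obj U) ((Zhat Γ B').obj U') ≫ (Zhat Γ X).map (s.extMap U U')

end Composite

end DW

/-!
The invariant counts flat bundles, and all assertions follow from two facts about them: flat bundles
glue along closed covers, and sums over groupoids satisfy a Fubini theorem.

*Gluing.* Let a locally contractible space be covered by two closed subspaces `A` and `B`. A map to
`Γ` is a morphism of bundles if its restrictions to `A` and `B` are (`isGauge_of_cover`), and
bundles on `A` and `B` together with an isomorphism of their restrictions to the intersection come
from a bundle on the whole space (`exists_glued_bundle`). No collars are needed: near each point the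
given bundles have local trivializations that fit together, and a compatible family of local
trivializations defines a covering space with fibre `Γ`, whose monodromy is the glued bundle
(`exists_bundle_of_local`). A bundle on the circle is determined up to isomorphism by its holonomy
(`exists_isGauge_circle`). Hence bundles on a glued surface are the same as pairs of bundles on the
pieces with matching holonomies, which makes `Ẑ(B₂) ∘ Ẑ(B₁) → Ẑ(B₂ ∪ B₁)` an isomorphism
(`SurfGluing.isIso_glueMap`).

*Integration.* For a functor `p : G ⥤ H` of groupoids, the sum over `G` is the sum over `H` of the
sums over the homotopy fibres of `p` (`gsum_fubini`). The value of `Z(C)` is defined by averaging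
over the holonomies `y` along the circles in `A_{d,2}` and by integrating over bundles `φ`, `ψ` on
the faces `h1`, `v2` and over the bundles on `C` with all four restrictions prescribed. By Fubini it
is one integral (`dwVal_eq_gsum`), over the groupoid `Tot C φ' ψ'` of bundles on `C` of which only
the restrictions `φ'` to `v1` and `ψ'` to `h2` are prescribed. This form of `Z(C)` gives the
theorem:

* a diffeomorphism induces an equivalence of the groupoids `Tot` by pullback (`dw_naturality`);
* for a disjoint union, `Tot` is a product of groupoids (`extMap₂_dw`). That the comparison maps are
  isomorphisms comes down to `SurfSum.extLin_bijective`: a family of tensors `w(ρ, ρ') ∈ U ⊗ U'`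
  which is invariant in `ρ` and in `ρ'` lies in the tensor product of the spaces of invariant
  families;
* for a manifold `E` glued from `C` and `C'`, restriction to one piece is a functor from `Tot E`
  whose homotopy fibre is the groupoid `Tot` of the other piece with the boundary value prescribed
  by the first on the common face. Fubini for this functor is the gluing law (`VGluing.glueMap_dw`,
  `HGluing.glueMap_dw`).
-/

namespace DW

/-! ### Local trivializations of flat bundles -/

section Local

variable {Γ : Type} [Group Γ] {X Y Z : Type} [TopologicalSpace X] [TopologicalSpace Y]
  [TopologicalSpace Z]

lemma bundle_ext {ρ ρ' : Bundle Γ X}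
    (h : ∀ ⦃x y : FundamentalGroupoid X⦄ (p : x ⟶ y), hol ρ p = hol ρ' p) : ρ = ρ' :=
  Functor.hext (fun _ => rfl) fun _ _ p => heq_of_eq (h p)

/-- Bundles are equal, not just isomorphic, if `1` is a morphism between them. -/
lemma IsGauge.eq {ρ ρ' : Bundle Γ X} (h : IsGauge 1 ρ ρ') : ρ = ρ' :=
  bundle_ext fun _ _ p => by simpa using (h p).symm

lemma pull_pull (f : C(X, Y)) (g : C(Y, Z)) (ρ : Bundle Γ Z) :
    pull f (pull g ρ) = pull (g.comp f) ρ := by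
  rw [pull, pull, pull, FundamentalGroupoid.map_comp]; rfl

lemma pull_id (ρ : Bundle Γ X) : pull (.id X) ρ = ρ := by
  rw [pull, FundamentalGroupoid.map_id]; rfl

lemma hol_pull (f : C(X, Y)) (ρ : Bundle Γ Y) {a b : X} (γ : Path a b) :
    hol (pull f ρ) (cls γ) = hol ρ (cls (γ.map f.continuous)) := rfl

/-- On paths that stay in `U` the holonomy of `ρ` is the coboundary of `f`; in other words, `f` is a
trivialization of `ρ` over `U`. -/
def Trivializes (ρ : Bundle Γ X) (f : X → Γ) (U : Set X) : Prop :=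
  ∀ ⦃a b : X⦄ (γ : Path a b), (∀ t, γ t ∈ U) → hol ρ (cls γ) = f b * (f a)⁻¹

lemma Trivializes.mono {ρ : Bundle Γ X} {f : X → Γ} {U V : Set X} (h : Trivializes ρ f U)
    (hV : V ⊆ U) : Trivializes ρ f V := fun _ _ γ hγ => h γ fun t => hV (hγ t)

/-- Over a contractible neighbourhood of `x`, the holonomies along paths that start at `x` and stay
in that neighbourhood form a trivialization. -/
lemma exists_trivializes [StronglyLocallyContractibleSpace X] (ρ : Bundle Γ X) (x : X) :
    ∃ U ∈ 𝓝 x, ∃ f : X → Γ, f x = 1 ∧ Trivializes ρ f U := by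
  classical
  obtain ⟨U, ⟨hU, hUc⟩, -⟩ := (contractible_basis x).mem_iff.1 (Filter.univ_mem (f := 𝓝 x))
  have hpc : IsPathConnected U := by
    rw [isPathConnected_iff_pathConnectedSpace]; infer_instance
  have hx : x ∈ U := mem_of_mem_nhds hU
  have hJ : ∀ w, ∃ p : w ∈ U → Path x w, ∀ h t, p h t ∈ U := fun w => by
    by_cases hw : w ∈ U
    · obtain ⟨p, hp⟩ := hpc.joinedIn x hx w hw
      exact ⟨fun _ => p, fun _ => hp⟩
    · exact ⟨fun h => absurd h hw, fun h => absurd h hw⟩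
  choose p hp using hJ
  refine ⟨U, hU, fun w => if h : w ∈ U then hol ρ (cls (p w h)) else 1, ?_, fun a b γ hγ => ?_⟩
  · simp only [dif_pos hx]
    have h1 : cls (p x hx) = 𝟙 _ := Quotient.sound (homotopic_of_range_subset _ (Path.refl x)
      (range_subset_iff.2 (hp x hx)) (range_subset_iff.2 fun _ => hx))
    rw [h1, hol_id]
  · have ha : a ∈ U := by simpa using hγ 0
    have hb : b ∈ U := by simpa using hγ 1
    simp only [dif_pos ha, dif_pos hb]
    have h1 : cls (p b hb) = cls ((p a ha).trans γ) := Quotient.sound (homotopic_of_range_subset _ _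
      (range_subset_iff.2 (hp b hb)) (by
        rw [Path.trans_range]
        exact union_subset (range_subset_iff.2 (hp a ha)) (range_subset_iff.2 hγ)))
    rw [h1, cls_trans, hol_comp, mul_inv_cancel_right]

/-- Whether `η` is a morphism of bundles can be checked on short paths, because by the Lebesgue
number lemma every path is a composite of such. -/
lemma isGauge_of_local {ρ ρ' : Bundle Γ X} {η : X → Γ} (h : ∀ x, ∃ N ∈ 𝓝 x, ∀ ⦃a b : X⦄
    (γ : Path a b), (∀ t, γ t ∈ N) → hol ρ' (cls γ) = η b * hol ρ (cls γ) * (η a)⁻¹) :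
    IsGauge η ρ ρ' := by
  choose N hN hγN using h
  rintro ⟨a⟩ ⟨b⟩ p
  obtain ⟨γ, rfl⟩ := Path.Homotopic.Quotient.mk_surjective p
  change hol ρ' (cls γ) = η b * hol ρ (cls γ) * (η a)⁻¹
  obtain ⟨u, hu0, hum, ⟨n, hn⟩, hu⟩ := exists_monotone_Icc_subset_open_cover_unitInterval
    (c := fun x => γ ⁻¹' interior (N x)) (fun x => isOpen_interior.preimage γ.continuous)
    (fun t _ => mem_iUnion.2 ⟨γ t, mem_interior_iff_mem_nhds.2 (hN _)⟩)
  have ind : ∀ m : ℕ, hol ρ' (cls (γ.subpath (u 0) (u m))) =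
      η (γ (u m)) * hol ρ (cls (γ.subpath (u 0) (u m))) * (η (γ (u 0)))⁻¹ := by
    intro m
    induction m with
    | zero =>
      rw [Path.subpath_self]
      change hol ρ' (𝟙 _) = _ * hol ρ (𝟙 _) * _
      simp [hol_id]
    | succ m ih =>
      obtain ⟨k, hk⟩ := hu m
      have h1 : cls (γ.subpath (u 0) (u (m + 1))) =
          cls (γ.subpath (u 0) (u m)) ≫ cls (γ.subpath (u m) (u (m + 1))) :=
        (Path.Homotopic.Quotient.eq.2
          ⟨Path.Homotopy.subpathTransSubpath γ (u 0) (u m) (u (m + 1))⟩).symm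
      have h2 := hγN k (γ.subpath (u m) (u (m + 1))) (by
        rw [← range_subset_iff, Path.range_subpath_of_le _ _ _ (hum (Nat.le_succ m))]
        rintro _ ⟨x, hx, rfl⟩
        exact interior_subset (hk hx))
      rw [h1, hol_comp, hol_comp, ih, h2]; simp [mul_assoc]
  have h := ind n
  rw [hu0, hn n le_rfl, Path.subpath_zero_one] at h
  have e0 : γ 0 = a := γ.source
  have e1 : γ 1 = b := γ.target
  have gen : ∀ (a' b' : X) (ha : a' = a) (hb : b' = b), hol ρ' (cls (γ.cast ha hb)) =
      η b' * hol ρ (cls (γ.cast ha hb)) * (η a')⁻¹ →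
      hol ρ' (cls γ) = η b * hol ρ (cls γ) * (η a)⁻¹ := by
    rintro _ _ rfl rfl h; exact h
  exact gen _ _ e0 e1 h

/-- Near `x`, every point of the closed subspace `S` can be joined within `S` to `x` by a short
path. -/
lemma eventually_exists_path {S : Type} [TopologicalSpace S] [LocallyPathConnectedSpace S]
    {k : S → X} (hk : IsClosedEmbedding k) (x : X) {O : Set X} (hO : O ∈ 𝓝 x) :
    ∀ᶠ w in 𝓝 x, ∀ s, k s = w → ∃ s₀, k s₀ = x ∧ ∃ γ : Path s₀ s, ∀ t, k (γ t) ∈ O := by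
  by_cases hx : x ∈ range k
  · obtain ⟨s₀, rfl⟩ := hx
    have h1 : k ⁻¹' O ∈ 𝓝 s₀ := hk.continuous.continuousAt.preimage_mem_nhds hO
    obtain ⟨V, ⟨hV, hVc⟩, hVO⟩ := (path_connected_basis s₀).mem_iff.1 h1
    rw [id] at hVO
    rw [hk.isInducing.nhds_eq_comap] at hV
    obtain ⟨T, hT, hTV⟩ := hV
    filter_upwards [hT] with w hw s hs
    subst hs
    obtain ⟨γ, hγ⟩ := hVc.joinedIn s₀ (hTV (show k s₀ ∈ T from mem_of_mem_nhds hT)) s (hTV hw)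
    exact ⟨s₀, rfl, γ, fun t => hVO (hγ t)⟩
  · filter_upwards [hk.isClosed_range.isOpen_compl.mem_nhds hx] with w hw s hs
    exact absurd ⟨s, hs⟩ hw

end Local

/-! ### Gluing bundles along a cover by two closed subspaces -/

section Gluing

variable {Γ : Type} [Group Γ] {X : Type} [TopologicalSpace X]

/-- The fibre bundle with discrete fibre `Γ` whose transition function from the chart over `U x` to
the chart over `U y` is left multiplication by the locally constant function `(f y)⁻¹ * f x`. -/
noncomputable def flatCore [TopologicalSpace Γ] [DiscreteTopology Γ] (U : X → Set X)
    (hU : ∀ x, IsOpen (U x)) (hx : ∀ x, x ∈ U x) (f : X → X → Γ)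
    (h : ∀ x y z, z ∈ U x → z ∈ U y → ∀ᶠ w in 𝓝 z, (f x w)⁻¹ * f y w = (f x z)⁻¹ * f y z) :
    FiberBundleCore X X Γ where
  baseSet := U
  isOpen_baseSet := hU
  indexAt := id
  mem_baseSet_at := hx
  coordChange x y z g := (f y z)⁻¹ * f x z * g
  coordChange_self _ _ _ _ := by simp
  continuousOn_coordChange x y := by
    rintro ⟨z, g⟩ ⟨⟨hz, hz'⟩, -⟩
    refine ContinuousAt.continuousWithinAt ?_
    have h1 : ContinuousAt (fun p : X × Γ => ((f y z)⁻¹ * f x z) * p.2) (z, g) := by fun_prop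
    refine h1.congr ?_
    have := (h y x z hz' hz).prod_inl_nhds g
    filter_upwards [this] with p hp
    rw [hp]
  coordChange_comp x y z w _ v := by simp [mul_assoc]

/-- Locally given trivializations that differ by locally constant functions define a bundle. The
holonomy along a path is read off from the monodromy of the covering space `flatCore`. -/
lemma exists_bundle_of_local (U : X → Set X) (hU : ∀ x, IsOpen (U x)) (hx : ∀ x, x ∈ U x)
    (f : X → X → Γ)
    (h : ∀ x y z, z ∈ U x → z ∈ U y → ∀ᶠ w in 𝓝 z, (f x w)⁻¹ * f y w = (f x z)⁻¹ * f y z) :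
    ∃ ρ : Bundle Γ X, ∀ x, Trivializes ρ (f x) (U x) := by
  let _ : TopologicalSpace Γ := ⊥
  have _ : DiscreteTopology Γ := ⟨rfl⟩
  let Z := flatCore U hU hx f h
  have cov : IsCoveringMap Z.proj := FiberBundle.isCoveringMap (F := Γ) (E := Z.Fiber)
  let v : Z.TotalSpace → Γ := fun e => e.2
  -- In terms of `tr` the section of the chart over `U x` with second component `g` is `f x * g`.
  let tr : Z.TotalSpace → Γ := fun e => f e.1 e.1 * v e
  let pt : ∀ (a : X) (g : Γ), Z.proj ⁻¹' {a} := fun a g => ⟨⟨a, (f a a)⁻¹ * g⟩, rfl⟩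
  have tr_pt : ∀ a g, tr (pt a g).1 = g := fun a g => by simp [tr, pt, v]
  have pt_tr : ∀ a (e : Z.proj ⁻¹' {a}), pt a (tr e.1) = e := by
    rintro a ⟨⟨a', g⟩, rfl⟩
    refine Subtype.ext ?_
    exact congrArg (fun g => (⟨a', g⟩ : Z.TotalSpace)) (inv_mul_cancel_left (f a' a') g)
  -- Right translations are automorphisms of the covering, so monodromy commutes with them; this
  -- makes `T p 1` multiplicative in `p`.
  let R : Γ → Z.TotalSpace → Z.TotalSpace := fun c e => ⟨e.1, v e * c⟩
  have tr_R : ∀ c e, tr (R c e) = tr e * c := fun c e => (mul_assoc _ _ _).symm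
  have R_cont : ∀ c, Continuous (R c) := fun c => by
    refine continuous_iff_continuousAt.2 fun e₀ => ?_
    refine (FiberBundle.continuousAt_totalSpace (F := Γ) (E := Z.Fiber) _).2
      ⟨(FiberBundle.continuous_proj Γ Z.Fiber).continuousAt, ?_⟩
    have h1 := ((FiberBundle.continuousAt_totalSpace (F := Γ) (E := Z.Fiber) (id : Z.TotalSpace → _)
      (x₀ := e₀)).1 continuousAt_id).2
    have h2 : ContinuousAt (fun e : Z.TotalSpace =>
        ((trivializationAt Γ Z.Fiber e₀.proj) e).2 * c) e₀ := h1.mul continuousAt_const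
    refine h2.congr (Filter.Eventually.of_forall fun e => ?_)
    exact mul_assoc _ _ _
  have key : ∀ {a b : X} (γ : Path a b) (Λ : unitInterval → Z.TotalSpace) (hΛ : Continuous Λ)
      (hp : ∀ t, Z.proj (Λ t) = γ t),
      (cov.monodromy (Path.Homotopic.Quotient.mk γ) (pt a (tr (Λ 0)))).1 = Λ 1 := by
    intro a b γ Λ hΛ hp
    have e : pt a (tr (Λ 0)) = ⟨Λ 0, (hp 0).trans γ.source⟩ := pt_tr a ⟨Λ 0, (hp 0).trans γ.source⟩
    rw [e]
    exact (congrFun ((cov.eq_liftPath_iff (γ := ⟨γ, γ.continuous⟩) (e := Λ 0) (hp 0).symm).2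
      ⟨hΛ, funext hp, rfl⟩) 1).symm
  let T : ∀ {a b : X}, Path.Homotopic.Quotient a b → Γ → Γ := fun {a b} p g =>
    tr (cov.monodromy p (pt a g)).1
  have T_mul : ∀ {a b : X} (p : Path.Homotopic.Quotient a b) (g c : Γ),
      T p (g * c) = T p g * c := by
    intro a b p g c
    obtain ⟨γ, rfl⟩ := Path.Homotopic.Quotient.mk_surjective p
    let Λ := cov.liftPath ⟨γ, γ.continuous⟩ (pt a g).1 γ.source
    have h0 : Λ 0 = (pt a g).1 := cov.liftPath_zero _ _ _
    have h1 := key γ (fun t => R c (Λ t)) ((R_cont c).comp Λ.continuous)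
      (fun t => congrFun (cov.liftPath_lifts _ _ _) t)
    simp only [h0, tr_R, tr_pt] at h1
    change tr (cov.monodromy _ _).1 = _
    rw [h1, tr_R]
    rfl
  let ρ : Bundle Γ X :=
    { obj := fun _ => SingleObj.star Γ
      map := fun {x y} p => T p 1
      map_id := fun x => by
        change tr (cov.monodromy (.refl x.as) (pt x.as 1)).1 = _
        rw [cov.monodromy_refl]
        exact tr_pt _ _
      map_comp := fun {x y z} p q => by
        change T (Path.Homotopic.Quotient.trans p q) 1 = T q 1 * T p 1
        rw [← T_mul, one_mul]
        change tr (cov.monodromy _ _).1 = tr (cov.monodromy _ (pt _ (tr (cov.monodromy _ _).1))).1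
        rw [pt_tr, cov.monodromy_trans_apply] }
  refine ⟨ρ, fun x a b γ hγ => ?_⟩
  have hcont : Continuous fun t =>
      (Z.localTriv x).toOpenPartialHomeomorph.symm (γ t, (f x a)⁻¹) := by
    refine (Z.localTriv x).toOpenPartialHomeomorph.symm.continuousOn.comp_continuous
      (γ.continuous.prodMk continuous_const) fun t => ?_
    exact (Z.mem_localTriv_target x _).2 (hγ t)
  have h1 := key γ _ hcont (fun t => rfl)
  have h2 : ∀ t, tr ((Z.localTriv x).toOpenPartialHomeomorph.symm (γ t, (f x a)⁻¹)) =
      f x (γ t) * (f x a)⁻¹ := fun t => by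
    change f (γ t) (γ t) * ((f (γ t) (γ t))⁻¹ * f x (γ t) * (f x a)⁻¹) = _
    simp [mul_assoc]
  change tr (cov.monodromy _ (pt a 1)).1 = _
  have h3 := (h2 0).trans (by rw [γ.source, mul_inv_cancel])
  have h4 := congrArg tr h1
  rw [h3, h2, γ.target] at h4
  exact h4

variable {A B S : Type} [TopologicalSpace A] [TopologicalSpace B] [TopologicalSpace S]
  [LocallyPathConnectedSpace S] {i : C(A, X)} {i' : C(B, X)} {j : C(S, A)} {j' : C(S, B)}

/-- A map is a morphism of bundles if its restrictions to the two parts of a closed cover are. -/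
lemma isGauge_of_cover [StronglyLocallyContractibleSpace X] [LocallyPathConnectedSpace A]
    [LocallyPathConnectedSpace B] (hi : IsClosedEmbedding i) (hi' : IsClosedEmbedding i')
    (cover : range i ∪ range i' = univ) {ρ ρ' : Bundle Γ X} {η : X → Γ}
    (h : IsGauge (fun a => η (i a)) (pull i ρ) (pull i ρ'))
    (h' : IsGauge (fun b => η (i' b)) (pull i' ρ) (pull i' ρ')) : IsGauge η ρ ρ' := by
  refine isGauge_of_local fun x => ?_
  obtain ⟨U, hU, f, hf, hfU⟩ := exists_trivializes ρ x
  obtain ⟨U', hU', f', hf', hfU'⟩ := exists_trivializes ρ' x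
  have hO := Filter.inter_mem hU hU'
  have hN : ∀ᶠ w in 𝓝 x, f' w = η w * f w * (η x)⁻¹ := by
    filter_upwards [eventually_exists_path hi x hO, eventually_exists_path hi' x hO] with w hw hw'
    rcases (cover.symm ▸ mem_univ w : w ∈ range i ∪ range i') with ⟨a, rfl⟩ | ⟨b, rfl⟩
    · obtain ⟨a₀, rfl, γ, hγ⟩ := hw a rfl
      have h1 := h (cls γ)
      rw [hol_pull, hol_pull, hfU _ fun t => (hγ t).1, hfU' _ fun t => (hγ t).2, hf, hf'] at h1
      simpa using h1
    · obtain ⟨b₀, rfl, γ, hγ⟩ := hw' b rfl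
      have h1 := h' (cls γ)
      rw [hol_pull, hol_pull, hfU _ fun t => (hγ t).1, hfU' _ fun t => (hγ t).2, hf, hf'] at h1
      simpa using h1
  refine ⟨_, Filter.inter_mem hO hN, fun a b γ hγ => ?_⟩
  have ha : f' a = η a * f a * (η x)⁻¹ := by simpa using (hγ 0).2
  have hb : f' b = η b * f b * (η x)⁻¹ := by simpa using (hγ 1).2
  rw [hfU γ fun t => (hγ t).1.1, hfU' γ fun t => (hγ t).1.2, ha, hb]
  simp [mul_assoc]

/-- Near `x`, a bundle on the closed subspace `A` has a trivialization. -/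
lemma exists_trivializes_closed [StronglyLocallyContractibleSpace A] (hi : IsClosedEmbedding i)
    (α : Bundle Γ A) (x : X) :
    ∃ O ∈ 𝓝 x, ∃ f : A → Γ, (∀ a, i a = x → f a = 1) ∧ Trivializes α f (i ⁻¹' O) := by
  by_cases hx : x ∈ range i
  · obtain ⟨a, rfl⟩ := hx
    obtain ⟨V, hV, f, hf, hfV⟩ := exists_trivializes α a
    rw [hi.isInducing.nhds_eq_comap] at hV
    obtain ⟨O, hO, hOV⟩ := hV
    refine ⟨O, hO, f, fun a' ha' => ?_, hfV.mono hOV⟩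
    rw [hi.injective ha', hf]
  · refine ⟨(range i)ᶜ, hi.isClosed_range.isOpen_compl.mem_nhds hx, 1, fun _ _ => rfl,
      fun a b γ hγ => ?_⟩
    exact absurd ⟨_, rfl⟩ (hγ 0)

/-- Bundles on the two parts of a closed cover that agree on the intersection `S` of these parts are
the restrictions of a bundle. -/
lemma exists_glued_bundle_of_eq [StronglyLocallyContractibleSpace A]
    [StronglyLocallyContractibleSpace B] (hi : IsClosedEmbedding i) (hi' : IsClosedEmbedding i')
    (hj : IsClosedEmbedding j) (cover : range i ∪ range i' = univ)
    (comm : ∀ s, i (j s) = i' (j' s)) (only : ∀ p q, i p = i' q → ∃ s, p = j s ∧ q = j' s)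
    {α : Bundle Γ A} {β : Bundle Γ B} (h : pull j α = pull j' β) :
    ∃ ρ : Bundle Γ X, pull i ρ = α ∧ pull i' ρ = β := by
  classical
  have local_data : ∀ x : X, ∃ O : Set X, IsOpen O ∧ x ∈ O ∧ ∃ f : X → Γ,
      Trivializes α (f ∘ i) (i ⁻¹' O) ∧ Trivializes β (f ∘ i') (i' ⁻¹' O) := by
    intro x
    obtain ⟨O₁, hO₁, f₁, hf₁, hfO₁⟩ := exists_trivializes_closed hi α x
    obtain ⟨O₂, hO₂, f₂, hf₂, hfO₂⟩ := exists_trivializes_closed hi' β x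
    have hO := Filter.inter_mem hO₁ hO₂
    -- On the intersection both trivializations are given by the holonomy along paths from `x`.
    have hS : ∀ᶠ w in 𝓝 x, ∀ s, i (j s) = w → f₁ (j s) = f₂ (j' s) := by
      filter_upwards [eventually_exists_path (hi.comp hj) x hO] with w hw s hs
      obtain ⟨s₀, hs₀, γ, hγ⟩ := hw s hs
      have h1 : hol α (cls (γ.map j.continuous)) = hol β (cls (γ.map j'.continuous)) :=
        congrArg (fun σ : Bundle Γ S => hol σ (cls γ)) h
      rw [hfO₁ _ fun t => (hγ t).1, hfO₂ _ fun t => show i' (j' (γ t)) ∈ O₂ from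
        comm (γ t) ▸ (hγ t).2, hf₁ _ hs₀, hf₂ _ ((comm s₀).symm.trans hs₀)] at h1
      simpa using h1
    obtain ⟨O, hO', hOo, hxO⟩ := mem_nhds_iff.1 (Filter.inter_mem hO hS)
    have hf : ∀ w, ∃ g : Γ, w ∈ O → (∀ a, i a = w → g = f₁ a) ∧ ∀ b, i' b = w → g = f₂ b := by
      intro w
      by_cases hw : w ∈ range i
      · obtain ⟨a, rfl⟩ := hw
        refine ⟨f₁ a, fun hwO => ⟨fun a' ha' => by rw [hi.injective ha'], fun b hb => ?_⟩⟩
        obtain ⟨s, rfl, rfl⟩ := only a b hb.symm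
        exact (hO' hwO).2 s rfl
      · by_cases hw' : w ∈ range i'
        · obtain ⟨b, rfl⟩ := hw'
          exact ⟨f₂ b, fun _ => ⟨fun a ha => absurd ⟨a, ha⟩ hw,
            fun b' hb' => by rw [hi'.injective hb']⟩⟩
        · exact ⟨1, fun _ => ⟨fun a ha => absurd ⟨a, ha⟩ hw, fun b hb => absurd ⟨b, hb⟩ hw'⟩⟩
    choose f hf using hf
    refine ⟨O, hOo, hxO, f, fun a b γ hγ => ?_, fun a b γ hγ => ?_⟩
    · have ha : i a ∈ O := by simpa using hγ 0
      have hb : i b ∈ O := by simpa using hγ 1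
      rw [hfO₁ γ fun t => (hO' (hγ t)).1.1, Function.comp, Function.comp, (hf _ ha).1 a rfl,
        (hf _ hb).1 b rfl]
    · have ha : i' a ∈ O := by simpa using hγ 0
      have hb : i' b ∈ O := by simpa using hγ 1
      rw [hfO₂ γ fun t => (hO' (hγ t)).1.2, Function.comp, Function.comp, (hf _ ha).2 a rfl,
        (hf _ hb).2 b rfl]
  choose U hU hx f hα hβ using local_data
  obtain ⟨ρ, hρ⟩ := exists_bundle_of_local U hU hx f fun x y z hzx hzy => by
    have hO : U x ∩ U y ∈ 𝓝 z := ((hU x).inter (hU y)).mem_nhds ⟨hzx, hzy⟩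
    filter_upwards [eventually_exists_path hi z hO, eventually_exists_path hi' z hO] with w hw hw'
    have aux : ∀ a b c d : Γ, b * a⁻¹ = d * c⁻¹ → b⁻¹ * d = a⁻¹ * c := fun a b c d h => by
      rw [eq_mul_inv_iff_mul_eq] at h
      rw [← h]; simp [mul_assoc]
    rcases (cover.symm ▸ mem_univ w : w ∈ range i ∪ range i') with ⟨a, rfl⟩ | ⟨b, rfl⟩
    · obtain ⟨a₀, rfl, γ, hγ⟩ := hw a rfl
      exact aux _ _ _ _ ((hα x γ fun t => (hγ t).1).symm.trans (hα y γ fun t => (hγ t).2))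
    · obtain ⟨b₀, rfl, γ, hγ⟩ := hw' b rfl
      exact aux _ _ _ _ ((hβ x γ fun t => (hγ t).1).symm.trans (hβ y γ fun t => (hγ t).2))
  refine ⟨ρ, IsGauge.eq (isGauge_of_local fun a => ?_), IsGauge.eq (isGauge_of_local fun b => ?_)⟩
  · refine ⟨i ⁻¹' U (i a), ((hU _).preimage i.continuous).mem_nhds (hx _), fun a b γ hγ => ?_⟩
    rw [hα _ γ hγ, hol_pull, hρ _ (γ.map i.continuous) hγ]
    simp
  · refine ⟨i' ⁻¹' U (i' b), ((hU _).preimage i'.continuous).mem_nhds (hx _), fun a b γ hγ => ?_⟩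
    rw [hβ _ γ hγ, hol_pull, hρ _ (γ.map i'.continuous) hγ]
    simp

/-- Bundles on the two parts of a closed cover can be glued along an isomorphism `θ` of their
restrictions to the intersection `S` of these parts. -/
lemma exists_glued_bundle [StronglyLocallyContractibleSpace A]
    [StronglyLocallyContractibleSpace B] (hi : IsClosedEmbedding i) (hi' : IsClosedEmbedding i')
    (hj : IsClosedEmbedding j) (cover : range i ∪ range i' = univ)
    (comm : ∀ s, i (j s) = i' (j' s)) (only : ∀ p q, i p = i' q → ∃ s, p = j s ∧ q = j' s)
    {α : Bundle Γ A} {β : Bundle Γ B} {θ : S → Γ} (h : IsGauge θ (pull j α) (pull j' β)) :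
    ∃ (ρ : Bundle Γ X) (μ : A → Γ) (μ' : B → Γ), IsGauge μ (pull i ρ) α ∧
      IsGauge μ' (pull i' ρ) β ∧ ∀ s, θ s * μ (j s) = μ' (j' s) := by
  have hinj : Function.Injective j' := fun s s' hs =>
    hj.injective (hi.injective ((comm s).trans ((congrArg i' hs).trans (comm s').symm)))
  -- Extend `θ` by `1` to a map on `B` and change `β` by it; the restrictions then agree strictly.
  let μ' : B → Γ := Function.extend j' θ 1
  have hμ' : ∀ s, μ' (j' s) = θ s := fun s => hinj.extend_apply _ _ s
  have h1 : IsGauge μ'⁻¹ β (gauge μ'⁻¹ β) := isGauge_gauge _ _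
  obtain ⟨ρ, h2, h3⟩ := exists_glued_bundle_of_eq (α := α) (β := gauge μ'⁻¹ β) hi hi' hj cover comm
    only (IsGauge.eq (by
      have h4 := h.trans (h1.pull j')
      have e : (fun s => μ'⁻¹ (j' s)) * θ = 1 := by funext s; simp [hμ']
      rwa [e] at h4))
  refine ⟨ρ, 1, μ', h2 ▸ .refl _, ?_, fun s => by simp [hμ']⟩
  rw [h3]
  simpa using h1.symm

end Gluing

/-! ### Bundles on the circle -/

section Circle

variable {Γ : Type} [Group Γ] {X : Type} [TopologicalSpace X]

lemma hol_congr (ρ : Bundle Γ X) {a b a' b' : X} (γ : Path a b) (γ' : Path a' b')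
    (h : ∀ t, γ t = γ' t) : hol ρ (cls γ) = hol ρ (cls γ') := by
  obtain rfl : a = a' := by simpa using h 0
  obtain rfl : b = b' := by simpa using h 1
  rw [Path.ext (funext h)]

/-- A morphism of bundles on a path connected space is determined by its value at one point. -/
lemma IsGauge.unique [PathConnectedSpace X] {ρ ρ' : Bundle Γ X} {η η' : X → Γ}
    (h : IsGauge η ρ ρ') (h' : IsGauge η' ρ ρ') (x : X) (hx : η x = η' x) : η = η' := by
  funext w
  have h1 := (h (cls (PathConnectedSpace.somePath x w))).symm.trans (h' _)
  simpa [hx] using h1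

instance : LocallyPathConnectedSpace Circle :=
  ChartedSpace.locallyPathConnectedSpace (EuclideanSpace ℝ (Fin 1)) Circle

instance : PathConnectedSpace Circle := by
  refine ⟨⟨1⟩, fun z w => ?_⟩
  obtain ⟨s, rfl⟩ : ∃ s, Circle.exp s = z := ⟨_, Circle.exp_arg z⟩
  obtain ⟨t, rfl⟩ : ∃ s, Circle.exp s = w := ⟨_, Circle.exp_arg w⟩
  exact ⟨(PathConnectedSpace.somePath s t).map Circle.exp.continuous⟩

/-- A bundle on the circle is determined up to isomorphism by its holonomy along the standard
loop. -/
lemma exists_isGauge_circle {σ σ' : Bundle Γ Circle}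
    (h : hol σ (cls circleLoop) = hol σ' (cls circleLoop)) :
    ∃ θ : Circle → Γ, IsGauge θ σ σ' ∧ θ 1 = 1 := by
  -- Pulled back to the line, `σ` is trivialized by `F σ`; translation by the period multiplies it
  -- by the holonomy, hence the quotient `D` of two trivializations is periodic and descends.
  let F : Bundle Γ Circle → ℝ → Γ := fun σ t =>
    hol (pull Circle.exp σ) (cls (PathConnectedSpace.somePath 0 t))
  have hF : ∀ (σ : Bundle Γ Circle) {s t : ℝ} (γ : Path s t),
      hol (pull Circle.exp σ) (cls γ) = F σ t * (F σ s)⁻¹ := fun σ s t γ => by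
    have h1 : cls (PathConnectedSpace.somePath 0 t) =
        cls ((PathConnectedSpace.somePath 0 s).trans γ) :=
      Quotient.sound (SimplyConnectedSpace.paths_homotopic _ _)
    simp only [F]
    rw [h1, cls_trans, hol_comp, mul_inv_cancel_right]
  have hF0 : ∀ σ, F σ 0 = 1 := fun σ =>
    (hF σ (PathConnectedSpace.somePath 0 0)).trans (mul_inv_cancel _)
  let line : Path (0 : ℝ) (2 * Real.pi) :=
    { toFun := fun t => 2 * Real.pi * t
      continuous_toFun := by fun_prop
      source' := by simp
      target' := by simp }
  have hper : ∀ σ t, F σ (t + 2 * Real.pi) = F σ t * hol σ (cls circleLoop) := fun σ t => by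
    let p : Path (0 : ℝ) t := PathConnectedSpace.somePath 0 t
    let q : Path (0 + 2 * Real.pi) (t + 2 * Real.pi) :=
      p.map (f := fun s => s + 2 * Real.pi) (by fun_prop)
    have h1 := hF σ q
    have h2 := hF σ line
    have h3 : hol (pull Circle.exp σ) (cls q) = hol (pull Circle.exp σ) (cls p) :=
      hol_congr σ (q.map Circle.exp.continuous) (p.map Circle.exp.continuous) fun s =>
        Circle.exp_add_two_pi (p s)
    have h4 : hol (pull Circle.exp σ) (cls line) = hol σ (cls circleLoop) :=
      hol_congr σ (line.map Circle.exp.continuous) circleLoop fun s => rfl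
    rw [hF0, inv_one, mul_one, h4] at h2
    rw [h3, zero_add, ← h2, hF σ p, hF0, inv_one, mul_one, eq_mul_inv_iff_mul_eq] at h1
    exact h1.symm
  let D : ℝ → Γ := fun t => F σ' t * (F σ t)⁻¹
  have hD : Function.Periodic D (2 * Real.pi) := fun t => by
    simp only [D]
    rw [hper, hper, h]; simp [mul_assoc]
  have hDexp : ∀ t, D (Circle.exp t : ℂ).arg = D t := fun t => by
    obtain ⟨m, hm⟩ := Circle.exp_eq_exp.1 (Circle.exp_arg (Circle.exp t))
    rw [hm]
    exact hD.int_mul m t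
  refine ⟨fun z => D (z : ℂ).arg, ?_, ?_⟩
  · rintro ⟨z⟩ ⟨w⟩ p
    obtain ⟨γ, rfl⟩ := Path.Homotopic.Quotient.mk_surjective p
    change hol σ' (cls γ) = _ * hol σ (cls γ) * _
    have hz := Circle.exp_arg z
    let Λ := Circle.isCoveringMap_exp.liftPath ⟨γ, γ.continuous⟩ (z : ℂ).arg
      (γ.source.trans hz.symm)
    have hΛ : ∀ t, Circle.exp (Λ t) = γ t := fun t =>
      congrFun (Circle.isCoveringMap_exp.liftPath_lifts _ _ _) t
    let γ' : Path (Λ 0) (Λ 1) := ⟨Λ, rfl, rfl⟩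
    have h1 : ∀ σ : Bundle Γ Circle, hol σ (cls γ) = F σ (Λ 1) * (F σ (Λ 0))⁻¹ := fun σ => by
      rw [← hF σ γ']
      exact hol_congr σ γ (γ'.map Circle.exp.continuous) fun t => (hΛ t).symm
    have e0 : D (z : ℂ).arg = D (Λ 0) := by rw [← hDexp (Λ 0), hΛ, γ.source]
    have e1 : D (w : ℂ).arg = D (Λ 1) := by rw [← hDexp (Λ 1), hΛ, γ.target]
    rw [h1, h1]
    change _ = D (w : ℂ).arg * _ * (D (z : ℂ).arg)⁻¹
    rw [e0, e1]; simp [D, mul_assoc]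
  · simp [D, hF0]

end Circle

/-! ### Local contractibility of manifolds with corners -/

lemma quadrant_slc (n : ℕ) : StronglyLocallyContractibleSpace (EuclideanQuadrant n) where
  contractible_basis x := by
    rw [Filter.hasBasis_self]
    intro N hN
    obtain ⟨N', hN', hsub⟩ := mem_nhds_induced Subtype.val x N |>.1 hN
    obtain ⟨r, hr, hball⟩ := Metric.mem_nhds_iff.1 hN'
    refine ⟨Subtype.val ⁻¹' Metric.ball x.1 r, ?_, ?_, (preimage_mono hball).trans hsub⟩
    · exact continuous_subtype_val.continuousAt.preimage_mem_nhds (Metric.ball_mem_nhds _ hr)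
    · have hconv := ((convex_ball x.1 r).inter (EuclideanQuadrant.convex (n := n)))
      have hc := hconv.contractibleSpace ⟨x.1, Metric.mem_ball_self hr, x.2⟩
      let e : (Subtype.val ⁻¹' Metric.ball x.1 r : Set (EuclideanQuadrant n)) ≃ₜ
          (Metric.ball x.1 r ∩ {y : EuclideanSpace ℝ (Fin n) | ∀ i, 0 ≤ y i} : Set _) :=
        { toFun := fun y => ⟨y.1.1, y.2, y.1.2⟩
          invFun := fun y => ⟨⟨y.1, y.2.2⟩, y.2.1⟩
          left_inv := fun _ => rfl
          right_inv := fun _ => rfl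
          continuous_toFun :=
            Continuous.subtype_mk (continuous_subtype_val.comp continuous_subtype_val) _
          continuous_invFun :=
            Continuous.subtype_mk (Continuous.subtype_mk continuous_subtype_val _) _ }
      exact e.contractibleSpace_iff.2 hc

instance {a b c d : Type} {h1 : Surface a b} {h2 : Surface c d} {v1 : Surface a c}
    {v2 : Surface b d} (C : CornerMfd h1 h2 v1 v2) : StronglyLocallyContractibleSpace C.carrier :=
  have := quadrant_slc 3
  chartedSpace_slc (EuclideanQuadrant 3) C.carrier

/-! ### Integration over groupoids -/

section Groupoid

variable {G H M : Type*} [Groupoid G] [Groupoid H] [AddCommGroup M] [Module ℂ M]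

lemma isIsomorphic_iff {a b : G} : IsIsomorphic a b ↔ Nonempty (a ⟶ b) :=
  ⟨fun h => ⟨h.some.hom⟩, fun ⟨f⟩ => ⟨⟨f, Groupoid.inv f, by simp, by simp⟩⟩⟩

lemma mk_eq_iff {a b : G} : (Quotient.mk (isIsomorphicSetoid G) a = Quotient.mk _ b) ↔
    Nonempty (a ⟶ b) := Quotient.eq.trans isIsomorphic_iff

lemma nonempty_out_hom (a : G) :
    Nonempty ((Quotient.mk (isIsomorphicSetoid G) a).out ⟶ a) :=
  mk_eq_iff.1 (Quotient.out_eq _)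

lemma eq_of_out_hom {c d : Quotient (isIsomorphicSetoid G)} (f : c.out ⟶ d.out) : c = d :=
  (Quotient.out_eq c).symm.trans ((mk_eq_iff.2 ⟨f⟩).trans (Quotient.out_eq d))

lemma card_hom_eq {a b c : G} (h : Nonempty (c ⟶ a)) (h' : Nonempty (c ⟶ b)) :
    Nat.card (a ⟶ b) = Nat.card (c ⟶ c) := by
  obtain ⟨f⟩ := h
  obtain ⟨g⟩ := h'
  exact Nat.card_congr
    { toFun := fun u => f ≫ u ≫ Groupoid.inv g
      invFun := fun u => Groupoid.inv f ≫ u ≫ g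
      left_inv := fun u => by simp
      right_inv := fun u => by simp }

/-- The sum over a groupoid can be computed from any finite family `s` of objects that meets all
isomorphism classes. -/
lemma gsum_eq_sum [∀ a b : G, Finite (a ⟶ b)] {T : Type*} [Fintype T] (s : T → G)
    (hs : ∀ g, ∃ t, Nonempty (s t ⟶ g)) (F : G → M)
    (hF : ∀ a b, Nonempty (a ⟶ b) → F a = F b) :
    gsum G F = ∑ t, (Nat.card (Σ t', s t ⟶ s t') : ℂ)⁻¹ • F (s t) := by
  classical
  let κ : T → Quotient (isIsomorphicSetoid G) := fun t => Quotient.mk _ (s t)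
  have hκ : Function.Surjective κ := fun c => by
    obtain ⟨t, ht⟩ := hs c.out
    exact ⟨t, (mk_eq_iff.2 ht).trans (Quotient.out_eq c)⟩
  have : Finite (Quotient (isIsomorphicSetoid G)) := Finite.of_surjective κ hκ
  let _ := Fintype.ofFinite (Quotient (isIsomorphicSetoid G))
  rw [gsum, finsum_eq_sum_of_fintype, ← Finset.sum_fiberwise Finset.univ κ]
  refine Finset.sum_congr rfl fun c _ => ?_
  have hout : ∀ t, κ t = c → Nonempty (c.out ⟶ s t) := fun t ht => ht ▸ nonempty_out_hom (s t)
  have hcard : ∀ t, κ t = c → (Nat.card (Σ t', s t ⟶ s t') : ℂ) =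
      (Finset.univ.filter fun t => κ t = c).card * Nat.card (c.out ⟶ c.out) := fun t ht => by
    rw [Nat.card_sigma, Finset.card_filter, Nat.cast_sum, Nat.cast_sum, Finset.sum_mul]
    refine Finset.sum_congr rfl fun t' _ => ?_
    split_ifs with h
    · rw [card_hom_eq (hout t ht) (hout t' h)]; simp
    · have : IsEmpty (s t ⟶ s t') := ⟨fun f => h ((mk_eq_iff.2 ⟨f⟩).symm.trans ht)⟩
      simp
  have hne : ((Finset.univ.filter fun t => κ t = c).card : ℂ) ≠ 0 := by
    obtain ⟨t, ht⟩ := hκ c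
    exact Nat.cast_ne_zero.2 (Finset.card_ne_zero.2 ⟨t, by simp [ht]⟩)
  have hsum : ∀ t ∈ Finset.univ.filter (fun t => κ t = c),
      (Nat.card (Σ t', s t ⟶ s t') : ℂ)⁻¹ • F (s t) =
        ((Finset.univ.filter fun t => κ t = c).card * Nat.card (c.out ⟶ c.out) : ℂ)⁻¹ • F c.out :=
    fun t ht => by
      have ht := (Finset.mem_filter.1 ht).2
      rw [hcard t ht, hF _ _ (hout t ht)]
  rw [Finset.sum_congr rfl hsum, Finset.sum_const, ← Nat.cast_smul_eq_nsmul ℂ, smul_smul, mul_inv,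
    mul_inv_cancel_left₀ hne]

/-- If every object is the source of exactly `n` morphisms, then the sum over the groupoid is the
average over its objects. -/
lemma gsum_eq_sum_objects [Fintype G] [∀ a b : G, Finite (a ⟶ b)] {n : ℕ}
    (hn : ∀ a : G, Nat.card (Σ b, a ⟶ b) = n) (F : G → M)
    (hF : ∀ a b, Nonempty (a ⟶ b) → F a = F b) : gsum G F = (n : ℂ)⁻¹ • ∑ a, F a := by
  rw [gsum_eq_sum id (fun g => ⟨g, ⟨𝟙 g⟩⟩) F hF, Finset.smul_sum]
  exact Finset.sum_congr rfl fun a _ => by rw [← hn a]; rfl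

/-- The homotopy fibre of a functor of groupoids over `h`: objects of the source together with a
morphism from their image to `h`. -/
structure Fib (p : G ⥤ H) (h : H) where
  pt : G
  arr : p.obj pt ⟶ h

instance (p : G ⥤ H) (h : H) : Groupoid (Fib p h) where
  Hom a b := {f : a.pt ⟶ b.pt // p.map f ≫ b.arr = a.arr}
  id a := ⟨𝟙 _, by simp⟩
  comp f g := ⟨f.1 ≫ g.1, by rw [p.map_comp, Category.assoc, g.2, f.2]⟩
  inv {a b} f := ⟨Groupoid.inv f.1, by
    simpa using f.2.symm⟩
  id_comp f := Subtype.ext (Category.id_comp _)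
  comp_id f := Subtype.ext (Category.comp_id _)
  assoc f g h := Subtype.ext (Category.assoc _ _ _)
  inv_comp f := Subtype.ext (Groupoid.inv_comp _)
  comp_inv f := Subtype.ext (Groupoid.comp_inv _)

instance (p : G ⥤ H) (h : H) [∀ a b : G, Finite (a ⟶ b)] (z w : Fib p h) : Finite (z ⟶ w) :=
  inferInstanceAs (Finite {f : z.pt ⟶ w.pt // p.map f ≫ w.arr = z.arr})

/-- `gsum` commutes with linear maps. -/
lemma map_gsum [Finite (Quotient (isIsomorphicSetoid G))] {N : Type*} [AddCommGroup N] [Module ℂ N]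
    (f : M →ₗ[ℂ] N) (F : G → M) : f (gsum G F) = gsum G fun g => f (F g) := by
  let _ := Fintype.ofFinite (Quotient (isIsomorphicSetoid G))
  rw [gsum, gsum, finsum_eq_sum_of_fintype, finsum_eq_sum_of_fintype, map_sum]
  simp

/-- The sum over the homotopy fibre depends only on the isomorphism class of the base point. -/
lemma gsum_fib_congr (p : G ⥤ H) {h h' : H} (u : h ⟶ h') (F : G → M)
    (hF : ∀ a b, Nonempty (a ⟶ b) → F a = F b) :
    gsum (Fib p h') (fun z => F z.pt) = gsum (Fib p h) fun z => F z.pt := by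
  refine gsum_congr (fun z : Fib p h => (⟨z.pt, z.arr ≫ u⟩ : Fib p h')) (fun z w => ?_)
    (fun w => ⟨⟨w.pt, w.arr ≫ Groupoid.inv u⟩, ?_⟩) _ _ fun z w ⟨f⟩ => (hF _ _ ⟨f.1⟩).symm
  · exact
      { toFun := fun f => ⟨f.1, by rw [← Category.assoc, f.2]⟩
        invFun := fun f => ⟨f.1, by
          have h1 : p.map f.1 ≫ w.arr ≫ u = z.arr ≫ u := f.2
          rw [← Category.assoc] at h1
          exact (cancel_mono u).1 h1⟩
        left_inv := fun _ => rfl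
        right_inv := fun _ => rfl }
  · exact ⟨(⟨𝟙 w.pt, by simp⟩ : {f : w.pt ⟶ w.pt // p.map f ≫ w.arr =
      (w.arr ≫ Groupoid.inv u) ≫ u})⟩

/-- Every isomorphism class of the homotopy fibre is represented by an object over the chosen system
of representatives of `G`. -/
lemma finite_fib [∀ a b : H, Finite (a ⟶ b)] [Finite (Quotient (isIsomorphicSetoid G))]
    (p : G ⥤ H) (h : H) : Finite (Quotient (isIsomorphicSetoid (Fib p h))) := by
  refine Finite.of_surjective (α := Σ e : Quotient (isIsomorphicSetoid G), p.obj e.out ⟶ h)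
    (fun t => Quotient.mk _ ⟨t.1.out, t.2⟩) fun c => ?_
  obtain ⟨z, rfl⟩ := Quotient.exists_rep c
  obtain ⟨f⟩ := nonempty_out_hom z.pt
  exact ⟨⟨_, p.map f ≫ z.arr⟩, mk_eq_iff.2 ⟨⟨f, rfl⟩⟩⟩

variable [∀ a b : G, Finite (a ⟶ b)] [∀ a b : H, Finite (a ⟶ b)]

/-- The sum over a homotopy fibre in terms of the source: each class `e` contributes once for every
morphism from its image to `h`. -/
lemma gsum_fib [Fintype (Quotient (isIsomorphicSetoid G))] (p : G ⥤ H) (h : H) (F : G → M)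
    (hF : ∀ a b, Nonempty (a ⟶ b) → F a = F b) :
    gsum (Fib p h) (fun z => F z.pt) = ∑ e : Quotient (isIsomorphicSetoid G),
      ((Nat.card (p.obj e.out ⟶ h) : ℂ) * (Nat.card (e.out ⟶ e.out) : ℂ)⁻¹) • F e.out := by
  classical
  let _ := fun e : Quotient (isIsomorphicSetoid G) => Fintype.ofFinite (p.obj e.out ⟶ h)
  let s : (Σ e : Quotient (isIsomorphicSetoid G), p.obj e.out ⟶ h) → Fib p h :=
    fun t => ⟨t.1.out, t.2⟩
  rw [gsum_eq_sum s, Fintype.sum_sigma]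
  · refine Finset.sum_congr rfl fun e _ => ?_
    have hcard : ∀ α : p.obj e.out ⟶ h,
        Nat.card (Σ t', s ⟨e, α⟩ ⟶ s t') = Nat.card (e.out ⟶ e.out) := fun α => by
      refine Nat.card_congr
        { toFun := fun t => t.2.1 ≫ eqToHom (congrArg Quotient.out
            (eq_of_out_hom (show e.out ⟶ t.1.1.out from t.2.1)).symm)
          invFun := fun f => ⟨⟨e, p.map (Groupoid.inv f) ≫ α⟩, f, ?_⟩
          left_inv := ?_
          right_inv := fun f => by simp }
      · change p.map f ≫ p.map (Groupoid.inv f) ≫ α = α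
        rw [← Category.assoc, ← p.map_comp]; simp
      · rintro ⟨⟨e', α'⟩, ⟨f, hf⟩⟩
        obtain rfl : e = e' := eq_of_out_hom (show e.out ⟶ e'.out from f)
        have gen : ∀ (f' : s ⟨e, α⟩ ⟶ s ⟨e, α'⟩) (β : p.obj e.out ⟶ h)
            (hβ : p.map f'.1 ≫ β = α), f'.1 = f → β = α' →
            (⟨⟨e, β⟩, f'.1, hβ⟩ : Σ t', s ⟨e, α⟩ ⟶ s t') = ⟨⟨e, α'⟩, f, hf⟩ := by
          rintro _ _ _ rfl rfl; rfl
        have e1 : f ≫ 𝟙 _ = f := Category.comp_id f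
        refine gen ⟨f ≫ 𝟙 _, by rw [e1, hf]⟩ _ _ e1 ?_
        change p.map (Groupoid.inv (f ≫ 𝟙 _)) ≫ α = α'
        rw [e1, show α = _ from hf.symm]
        change p.map (Groupoid.inv f) ≫ p.map f ≫ α' = α'
        rw [← Category.assoc, ← p.map_comp]; simp
    simp only [hcard, s]
    rw [Finset.sum_const, ← Nat.cast_smul_eq_nsmul ℂ, smul_smul, Finset.card_univ,
      Nat.card_eq_fintype_card (α := p.obj e.out ⟶ h)]
  · intro z
    obtain ⟨f⟩ := nonempty_out_hom z.pt
    exact ⟨⟨_, p.map f ≫ z.arr⟩, ⟨⟨f, rfl⟩⟩⟩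
  · rintro a b ⟨f⟩
    exact hF _ _ ⟨f.1⟩

/-- The sum over a groupoid is the sum over the base of the sums over the homotopy fibres. -/
lemma gsum_fubini [Finite (Quotient (isIsomorphicSetoid G))] (p : G ⥤ H) (F : G → M)
    (hF : ∀ a b, Nonempty (a ⟶ b) → F a = F b) :
    gsum G F = gsum H fun h => gsum (Fib p h) fun z => F z.pt := by
  classical
  let _ := Fintype.ofFinite (Quotient (isIsomorphicSetoid G))
  simp only [gsum_fib p _ F hF]
  rw [gsum, gsum, finsum_eq_sum_of_fintype]
  simp only [Finset.smul_sum]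
  have hz : ∀ (e : Quotient (isIsomorphicSetoid G)) (c : Quotient (isIsomorphicSetoid H)),
      c ≠ Quotient.mk _ (p.obj e.out) → Nat.card (p.obj e.out ⟶ c.out) = 0 := fun e c hc => by
    have : IsEmpty (p.obj e.out ⟶ c.out) :=
      ⟨fun f => hc ((mk_eq_iff.2 ⟨f⟩).trans (Quotient.out_eq c)).symm⟩
    simp
  rw [finsum_sum_comm]
  · refine Finset.sum_congr rfl fun e _ => ?_
    rw [finsum_eq_single _ (Quotient.mk _ (p.obj e.out))]
    · rw [card_hom_eq (nonempty_out_hom (p.obj e.out)) ⟨𝟙 _⟩, smul_smul, ← mul_assoc,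
        inv_mul_cancel₀, one_mul]
      have : Nonempty ((Quotient.mk (isIsomorphicSetoid H) (p.obj e.out)).out ⟶
        (Quotient.mk (isIsomorphicSetoid H) (p.obj e.out)).out) := ⟨𝟙 _⟩
      exact Nat.cast_ne_zero.2 Nat.card_pos.ne'
    · intro c hc
      simp [hz e c hc]
  · intro e _
    refine (finite_singleton (Quotient.mk _ (p.obj e.out))).subset fun c hc => ?_
    by_contra h
    exact hc (by simp [hz e c h])

lemma gsum_prod [Finite (Quotient (isIsomorphicSetoid G))]
    [Finite (Quotient (isIsomorphicSetoid H))] (F : G × H → M)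
    (hF : ∀ a b, Nonempty (a ⟶ b) → F a = F b) :
    gsum (G × H) F = gsum G fun g => gsum H fun h => F (g, h) := by
  let _ := Fintype.ofFinite (Quotient (isIsomorphicSetoid G))
  let _ := Fintype.ofFinite (Quotient (isIsomorphicSetoid H))
  have : ∀ a b : G × H, Finite (a ⟶ b) := fun a b =>
    inferInstanceAs (Finite ((a.1 ⟶ b.1) × (a.2 ⟶ b.2)))
  let s : Quotient (isIsomorphicSetoid G) × Quotient (isIsomorphicSetoid H) → G × H :=
    fun t => (t.1.out, t.2.out)
  rw [gsum_eq_sum s, Fintype.sum_prod_type, gsum, finsum_eq_sum_of_fintype]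
  · refine Finset.sum_congr rfl fun c _ => ?_
    rw [gsum, finsum_eq_sum_of_fintype, Finset.smul_sum]
    refine Finset.sum_congr rfl fun d _ => ?_
    rw [smul_smul, ← mul_inv, ← Nat.cast_mul, ← Nat.card_prod]
    congr 3
    refine Nat.card_congr
      { toFun := fun t => (t.2.1 ≫ eqToHom (congrArg Quotient.out (eq_of_out_hom
            (show c.out ⟶ t.1.1.out from t.2.1)).symm),
          t.2.2 ≫ eqToHom (congrArg Quotient.out (eq_of_out_hom
            (show d.out ⟶ t.1.2.out from t.2.2)).symm))
        invFun := fun f => ⟨(c, d), f⟩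
        left_inv := ?_
        right_inv := fun f => by simp }
    · rintro ⟨⟨c', d'⟩, f⟩
      obtain rfl : c = c' := eq_of_out_hom (show c.out ⟶ c'.out from f.1)
      obtain rfl : d = d' := eq_of_out_hom (show d.out ⟶ d'.out from f.2)
      simp [s]
  · intro g
    exact ⟨(Quotient.mk _ g.1, Quotient.mk _ g.2),
      ⟨((nonempty_out_hom g.1).some, (nonempty_out_hom g.2).some)⟩⟩
  · exact hF

end Groupoid

/-! ### The groupoid of bundles on a 3-manifold with two prescribed faces -/

section Total

variable {Γ : Type} [Group Γ] {a b c d : Type} {h1 : Surface a b} {h2 : Surface c d}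
  {v1 : Surface a c} {v2 : Surface b d}

/-- The groupoid of all bundles on `C` with prescribed restrictions `φ'` and `ψ'` to the faces `v1`
and `h2` only. To an object belongs the choice of bundles `φ` and `ψ` isomorphic to the
restrictions to the other two faces, but morphisms need not respect this choice. -/
structure Tot (C : CornerMfd h1 h2 v1 v2) {x : a → Γ} {y' : c → Γ} {z : d → Γ}
    (φ' : BunCat v1 x y') (ψ' : BunCat h2 y' z) where
  y : b → Γ
  φ : BunCat h1 x y
  ψ : BunCat v2 y z
  fill : Filling C φ ψ φ' ψ'

variable {C : CornerMfd h1 h2 v1 v2} {x : a → Γ} {y' : c → Γ} {z : d → Γ}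
  {φ' : BunCat v1 x y'} {ψ' : BunCat h2 y' z}

/-- A morphism of bundles on `C` that is compatible with the identifications over `v1` and `h2`. -/
@[ext]
structure Tot.Hom (P Q : Tot C φ' ψ') where
  η : C.carrier → Γ
  isGauge : IsGauge η P.fill.ρ Q.fill.ρ
  cv1 : ∀ p, Q.fill.θv1 p * η (C.iv1 p) = P.fill.θv1 p
  ch2 : ∀ p, Q.fill.θh2 p * η (C.ih2 p) = P.fill.θh2 p

instance : Groupoid (Tot C φ' ψ') where
  Hom := Tot.Hom
  id P := ⟨1, .refl _, fun _ => mul_one _, fun _ => mul_one _⟩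
  comp f g := ⟨g.η * f.η, f.isGauge.trans g.isGauge,
    fun p => by rw [← f.cv1, ← g.cv1]; exact (mul_assoc _ _ _).symm,
    fun p => by rw [← f.ch2, ← g.ch2]; exact (mul_assoc _ _ _).symm⟩
  inv f := ⟨f.η⁻¹, f.isGauge.symm, fun p => by simp [← f.cv1], fun p => by simp [← f.ch2]⟩
  id_comp f := Tot.Hom.ext (mul_one f.η)
  comp_id f := Tot.Hom.ext (one_mul f.η)
  assoc f g h := Tot.Hom.ext (mul_assoc h.η g.η f.η).symm
  inv_comp f := Tot.Hom.ext (mul_inv_cancel f.η)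
  comp_inv f := Tot.Hom.ext (inv_mul_cancel f.η)

/-- The groupoid of pairs of bundles on `h1` and `v2` whose holonomies along the common circles
agree; morphisms are trivial at the base points of all other circles. -/
structure BunPair (h1 : Surface a b) (v2 : Surface b d) (x : a → Γ) (z : d → Γ) where
  y : b → Γ
  φ : BunCat h1 x y
  ψ : BunCat v2 y z

/-- A pair of morphisms of bundles that agree at the base points of the common circles. -/
@[ext]
structure BunPair.Hom (p q : BunPair h1 v2 x z) where
  η₁ : h1.carrier → Γ
  η₂ : v2.carrier → Γ
  gauge₁ : IsGauge η₁ p.φ.ρ q.φ.ρ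
  gauge₂ : IsGauge η₂ p.ψ.ρ q.ψ.ρ
  inc : ∀ i, η₁ (h1.inc i 1) = 1
  mid : ∀ j, η₁ (h1.out j 1) = η₂ (v2.inc j 1)
  out : ∀ k, η₂ (v2.out k 1) = 1

instance : Groupoid (BunPair h1 v2 x z) where
  Hom := BunPair.Hom
  id p := ⟨1, 1, .refl _, .refl _, fun _ => rfl, fun _ => rfl, fun _ => rfl⟩
  comp f g := ⟨g.η₁ * f.η₁, g.η₂ * f.η₂, f.gauge₁.trans g.gauge₁, f.gauge₂.trans g.gauge₂,
    fun i => by simp [f.inc, g.inc], fun i => by simp [f.mid, g.mid],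
    fun i => by simp [f.out, g.out]⟩
  inv f := ⟨f.η₁⁻¹, f.η₂⁻¹, f.gauge₁.symm, f.gauge₂.symm, fun i => by simp [f.inc],
    fun i => by simp [f.mid], fun i => by simp [f.out]⟩
  id_comp f := BunPair.Hom.ext (mul_one f.η₁) (mul_one f.η₂)
  comp_id f := BunPair.Hom.ext (one_mul f.η₁) (one_mul f.η₂)
  assoc f g h := BunPair.Hom.ext (mul_assoc h.η₁ g.η₁ f.η₁).symm (mul_assoc h.η₂ g.η₂ f.η₂).symm
  inv_comp f := BunPair.Hom.ext (mul_inv_cancel f.η₁) (mul_inv_cancel f.η₂)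
  comp_inv f := BunPair.Hom.ext (inv_mul_cancel f.η₁) (inv_mul_cancel f.η₂)

lemma BunPair.Hom.moves₁ {p q : BunPair h1 v2 x z} (f : p ⟶ q) :
    Moves 1 (fun j => f.η₁ (h1.out j 1)) p.φ q.φ := ⟨f.η₁, f.gauge₁, f.inc, fun _ => rfl⟩

lemma BunPair.Hom.moves₂ {p q : BunPair h1 v2 x z} (f : p ⟶ q) :
    Moves (fun j => f.η₁ (h1.out j 1)) 1 p.ψ q.ψ :=
  ⟨f.η₂, f.gauge₂, fun j => (f.mid j).symm, f.out⟩

lemma BunPair.hom_of_moves {p q : BunPair h1 v2 x z} {k : b → Γ} (m₁ : Moves 1 k p.φ q.φ)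
    (m₂ : Moves k 1 p.ψ q.ψ) : Nonempty (p ⟶ q) := by
  obtain ⟨η₁, g₁, e₁, e₂⟩ := m₁
  obtain ⟨η₂, g₂, e₃, e₄⟩ := m₂
  exact ⟨⟨η₁, η₂, g₁, g₂, e₁, fun j => by rw [e₂, e₃], e₄⟩⟩

/-- The group `Γ^b` acting on itself by conjugation, as a groupoid. -/
structure ConjGpd (Γ b : Type) where
  pt : b → Γ

instance : Groupoid (ConjGpd Γ b) where
  Hom p q := {k : b → Γ // q.pt = k * p.pt * k⁻¹}
  id p := ⟨1, by simp⟩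
  comp f g := ⟨g.1 * f.1,
    (g.2.trans (congrArg (fun t => g.1 * t * g.1⁻¹) f.2)).trans (by simp [mul_assoc])⟩
  inv f := ⟨f.1⁻¹, by
    simpa [mul_assoc] using (congrArg (fun t => f.1⁻¹ * t * f.1) f.2).symm⟩
  id_comp f := Subtype.ext (mul_one f.1)
  comp_id f := Subtype.ext (one_mul f.1)
  assoc f g h := Subtype.ext (mul_assoc h.1 g.1 f.1).symm
  inv_comp f := Subtype.ext (mul_inv_cancel f.1)
  comp_inv f := Subtype.ext (inv_mul_cancel f.1)

/-- Objects of the conjugation groupoid are elements of `Γ^b`. -/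
def ConjGpd.equiv : ConjGpd Γ b ≃ (b → Γ) := ⟨ConjGpd.pt, ConjGpd.mk, fun _ => rfl, fun _ => rfl⟩

lemma ConjGpd.card_hom (p : ConjGpd Γ b) : Nat.card (Σ q, p ⟶ q) = Nat.card (b → Γ) :=
  Nat.card_congr
    { toFun := fun t => t.2.1
      invFun := fun k => ⟨⟨k * p.pt * k⁻¹⟩, k, rfl⟩
      left_inv := by
        rintro ⟨⟨q⟩, ⟨k, hk⟩⟩
        change q = _ at hk
        subst hk
        rfl
      right_inv := fun _ => rfl }

/-- The holonomies along the common circles. -/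
noncomputable def BunPair.toConj (h1 : Surface a b) (v2 : Surface b d) (x : a → Γ) (z : d → Γ) :
    BunPair h1 v2 x z ⥤ ConjGpd Γ b where
  obj p := ⟨p.y⟩
  map f := ⟨fun j => f.η₁ (h1.out j 1), f.moves₁.out_eq⟩
  map_id _ := rfl
  map_comp _ _ := rfl

/-- The restriction of bundles on `C` to the faces `h1` and `v2`, transported to the bundles `φ` and
`ψ` that belong to the objects. -/
noncomputable def Tot.toPair (C : CornerMfd h1 h2 v1 v2) (φ' : BunCat v1 x y')
    (ψ' : BunCat h2 y' z) : Tot C φ' ψ' ⥤ BunPair h1 v2 x z where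
  obj P := ⟨P.y, P.φ, P.ψ⟩
  map {P Q} f :=
    { η₁ := Q.fill.θh1 * (fun p => f.η (C.ih1 p)) * P.fill.θh1⁻¹
      η₂ := Q.fill.θv2 * (fun p => f.η (C.iv2 p)) * P.fill.θv2⁻¹
      gauge₁ := by
        simpa [mul_assoc] using P.fill.gh1.symm.trans ((f.isGauge.pull C.ih1).trans Q.fill.gh1)
      gauge₂ := by
        simpa [mul_assoc] using P.fill.gv2.symm.trans ((f.isGauge.pull C.iv2).trans Q.fill.gv2)
      inc := fun i => by simp [P.fill.d1, Q.fill.d1, C.d1, ← f.cv1]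
      mid := fun j => by simp [P.fill.d2, Q.fill.d2, C.d2]
      out := fun k => by simp [← P.fill.u2, ← Q.fill.u2, ← C.u2, ← f.ch2] }
  map_id P := BunPair.Hom.ext
    (funext fun p => show P.fill.θh1 p * 1 * (P.fill.θh1 p)⁻¹ = 1 by simp)
    (funext fun p => show P.fill.θv2 p * 1 * (P.fill.θv2 p)⁻¹ = 1 by simp)
  map_comp {P Q R} f g := BunPair.Hom.ext
    (funext fun p => show R.fill.θh1 p * (g.η (C.ih1 p) * f.η (C.ih1 p)) * (P.fill.θh1 p)⁻¹ =
      (R.fill.θh1 p * g.η (C.ih1 p) * (Q.fill.θh1 p)⁻¹) *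
        (Q.fill.θh1 p * f.η (C.ih1 p) * (P.fill.θh1 p)⁻¹) by simp [mul_assoc])
    (funext fun p => show R.fill.θv2 p * (g.η (C.iv2 p) * f.η (C.iv2 p)) * (P.fill.θv2 p)⁻¹ =
      (R.fill.θv2 p * g.η (C.iv2 p) * (Q.fill.θv2 p)⁻¹) *
        (Q.fill.θv2 p * f.η (C.iv2 p) * (P.fill.θv2 p)⁻¹) by simp [mul_assoc])

/-! ### Finiteness of the groupoids -/

variable [Finite Γ] [Finite a] [Finite b] [Finite c] [Finite d]

instance (P Q : Tot C φ' ψ') : Finite (P ⟶ Q) := by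
  obtain ⟨S, hS⟩ := exists_finite_points (Γ := Γ) C.carrier
  refine Finite.of_injective (fun (f : P ⟶ Q) (p : S) => Tot.Hom.η f p) fun f f' h => ?_
  exact Tot.Hom.ext (hS _ _ _ _ f.isGauge f'.isGauge fun p hp => congrFun h ⟨p, hp⟩)

instance (p q : BunPair h1 v2 x z) : Finite (p ⟶ q) := by
  obtain ⟨S, hS⟩ := exists_finite_points (Γ := Γ) h1.carrier
  obtain ⟨S', hS'⟩ := exists_finite_points (Γ := Γ) v2.carrier
  refine Finite.of_injective (β := (S → Γ) × (S' → Γ)) (fun (f : p ⟶ q) =>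
    (fun s => BunPair.Hom.η₁ f s, fun s => BunPair.Hom.η₂ f s)) fun f f' h => ?_
  exact BunPair.Hom.ext
    (hS _ _ _ _ f.gauge₁ f'.gauge₁ fun p hp => congrFun (congrArg Prod.fst h) ⟨p, hp⟩)
    (hS' _ _ _ _ f.gauge₂ f'.gauge₂ fun p hp => congrFun (congrArg Prod.snd h) ⟨p, hp⟩)

instance (p q : ConjGpd Γ b) : Finite (p ⟶ q) :=
  inferInstanceAs (Finite {k : b → Γ // q.pt = k * p.pt * k⁻¹})

instance : Finite (Quotient (isIsomorphicSetoid (BunPair h1 v2 x z))) := by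
  refine Finite.of_surjective
    (α := Σ y : b → Γ, Quotient (isIsomorphicSetoid (BunCat h1 x y)) ×
      Quotient (isIsomorphicSetoid (BunCat v2 y z)))
    (fun t => Quotient.mk _ ⟨t.1, t.2.1.out, t.2.2.out⟩) fun e => ?_
  obtain ⟨p, rfl⟩ := Quotient.exists_rep e
  exact ⟨⟨p.y, Quotient.mk _ p.φ, Quotient.mk _ p.ψ⟩, mk_eq_iff.2 (BunPair.hom_of_moves (k := 1)
    (moves_one.2 (nonempty_out_hom p.φ)) (moves_one.2 (nonempty_out_hom p.ψ)))⟩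

/-- A class is determined by finitely many holonomies and by the values of the identifications over
`v1` and `h2` at finitely many points. -/
instance : Finite (Quotient (isIsomorphicSetoid (Tot C φ' ψ'))) := by
  obtain ⟨S, hS⟩ := exists_finite_points (Γ := Γ) v1.carrier
  obtain ⟨S', hS'⟩ := exists_finite_points (Γ := Γ) h2.carrier
  obtain ⟨T, hT, s, t, p, hp⟩ := exists_finite_test (Γ := Γ) C.carrier
    (C.iv1 '' S ∪ C.ih2 '' S') ((S.finite_toSet.image _).union (S'.finite_toSet.image _))
  refine Finite.of_injective (β := (T → Γ) × (S → Γ) × (S' → Γ))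
    (fun (e : Quotient (isIsomorphicSetoid (Tot C φ' ψ'))) =>
      (fun i => hol e.out.fill.ρ (p i), fun q => e.out.fill.θv1 q, fun q => e.out.fill.θh2 q))
    fun e e' h => ?_
  rw [Prod.mk.injEq, Prod.mk.injEq] at h
  obtain ⟨η, g, hη⟩ := hp _ _ (congrFun h.1)
  rw [← Quotient.out_eq e, ← Quotient.out_eq e']
  refine mk_eq_iff.2 ⟨⟨η, g, fun q => ?_, fun q => ?_⟩⟩
  · refine congrFun (hS _ _ _ _ ((g.pull C.iv1).trans e'.out.fill.gv1) e.out.fill.gv1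
      fun r hr => ?_) q
    have h1 := congrFun h.2.1 ⟨r, hr⟩
    simp only [Pi.mul_apply, hη _ (Or.inl ⟨r, hr, rfl⟩), mul_one]
    exact h1.symm
  · refine congrFun (hS' _ _ _ _ ((g.pull C.ih2).trans e'.out.fill.gh2) e.out.fill.gh2
      fun r hr => ?_) q
    have h1 := congrFun h.2.2 ⟨r, hr⟩
    simp only [Pi.mul_apply, hη _ (Or.inr ⟨r, hr, rfl⟩), mul_one]
    exact h1.symm

end Total

/-! ### The invariant of a 3-manifold as one integral -/

section Total

variable {Γ : Type} [Group Γ] {a b c d : Type} {h1 : Surface a b} {h2 : Surface c d}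
  {v1 : Surface a c} {v2 : Surface b d} {C : CornerMfd h1 h2 v1 v2} {x : a → Γ} {y' : c → Γ}
  {z : d → Γ} {φ' : BunCat v1 x y'} {ψ' : BunCat h2 y' z}

/-- The fillings with boundary values `φ, ψ, φ', ψ'` form the homotopy fibre of the restriction
functor. -/
lemma Y_eq_gsum_fib (p : BunPair h1 v2 x z) :
    gsum (Fib (Tot.toPair C φ' ψ') p) (fun _ => (1 : ℂ)) = Y C p.φ p.ψ φ' ψ' := by
  refine gsum_congr (fun P => (⟨⟨p.y, p.φ, p.ψ, P⟩, 𝟙 p⟩ : Fib (Tot.toPair C φ' ψ') p))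
    (fun P Q => ?_) (fun z => ?_) _ _ fun _ _ _ => rfl
  · exact
      { toFun := fun f => ⟨⟨f.η, f.isGauge, f.cv1, f.ch2⟩, BunPair.Hom.ext
          (funext fun p => show 1 * (Q.θh1 p * f.η (C.ih1 p) * (P.θh1 p)⁻¹) = 1 by
            rw [f.ch1]; simp)
          (funext fun p => show 1 * (Q.θv2 p * f.η (C.iv2 p) * (P.θv2 p)⁻¹) = 1 by
            rw [f.cv2]; simp)⟩
        invFun := fun f => ⟨f.1.η, f.1.isGauge, fun p => by
            have h : 1 * (Q.θh1 p * f.1.η (C.ih1 p) * (P.θh1 p)⁻¹) = 1 :=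
              congrFun (congrArg BunPair.Hom.η₁ f.2) p
            rwa [one_mul, mul_inv_eq_one] at h, fun p => by
            have h : 1 * (Q.θv2 p * f.1.η (C.iv2 p) * (P.θv2 p)⁻¹) = 1 :=
              congrFun (congrArg BunPair.Hom.η₂ f.2) p
            rwa [one_mul, mul_inv_eq_one] at h, f.1.cv1, f.1.ch2⟩
        left_inv := fun _ => rfl
        right_inv := fun _ => rfl }
  · obtain ⟨P, f⟩ := z
    refine ⟨{ P.fill with
        θh1 := f.η₁ * P.fill.θh1
        θv2 := f.η₂ * P.fill.θv2
        gh1 := P.fill.gh1.trans f.gauge₁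
        gv2 := P.fill.gv2.trans f.gauge₂
        d1 := fun i => by simp [f.inc, P.fill.d1]
        d2 := fun i => by simp [f.mid, P.fill.d2]
        u2 := fun i => by simp [f.out, P.fill.u2] }, ?_⟩
    exact ⟨⟨⟨1, .refl _, fun p => mul_one _, fun p => mul_one _⟩, BunPair.Hom.ext
      (funext fun p => show f.η₁ p * (P.fill.θh1 p * 1 * (f.η₁ p * P.fill.θh1 p)⁻¹) = 1 by simp)
      (funext fun p => show f.η₂ p * (P.fill.θv2 p * 1 * (f.η₂ p * P.fill.θv2 p)⁻¹) = 1 by simp)⟩⟩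

/-- The pairs with given holonomies along the common circles form the homotopy fibre of the
functor that records these holonomies. -/
lemma gsum_fib_toConj [Finite Γ] [Finite a] [Finite b] [Finite d] {M : Type*} [AddCommGroup M]
    [Module ℂ M] (y : b → Γ) (F : BunPair h1 v2 x z → M)
    (hF : ∀ p q, Nonempty (p ⟶ q) → F p = F q) :
    gsum (Fib (BunPair.toConj h1 v2 x z) ⟨y⟩) (fun p => F p.pt) =
      gsum (BunCat h1 x y) fun φ => gsum (BunCat v2 y z) fun ψ => F ⟨y, φ, ψ⟩ := by
  rw [← gsum_prod (fun p : BunCat h1 x y × BunCat v2 y z => F ⟨y, p.1, p.2⟩)]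
  · refine gsum_congr (fun p : BunCat h1 x y × BunCat v2 y z =>
      (⟨⟨y, p.1, p.2⟩, 𝟙 _⟩ : Fib (BunPair.toConj h1 v2 x z) ⟨y⟩)) (fun p q => ?_) (fun w => ?_)
      _ _ fun p q ⟨f⟩ => (hF _ _ ⟨f.1⟩).symm
    · exact
        { toFun := fun f => ⟨⟨f.1.η, f.2.η, f.1.isGauge, f.2.isGauge, fun i => f.1.base _,
            fun j => (f.1.base _).trans (f.2.base _).symm, fun k => f.2.base _⟩,
            Subtype.ext (funext fun j => (one_mul _).trans (f.1.base _))⟩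
          invFun := fun f =>
            have h : ∀ j, f.1.η₁ (h1.out j 1) = 1 := fun j =>
              (one_mul _).symm.trans (congrFun (congrArg Subtype.val f.2) j)
            (⟨f.1.η₁, f.1.gauge₁, fun s => by
              cases s with
              | inl i => exact f.1.inc i
              | inr j => exact h j⟩,
             ⟨f.1.η₂, f.1.gauge₂, fun s => by
              cases s with
              | inl j => exact (f.1.mid j).symm.trans (h j)
              | inr k => exact f.1.out k⟩)
          left_inv := fun _ => rfl
          right_inv := fun _ => rfl }
    · obtain ⟨⟨y₁, φ, ψ⟩, ⟨k, hk⟩⟩ := w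
      change y = k * y₁ * k⁻¹ at hk
      have m₁ := (moves_shift 1 k (by simp : x = 1 * x * 1⁻¹) hk φ).symm
      have m₂ := (moves_shift k 1 hk (by simp : z = 1 * z * 1⁻¹) ψ).symm
      obtain ⟨η₁, g₁, e₁, e₂⟩ := m₁
      obtain ⟨η₂, g₂, e₃, e₄⟩ := m₂
      refine ⟨(φ.shift 1 k (by simp) hk, ψ.shift k 1 hk (by simp)),
        ⟨⟨⟨η₁, η₂, g₁, g₂, fun i => ?_, fun j => ?_, fun i => ?_⟩, ?_⟩⟩⟩
      · rw [e₁]; simp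
      · rw [e₂, e₃]
      · rw [e₄]; simp
      · refine Subtype.ext (funext fun j => ?_)
        change k j * η₁ (h1.out j 1) = 1
        rw [e₂]; simp
  · rintro p q ⟨f⟩
    exact hF _ _ (BunPair.hom_of_moves (k := 1) (moves_one.2 ⟨f.1⟩) (moves_one.2 ⟨f.2⟩))

/-- The value of an element of `Ẑ(v2) Ẑ(h1) U` at a pair of bundles is unchanged by morphisms which
conjugate the holonomies along the common circles by `k` and are trivial on the other circles. -/
lemma Sect.eq_of_moves [Finite Γ] [Finite a] [Finite b] {U : GrObj Γ a}
    (f : Sect v2 (ZhatObj h1 U) z) {y y₁ k : b → Γ}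
    {φ : BunCat h1 x y} {φ₁ : BunCat h1 x y₁} {ψ : BunCat v2 y z} {ψ₁ : BunCat v2 y₁ z}
    (m₁ : Moves 1 k φ φ₁) (m₂ : Moves k 1 ψ ψ₁) : (f.1 y₁ ψ₁).1 x φ₁ = (f.1 y ψ).1 x φ := by
  have hx : x = 1 * x * 1⁻¹ := by simp
  exact (congrArg (fun s : Sect h1 U y₁ => s.1 x φ₁) (f.2 k m₁.out_eq ψ ψ₁ m₂)).trans
    ((Sect.act_apply k m₁.out_eq _ hx m₁).trans (U.act_one hx _))

lemma Tot.eval_eq [Finite Γ] [Finite a] [Finite b] {U : GrObj Γ a}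
    (f : Sect v2 (ZhatObj h1 U) z) (P Q : Tot C φ' ψ') (h : Nonempty (P ⟶ Q)) :
    (f.1 P.y P.ψ).1 x P.φ = (f.1 Q.y Q.ψ).1 x Q.φ :=
  (Sect.eq_of_moves f ((Tot.toPair C φ' ψ').map h.some).moves₁
    ((Tot.toPair C φ' ψ').map h.some).moves₂).symm

variable [Finite Γ] [Finite a] [Finite b] [Finite d]

/-- The value of `Z(C)` is a single integral, over all bundles on `C` with prescribed restrictions
to `v1` and `h2`. -/
theorem dwVal_eq_gsum {U : GrObj Γ a} (f : Sect v2 (ZhatObj h1 U) z) :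
    dwVal C f φ' ψ' = gsum (Tot C φ' ψ') fun P => (f.1 P.y P.ψ).1 x P.φ := by
  let _ := Fintype.ofFinite (b → Γ)
  let _ : Fintype (ConjGpd Γ b) := Fintype.ofEquiv _ ConjGpd.equiv.symm
  have hY : ∀ p : BunPair h1 v2 x z,
      gsum (Fib (Tot.toPair C φ' ψ') p) (fun w => (f.1 w.pt.y w.pt.ψ).1 x w.pt.φ) =
        Y C p.φ p.ψ φ' ψ' • (f.1 p.y p.ψ).1 x p.φ := fun p => by
    have := finite_fib (Tot.toPair C φ' ψ') p
    rw [← Y_eq_gsum_fib]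
    refine Eq.trans ?_ (map_gsum (LinearMap.toSpanSingleton ℂ _ ((f.1 p.y p.ψ).1 x p.φ))
      fun _ => (1 : ℂ)).symm
    congr 1
    funext w
    rw [LinearMap.toSpanSingleton_apply, one_smul]
    exact (Sect.eq_of_moves f w.arr.moves₁ w.arr.moves₂).symm
  have hinv : ∀ p q : BunPair h1 v2 x z, Nonempty (p ⟶ q) →
      Y C p.φ p.ψ φ' ψ' • (f.1 p.y p.ψ).1 x p.φ = Y C q.φ q.ψ φ' ψ' • (f.1 q.y q.ψ).1 x q.φ := by
    rintro p q ⟨u⟩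
    rw [Sect.eq_of_moves f u.moves₁ u.moves₂,
      Y_congr u.moves₁ u.moves₂ (moves_one.2 ⟨𝟙 φ'⟩) (moves_one.2 ⟨𝟙 ψ'⟩)]
  -- The integral over `Tot` is computed along the restriction to `BunPair` and then along the
  -- holonomy functor to `ConjGpd`, whose objects have equally many outgoing morphisms.
  rw [gsum_fubini (Tot.toPair C φ' ψ') _ (Tot.eval_eq f)]
  simp only [hY]
  rw [gsum_fubini (BunPair.toConj h1 v2 x z) _ hinv,
    gsum_eq_sum_objects ConjGpd.card_hom _ fun p q ⟨u⟩ => (gsum_fib_congr _ u _ hinv).symm, dwVal,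
    finsum_eq_sum_of_fintype]
  congr 1
  refine Fintype.sum_equiv ConjGpd.equiv.symm _ _ fun y => ?_
  exact (gsum_fib_toConj y _ hinv).symm

end Total

/-! ### Functoriality with respect to diffeomorphisms -/

section Functoriality

variable {Γ : Type} [Group Γ]

lemma pull_comp_eq {X Y Z : Type} [TopologicalSpace X] [TopologicalSpace Y] [TopologicalSpace Z]
    {Y' : Type} [TopologicalSpace Y'] {f : C(X, Y)} {g : C(Y, Z)} {f' : C(X, Y')} {g' : C(Y', Z)}
    (h : ∀ p, g (f p) = g' (f' p)) (ρ : Bundle Γ Z) :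
    pull f (pull g ρ) = pull f' (pull g' ρ) := by
  rw [pull_pull, pull_pull, show g.comp f = g'.comp f' from ContinuousMap.ext h]

lemma pull_pull_cancel {X Y : Type} [TopologicalSpace X] [TopologicalSpace Y] {f : C(X, Y)}
    {g : C(Y, X)} (h : ∀ p, g (f p) = p) (ρ : Bundle Γ X) : pull f (pull g ρ) = ρ := by
  rw [pull_pull, show g.comp f = .id X from ContinuousMap.ext h, pull_id]

/-- The inverse diffeomorphism. -/
noncomputable def SurfDiffeo.symm {ι κ : Type} {B B' : Surface ι κ} (f : SurfDiffeo B B') :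
    SurfDiffeo B' B where
  toDiffeo := f.toDiffeo.symm
  lab s z := by rw [← f.lab, Diffeomorph.symm_apply_apply]

lemma SurfDiffeo.symm_apply {ι κ : Type} {B B' : Surface ι κ} (f : SurfDiffeo B B')
    (p : B.carrier) : f.symm.toMap (f.toMap p) = p := f.toDiffeo.symm_apply_apply p

lemma SurfDiffeo.apply_symm {ι κ : Type} {B B' : Surface ι κ} (f : SurfDiffeo B B')
    (p : B'.carrier) : f.toMap (f.symm.toMap p) = p := f.toDiffeo.apply_symm_apply p

variable {a b c d : Type} {h1 h1' : Surface a b} {h2 h2' : Surface c d} {v1 v1' : Surface a c}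
  {v2 v2' : Surface b d} {C : CornerMfd h1 h2 v1 v2} {C' : CornerMfd h1' h2' v1' v2'}

namespace CornerDiffeo

/-- The inverse diffeomorphism. -/
noncomputable def symm (F : CornerDiffeo C C') : CornerDiffeo C' C where
  toDiffeo := F.toDiffeo.symm
  fh1 := F.fh1.symm
  fh2 := F.fh2.symm
  fv1 := F.fv1.symm
  fv2 := F.fv2.symm
  ch1 p := (congrArg F.toDiffeo.symm
    ((F.ch1 _).trans (congrArg C'.ih1 (F.fh1.apply_symm p)))).symm.trans
      (F.toDiffeo.symm_apply_apply _)
  ch2 p := (congrArg F.toDiffeo.symm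
    ((F.ch2 _).trans (congrArg C'.ih2 (F.fh2.apply_symm p)))).symm.trans
      (F.toDiffeo.symm_apply_apply _)
  cv1 p := (congrArg F.toDiffeo.symm
    ((F.cv1 _).trans (congrArg C'.iv1 (F.fv1.apply_symm p)))).symm.trans
      (F.toDiffeo.symm_apply_apply _)
  cv2 p := (congrArg F.toDiffeo.symm
    ((F.cv2 _).trans (congrArg C'.iv2 (F.fv2.apply_symm p)))).symm.trans
      (F.toDiffeo.symm_apply_apply _)

variable (F : CornerDiffeo C C')

/-- The diffeomorphism as a continuous map. -/
noncomputable def toMap : C(C.carrier, C'.carrier) := ⟨F.toDiffeo, F.toDiffeo.continuous⟩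

lemma symm_apply (p : C.carrier) : F.symm.toMap (F.toMap p) = p := F.toDiffeo.symm_apply_apply p

lemma apply_symm (p : C'.carrier) : F.toMap (F.symm.toMap p) = p := F.toDiffeo.apply_symm_apply p

variable {x : a → Γ} {y : b → Γ} {y' : c → Γ} {z : d → Γ}

/-- The pullback of fillings along a diffeomorphism. -/
noncomputable def pullFill {φ : BunCat h1' x y} {ψ : BunCat v2' y z} {φ' : BunCat v1' x y'}
    {ψ' : BunCat h2' y' z} {φ₁ : BunCat h1 x y} {ψ₁ : BunCat v2 y z} {φ₁' : BunCat v1 x y'}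
    {ψ₁' : BunCat h2 y' z} (P : Filling C' φ ψ φ' ψ') (hφ : pull F.fh1.toMap φ.ρ = φ₁.ρ)
    (hψ : pull F.fv2.toMap ψ.ρ = ψ₁.ρ) (hφ' : pull F.fv1.toMap φ'.ρ = φ₁'.ρ)
    (hψ' : pull F.fh2.toMap ψ'.ρ = ψ₁'.ρ) : Filling C φ₁ ψ₁ φ₁' ψ₁' where
  ρ := pull F.toMap P.ρ
  θh1 := fun p => P.θh1 (F.fh1.toMap p)
  θv2 := fun p => P.θv2 (F.fv2.toMap p)
  θv1 := fun p => P.θv1 (F.fv1.toMap p)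
  θh2 := fun p => P.θh2 (F.fh2.toMap p)
  gh1 := by
    rw [pull_comp_eq (f' := F.fh1.toMap) (g' := C'.ih1) F.ch1, ← hφ]; exact P.gh1.pull _
  gv2 := by
    rw [pull_comp_eq (f' := F.fv2.toMap) (g' := C'.iv2) F.cv2, ← hψ]; exact P.gv2.pull _
  gv1 := by
    rw [pull_comp_eq (f' := F.fv1.toMap) (g' := C'.iv1) F.cv1, ← hφ']; exact P.gv1.pull _
  gh2 := by
    rw [pull_comp_eq (f' := F.fh2.toMap) (g' := C'.ih2) F.ch2, ← hψ']; exact P.gh2.pull _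
  d1 i := (congrArg P.θh1 (F.fh1.lab _ _)).trans
    ((P.d1 i).trans (congrArg P.θv1 (F.fv1.lab _ _)).symm)
  d2 i := (congrArg P.θh1 (F.fh1.lab _ _)).trans
    ((P.d2 i).trans (congrArg P.θv2 (F.fv2.lab _ _)).symm)
  u1 i := (congrArg P.θh2 (F.fh2.lab _ _)).trans
    ((P.u1 i).trans (congrArg P.θv1 (F.fv1.lab _ _)).symm)
  u2 i := (congrArg P.θh2 (F.fh2.lab _ _)).trans
    ((P.u2 i).trans (congrArg P.θv2 (F.fv2.lab _ _)).symm)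

/-- Pullback along a diffeomorphism is an equivalence between the groupoids of bundles. -/
lemma gsum_tot {M : Type*} [AddCommGroup M] [Module ℂ M] (φ' : BunCat v1' x y')
    (ψ' : BunCat h2' y' z) (G : Tot C (F.fv1.pullback φ') (F.fh2.pullback ψ') → M)
    (hG : ∀ P Q, Nonempty (P ⟶ Q) → G P = G Q) :
    gsum _ G = gsum (Tot C' φ' ψ') fun P => G ⟨P.y, F.fh1.pullback P.φ, F.fv2.pullback P.ψ,
      F.pullFill P.fill rfl rfl rfl rfl⟩ := by
  refine gsum_congr (fun P : Tot C' φ' ψ' => (⟨P.y, F.fh1.pullback P.φ, F.fv2.pullback P.ψ,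
    F.pullFill P.fill rfl rfl rfl rfl⟩ : Tot C _ _)) (fun P Q => ?_) (fun Q => ?_) _ _
    fun P Q h => (hG _ _ h).symm
  · exact
      { toFun := fun f => ⟨fun p => f.η (F.toMap p), f.isGauge.pull F.toMap,
          fun p => (congrArg (fun q => Q.fill.θv1 (F.fv1.toMap p) * f.η q) (F.cv1 p)).trans
            (f.cv1 _),
          fun p => (congrArg (fun q => Q.fill.θh2 (F.fh2.toMap p) * f.η q) (F.ch2 p)).trans
            (f.ch2 _)⟩
        invFun := fun f => ⟨fun p => f.η (F.symm.toMap p), by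
            have h := f.isGauge.pull F.symm.toMap
            change IsGauge _ (pull _ (pull F.toMap P.fill.ρ)) (pull _ (pull F.toMap Q.fill.ρ)) at h
            rwa [pull_pull_cancel F.apply_symm, pull_pull_cancel F.apply_symm] at h,
          fun p => by
            have h : Q.fill.θv1 (F.fv1.toMap (F.fv1.symm.toMap p)) *
                f.η (C.iv1 (F.fv1.symm.toMap p)) =
              P.fill.θv1 (F.fv1.toMap (F.fv1.symm.toMap p)) := f.cv1 (F.fv1.symm.toMap p)
            rw [F.fv1.apply_symm] at h
            exact (congrArg (fun q => Q.fill.θv1 p * f.η q) (F.symm.cv1 p)).trans h,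
          fun p => by
            have h : Q.fill.θh2 (F.fh2.toMap (F.fh2.symm.toMap p)) *
                f.η (C.ih2 (F.fh2.symm.toMap p)) =
              P.fill.θh2 (F.fh2.toMap (F.fh2.symm.toMap p)) := f.ch2 (F.fh2.symm.toMap p)
            rw [F.fh2.apply_symm] at h
            exact (congrArg (fun q => Q.fill.θh2 p * f.η q) (F.symm.ch2 p)).trans h⟩
        left_inv := fun f => Tot.Hom.ext (funext fun p => congrArg f.η (F.apply_symm p))
        right_inv := fun f => Tot.Hom.ext (funext fun p => congrArg f.η (F.symm_apply p)) }
  · refine ⟨⟨Q.y, F.fh1.symm.pullback Q.φ, F.fv2.symm.pullback Q.ψ, F.symm.pullFill Q.fill rfl rfl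
      (pull_pull_cancel F.fv1.apply_symm _) (pull_pull_cancel F.fh2.apply_symm _)⟩, ⟨⟨1, ?_,
      fun p => ?_, fun p => ?_⟩⟩⟩
    · have e : pull F.toMap (pull F.symm.toMap Q.fill.ρ) = Q.fill.ρ :=
        pull_pull_cancel F.symm_apply _
      change IsGauge 1 (pull F.toMap (pull F.symm.toMap Q.fill.ρ)) Q.fill.ρ
      rw [e]
      exact .refl _
    · exact (mul_one _).trans (congrArg Q.fill.θv1 (F.fv1.symm_apply p)).symm
    · exact (mul_one _).trans (congrArg Q.fill.θh2 (F.fh2.symm_apply p)).symm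

end CornerDiffeo

/-- `Z` is functorial with respect to diffeomorphisms. -/
theorem dw_naturality [Finite Γ] [Finite a] [Finite b] [Finite c] [Finite d]
    (F : CornerDiffeo C C') : dw Γ C ≫ (F.fv1.push Γ ◫ F.fh2.push Γ) =
      (F.fh1.push Γ ◫ F.fv2.push Γ) ≫ dw Γ C' := by
  ext U
  apply GrObj.Hom.ext
  funext z
  refine LinearMap.ext fun (f : Sect v2 (ZhatObj h1 U) z) => Subtype.ext ?_
  funext y' ψ'
  refine Subtype.ext ?_
  funext x φ'
  change dwVal C f (F.fv1.pullback φ') (F.fh2.pullback ψ') =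
    dwVal C' (((F.fh1.push Γ ◫ F.fv2.push Γ).app U).app z f : Sect v2' (ZhatObj h1' U) z) φ' ψ'
  let f' : Sect v2' (ZhatObj h1' U) z := ((F.fh1.push Γ ◫ F.fv2.push Γ).app U).app z f
  have h := dwVal_eq_gsum (C := C') (φ' := φ') (ψ' := ψ') f'
  exact (dwVal_eq_gsum f).trans ((F.gsum_tot _ _ _ (Tot.eval_eq f)).trans h.symm)

end Functoriality

/-! ### Gluing of surfaces -/

section GluedGauge

variable {Γ : Type} [Group Γ] {A B X : Type} [TopologicalSpace A] [TopologicalSpace B]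
  [TopologicalSpace X] {i : C(A, X)} {i' : C(B, X)}

/-- Morphisms of bundles can be glued along a cover by two closed subspaces. -/
lemma exists_glued_gauge [StronglyLocallyContractibleSpace X] [LocallyPathConnectedSpace A]
    [LocallyPathConnectedSpace B] (hi : IsClosedEmbedding i) (hi' : IsClosedEmbedding i')
    (cover : range i ∪ range i' = univ) {ρ ρ' : Bundle Γ X} {ν : A → Γ} {ν' : B → Γ}
    (h : IsGauge ν (pull i ρ) (pull i ρ')) (h' : IsGauge ν' (pull i' ρ) (pull i' ρ'))
    (agree : ∀ p q, i p = i' q → ν p = ν' q) :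
    ∃ η : X → Γ, IsGauge η ρ ρ' ∧ (∀ p, η (i p) = ν p) ∧ ∀ q, η (i' q) = ν' q := by
  classical
  have hη : ∀ w : X, ∃ t : Γ, (∀ p, i p = w → t = ν p) ∧ ∀ q, i' q = w → t = ν' q := fun w => by
    rcases cover ▸ mem_univ w with ⟨p, rfl⟩ | ⟨q, rfl⟩
    · exact ⟨ν p, fun p' hp' => by rw [hi.injective hp'], fun q hq => agree p q hq.symm⟩
    · exact ⟨ν' q, fun p hp => (agree p q hp).symm, fun q' hq' => by rw [hi'.injective hq']⟩
  choose η h1 h2 using hη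
  refine ⟨η, isGauge_of_cover hi hi' cover ?_ ?_, fun p => h1 _ p rfl, fun q => h2 _ q rfl⟩
  · rwa [show (fun p => η (i p)) = ν from funext fun p => h1 _ p rfl]
  · rwa [show (fun q => η (i' q)) = ν' from funext fun q => h2 _ q rfl]

/-- The inclusion of a summand of a disjoint union of copies of `X`. -/
def sigmaIncl {b : Type} (j : b) : C(X, Σ _ : b, X) :=
  ⟨fun p => ⟨j, p⟩, continuous_sigmaMk (σ := fun _ : b => X)⟩

/-- Morphisms of bundles on a disjoint union of copies of `X` are families of morphisms on `X`: the
summands are open, so short paths stay in one of them. -/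
lemma isGauge_sigma {b : Type} {ρ ρ' : Bundle Γ (Σ _ : b, X)} {θ : (Σ _ : b, X) → Γ}
    (h : ∀ j, IsGauge (fun p => θ ⟨j, p⟩) (pull (sigmaIncl j) ρ) (pull (sigmaIncl j) ρ')) :
    IsGauge θ ρ ρ' := by
  refine isGauge_of_local fun s => ⟨range (Sigma.mk s.1),
    (IsOpenEmbedding.sigmaMk (σ := fun _ : b => X) (i := s.1)).isOpen_range.mem_nhds ⟨s.2, rfl⟩,
    fun p q γ hγ => ?_⟩
  choose γ₀ hγ₀ using hγ
  have hc : Continuous γ₀ := by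
    rw [(IsOpenEmbedding.sigmaMk (σ := fun _ : b => X) (i := s.1)).isEmbedding.continuous_iff]
    exact γ.continuous.congr fun t => (hγ₀ t).symm
  let δ : Path (γ₀ 0) (γ₀ 1) := ⟨⟨γ₀, hc⟩, rfl, rfl⟩
  have e : ∀ σ : Bundle Γ (Σ _ : b, X), hol σ (cls γ) =
      hol (pull (sigmaIncl s.1) σ) (cls δ) := fun σ =>
    hol_congr σ γ (δ.map (sigmaIncl s.1).continuous) fun t => (hγ₀ t).symm
  rw [e, e, h s.1 (cls δ)]
  simp only [hγ₀, γ.source, γ.target]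

end GluedGauge

section Surfaces

variable {Γ : Type} [Group Γ]

lemma IsSmoothEmb.isClosedEmbedding {E H M E' H' M' : Type} [NormedAddCommGroup E]
    [NormedSpace ℝ E] [TopologicalSpace H] [TopologicalSpace M] [ChartedSpace H M]
    [NormedAddCommGroup E'] [NormedSpace ℝ E'] [TopologicalSpace H'] [TopologicalSpace M']
    [ChartedSpace H' M'] {I : ModelWithCorners ℝ E H} {I' : ModelWithCorners ℝ E' H'}
    [CompactSpace M] [T2Space M'] {f : M → M'} (h : IsSmoothEmb I I' f) : IsClosedEmbedding f :=
  h.1.continuous.isClosedEmbedding h.2.1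

/-- A family of labelled circles in a space, as one map from a disjoint union of circles. -/
noncomputable def circles {X b : Type} [TopologicalSpace X] (l : b → C(Circle, X)) :
    C(Σ _ : b, Circle, X) :=
  ⟨fun s => l s.1 s.2, continuous_sigma fun j => (l j).continuous⟩

lemma Surface.isClosedEmbedding_circles {ι κ b : Type} [Finite b] (B : Surface ι κ)
    {s : b → ι ⊕ κ} (hs : Function.Injective s) :
    IsClosedEmbedding (circles fun j => B.lab (s j)) := by
  refine (circles fun j => B.lab (s j)).continuous.isClosedEmbedding ?_
  rintro ⟨j, z⟩ ⟨j', z'⟩ h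
  change B.lab (s j) z = B.lab (s j') z' at h
  obtain rfl := hs (B.lab_inj _ _ _ _ h)
  rw [(B.lab_emb _).2.1 h]

namespace SurfGluing

variable {a b c : Type} {B₁ : Surface a b} {B₂ : Surface b c} {W : Surface a c}
  (g : SurfGluing B₁ B₂ W) {x : a → Γ} {y : b → Γ} {z : c → Γ}

/-- Bundles on `B₁` and `B₂` with equal holonomies along the common circles can be glued. The tuple
`k` records that the glued bundle restricts to the given ones only up to morphisms which need not be
trivial at the base points of the common circles. -/
lemma exists_glue [Finite b] (φ : BunCat B₁ x y) (ψ : BunCat B₂ y z) :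
    ∃ (τ : BunCat W x z) (k : b → Γ), Moves 1 k (g.res₁ τ) φ ∧ Moves k 1 (g.res₂ τ) ψ := by
  have h : ∀ j, ∃ θ : Circle → Γ, IsGauge θ (pull (B₁.out j) φ.ρ) (pull (B₂.inc j) ψ.ρ) ∧
      θ 1 = 1 := fun j => exists_isGauge_circle ((φ.hol_out j).trans (ψ.hol_inc j).symm)
  choose θ hθ hθ1 using h
  have hθ' : IsGauge (fun s : Σ _ : b, Circle => θ s.1 s.2) (pull (circles B₁.out) φ.ρ)
      (pull (circles B₂.inc) ψ.ρ) := isGauge_sigma fun j => by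
    rw [pull_pull, pull_pull]
    exact hθ j
  obtain ⟨ρ, μ, μ', hμ, hμ', e⟩ := exists_glued_bundle g.emb₁.isClosedEmbedding
    g.emb₂.isClosedEmbedding (j' := circles B₂.inc)
    (B₁.isClosedEmbedding_circles Sum.inr_injective) g.cover
    (fun s => g.glue s.1 s.2) (fun p q h => by
      obtain ⟨j, w, h1, h2⟩ := g.glue_only p q h
      exact ⟨⟨j, w⟩, h1, h2⟩) hθ'
  -- The holonomies of the glued bundle are right only up to conjugation; `β` corrects this.
  let β := bdryGauge W (fun i => μ (B₁.inc i 1)) (fun k => μ' (B₂.out k 1))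
  have hβ' := bdryGauge_apply (B := W) (fun i => μ (B₁.inc i 1)) (fun k => μ' (B₂.out k 1))
  have hβ : IsGauge β ρ (gauge β ρ) := isGauge_gauge β ρ
  have h1 := (hβ.pull g.i₁).symm.trans hμ
  have h2 := (hβ.pull g.i₂).symm.trans hμ'
  have hinc : ∀ i, μ (B₁.inc i 1) * (β (g.i₁ (B₁.inc i 1)))⁻¹ = 1 := fun i => by
    rw [g.inc, mul_inv_eq_one]; exact (hβ' (.inl i)).symm
  have hout : ∀ i, μ' (B₂.out i 1) * (β (g.i₂ (B₂.out i 1)))⁻¹ = 1 := fun i => by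
    rw [g.out, mul_inv_eq_one]; exact (hβ' (.inr i)).symm
  refine ⟨⟨gauge β ρ, fun i => ?_, fun k => ?_⟩,
    fun j => μ (B₁.out j 1) * (β (g.i₁ (B₁.out j 1)))⁻¹, ⟨_, h1, hinc, fun _ => rfl⟩,
    ⟨_, h2, fun j => ?_, hout⟩⟩
  · have h3 := h1.loopHol (B₁.inc i)
    rw [φ.hol_inc, loopHol_pull, show g.i₁.comp (B₁.inc i) = W.inc i from
      ContinuousMap.ext (g.inc i)] at h3
    have h4 := hinc i
    simp only [Pi.mul_apply, Pi.inv_apply] at h3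
    rw [h4] at h3
    simpa using h3.symm
  · have h3 := h2.loopHol (B₂.out k)
    rw [ψ.hol_out, loopHol_pull, show g.i₂.comp (B₂.out k) = W.out k from
      ContinuousMap.ext (g.out k)] at h3
    have h4 := hout k
    simp only [Pi.mul_apply, Pi.inv_apply] at h3
    rw [h4] at h3
    simpa using h3.symm
  · have h3 := e ⟨j, 1⟩
    change θ j 1 * μ (B₁.out j 1) = μ' (B₂.inc j 1) at h3
    rw [hθ1, one_mul] at h3
    change μ' (B₂.inc j 1) * (β (g.i₂ (B₂.inc j 1)))⁻¹ =
      μ (B₁.out j 1) * (β (g.i₁ (B₁.out j 1)))⁻¹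
    rw [h3, g.glue]

/-- Morphisms over `B₁` and over `B₂` agree on the common circles as soon as they agree at the base
points. -/
lemma agree_of_base {ρ ρ' : Bundle Γ W.carrier} {ν : B₁.carrier → Γ} {ν' : B₂.carrier → Γ}
    (h : IsGauge ν (pull g.i₁ ρ) (pull g.i₁ ρ')) (h' : IsGauge ν' (pull g.i₂ ρ) (pull g.i₂ ρ'))
    (base : ∀ j, ν (B₁.out j 1) = ν' (B₂.inc j 1)) (p q) (hpq : g.i₁ p = g.i₂ q) :
    ν p = ν' q := by
  obtain ⟨j, w, rfl, rfl⟩ := g.glue_only p q hpq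
  have h1 := h.pull (B₁.out j)
  have h2 := h'.pull (B₂.inc j)
  rw [pull_comp_eq (f' := B₂.inc j) (g' := g.i₂) (g.glue j),
    pull_comp_eq (f' := B₂.inc j) (g' := g.i₂) (g.glue j)] at h1
  exact congrFun (h1.unique h2 1 (base j)) w

lemma exists_glued_gauge {ρ ρ' : Bundle Γ W.carrier} {ν : B₁.carrier → Γ} {ν' : B₂.carrier → Γ}
    (h : IsGauge ν (pull g.i₁ ρ) (pull g.i₁ ρ')) (h' : IsGauge ν' (pull g.i₂ ρ) (pull g.i₂ ρ'))
    (base : ∀ j, ν (B₁.out j 1) = ν' (B₂.inc j 1)) :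
    ∃ η : W.carrier → Γ, IsGauge η ρ ρ' ∧ (∀ p, η (g.i₁ p) = ν p) ∧ ∀ q, η (g.i₂ q) = ν' q :=
  DW.exists_glued_gauge g.emb₁.isClosedEmbedding g.emb₂.isClosedEmbedding g.cover h h'
    (g.agree_of_base h h' base)

/-- A morphism between bundles on the glued surface is given by morphisms between their restrictions
that have the same values `k` at the base points of the common circles. -/
lemma moves_of_res {x' : a → Γ} {z' : c → Γ} {τ : BunCat W x z} {τ' : BunCat W x' z'} {h : a → Γ}
    {k : b → Γ} {l : c → Γ} (m₁ : Moves h k (g.res₁ τ) (g.res₁ τ'))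
    (m₂ : Moves k l (g.res₂ τ) (g.res₂ τ')) : Moves h l τ τ' := by
  obtain ⟨ν, n1, n2, n3⟩ := m₁
  obtain ⟨ν', n1', n2', n3'⟩ := m₂
  obtain ⟨η, h1, h2, h3⟩ := g.exists_glued_gauge n1 n1' fun j => (n3 j).trans (n2' j).symm
  exact ⟨η, h1, fun i => by rw [← g.inc, h2, n2], fun k => by rw [← g.out, h3, n3']⟩

/-- Morphisms between bundles on the two pieces induce a morphism between the bundles glued from
them. -/
lemma moves_of_moves {x' : a → Γ} {y' : b → Γ} {z' : c → Γ} {τ : BunCat W x z}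
    {τ' : BunCat W x' z'} {φ : BunCat B₁ x y} {ψ : BunCat B₂ y z} {φ' : BunCat B₁ x' y'}
    {ψ' : BunCat B₂ y' z'} {h : a → Γ} {l : c → Γ} {k k' m : b → Γ}
    (h1 : Moves 1 k (g.res₁ τ) φ) (h2 : Moves k 1 (g.res₂ τ) ψ) (h1' : Moves 1 k' (g.res₁ τ') φ')
    (h2' : Moves k' 1 (g.res₂ τ') ψ') (n1 : Moves h m φ φ') (n2 : Moves m l ψ ψ') :
    Moves h l τ τ' := by
  have m₁ := h1.trans (n1.trans h1'.symm)
  have m₂ := h2.trans (n2.trans h2'.symm)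
  simpa using g.moves_of_res m₁ m₂

end SurfGluing

end Surfaces

section Iso

variable {Γ : Type} [Group Γ] {ι : Type}

lemma GrObj.isIso_of_bijective {U U' : GrObj Γ ι} (f : U ⟶ U')
    (h : ∀ x, Function.Bijective (f.app x)) : IsIso f := by
  let e := fun x => LinearEquiv.ofBijective (f.app x) (h x)
  refine ⟨⟨fun x => (e x).symm.toLinearMap, fun k {x y} hy v => ?_⟩, ?_, ?_⟩
  · change (e y).symm _ = U.act k hy ((e x).symm v)
    rw [LinearEquiv.symm_apply_eq]
    refine Eq.trans ?_ (f.comm k hy _).symm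
    exact congrArg _ ((e x).apply_symm_apply v).symm
  · exact GrObj.Hom.ext (funext fun x => LinearMap.ext fun v => (e x).symm_apply_apply v)
  · exact GrObj.Hom.ext (funext fun x => LinearMap.ext fun v => (e x).apply_symm_apply v)

end Iso

section Glue

variable {Γ : Type} [Group Γ] [Finite Γ] {a b c : Type} [Finite a] [Finite b] [Finite c]
  {B₁ : Surface a b} {B₂ : Surface b c} {W : Surface a c} (g : SurfGluing B₁ B₂ W)

/-- Injectivity holds since all pairs of bundles on the pieces come from bundles on the glued
surface. For surjectivity, the preimage of `u` takes at a pair of bundles the value of `u` at a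
bundle glued from this pair. -/
lemma SurfGluing.glueMap_app_bijective (U : GrObj Γ a) (z : c → Γ) :
    Function.Bijective (((glueMap Γ g).app U).app z) := by
  constructor
  · intro f f' hff
    have hff' : ∀ x (τ : BunCat W x z), (f.1 (g.mid τ) (g.res₂ τ)).1 x (g.res₁ τ) =
        (f'.1 (g.mid τ) (g.res₂ τ)).1 x (g.res₁ τ) := fun x τ =>
      congrArg (fun s : Sect W U z => s.1 x τ) hff
    refine Subtype.ext ?_
    funext y ψ
    refine Subtype.ext ?_
    funext x φ
    obtain ⟨τ, k, m₁, m₂⟩ := g.exists_glue φ ψ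
    exact (Sect.eq_of_moves f m₁ m₂).trans
      ((hff' x τ).trans (Sect.eq_of_moves f' m₁ m₂).symm)
  · intro (u : Sect W U z)
    choose τ k h1 h2 using fun (x : a → Γ) (y : b → Γ) (φ : BunCat B₁ x y) (ψ : BunCat B₂ y z) =>
      g.exists_glue φ ψ
    have key : ∀ {x x' y y'} {φ : BunCat B₁ x y} {ψ : BunCat B₂ y z} {φ' : BunCat B₁ x' y'}
        {ψ' : BunCat B₂ y' z} {h : a → Γ} {m : b → Γ} (hx : x' = h * x * h⁻¹), Moves h m φ φ' →
        Moves m 1 ψ ψ' → u.1 x' (τ x' y' φ' ψ') = U.act h hx (u.1 x (τ x y φ ψ)) :=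
      fun hx n1 n2 => u.2 _ hx _ _
        (g.moves_of_moves (h1 _ _ _ _) (h2 _ _ _ _) (h1 _ _ _ _) (h2 _ _ _ _) n1 n2)
    refine ⟨(⟨fun y ψ => (⟨fun x φ => u.1 x (τ x y φ ψ), fun h x x' hx φ φ' n =>
      key hx n (moves_one.2 ⟨𝟙 ψ⟩)⟩ : Sect B₁ U y), fun m y y' hy ψ ψ' n => Subtype.ext ?_⟩ :
        Sect B₂ (ZhatObj B₁ U) z), Subtype.ext ?_⟩
    · funext x φ'
      have e1 : y = m⁻¹ * y' * m⁻¹⁻¹ := by rw [hy]; simp [mul_assoc]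
      have e2 : x = 1 * x * 1⁻¹ := by simp
      have n' := (moves_shift 1 m⁻¹ e2 e1 φ').symm
      rw [inv_one, inv_inv] at n'
      exact (key e2 n' n).trans (U.act_one e2 _)
    · funext x t
      have e2 : x = 1 * x * 1⁻¹ := by simp
      exact ((u.2 1 e2 _ t (g.moves_of_res (h1 _ _ _ _) (h2 _ _ _ _))).trans (U.act_one e2 _)).symm

/-- `Ẑ(B₂) ∘ Ẑ(B₁)` and `Ẑ(B₂ ∪ B₁)` are isomorphic. -/
theorem SurfGluing.isIso_glueMap : IsIso (glueMap Γ g) := by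
  have : ∀ U, IsIso ((glueMap Γ g).app U) := fun U =>
    GrObj.isIso_of_bijective _ (g.glueMap_app_bijective U)
  exact NatIso.isIso_of_isIso_app _

end Glue

/-! ### Functionals on tensor products -/

section TensorSection

variable {P S V' : Type} {V : P → Type} [AddCommGroup S] [Module ℂ S] [AddCommGroup V']
  [Module ℂ V'] [∀ p, AddCommGroup (V p)] [∀ p, Module ℂ (V p)]

/-- Contraction of the second factor of a tensor product. -/
noncomputable def contract {A B : Type} [AddCommGroup A] [Module ℂ A] [AddCommGroup B] [Module ℂ B]
    (l : B →ₗ[ℂ] ℂ) : A ⊗[ℂ] B →ₗ[ℂ] A :=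
  TensorProduct.rid ℂ A ∘ₗ TensorProduct.map LinearMap.id l

lemma contract_tmul {A B : Type} [AddCommGroup A] [Module ℂ A] [AddCommGroup B] [Module ℂ B]
    (l : B →ₗ[ℂ] ℂ) (v : A) (w : B) : contract l (v ⊗ₜ w) = l w • v := by
  simp [contract]

lemma sum_contract {A B ι : Type} [AddCommGroup A] [Module ℂ A] [AddCommGroup B] [Module ℂ B]
    [Fintype ι] (e : Module.Basis ι ℂ B) (t : A ⊗[ℂ] B) :
    ∑ m, contract (e.coord m) t ⊗ₜ[ℂ] e m = t := by
  induction t with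
  | zero => simp
  | add s t hs ht =>
    simp only [map_add, TensorProduct.add_tmul, Finset.sum_add_distrib, hs, ht]
  | tmul v w =>
    simp only [contract_tmul, TensorProduct.smul_tmul]
    rw [← TensorProduct.tmul_sum]
    simp [e.sum_repr]

lemma contract_map {A B C : Type} [AddCommGroup A] [Module ℂ A] [AddCommGroup B] [Module ℂ B]
    [AddCommGroup C] [Module ℂ C] (f : A →ₗ[ℂ] C) (l : B →ₗ[ℂ] ℂ) (t : A ⊗[ℂ] B) :
    contract l (TensorProduct.map f LinearMap.id t) = f (contract l t) :=
  tensor_eq (contract l ∘ₗ TensorProduct.map f LinearMap.id) (f ∘ₗ contract l)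
    (fun v w => by simp [contract_tmul]) t

/-- A tensor product of maps is applied one factor at a time, with only the first factor acted on.
-/
lemma tensor_map_eq_comm {A A' S S' : Type} [AddCommGroup A] [Module ℂ A] [AddCommGroup A']
    [Module ℂ A'] [AddCommGroup S] [Module ℂ S] [AddCommGroup S'] [Module ℂ S'] (f : S →ₗ[ℂ] A)
    (f' : S' →ₗ[ℂ] A') (t : S ⊗[ℂ] S') : TensorProduct.map f f' t =
      TensorProduct.map f LinearMap.id (TensorProduct.comm ℂ A' S
        (TensorProduct.map f' LinearMap.id (TensorProduct.comm ℂ S S' t))) :=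
  tensor_eq (TensorProduct.map f f') (TensorProduct.map f LinearMap.id ∘ₗ
    (TensorProduct.comm ℂ A' S).toLinearMap ∘ₗ TensorProduct.map f' LinearMap.id ∘ₗ
      (TensorProduct.comm ℂ S S').toLinearMap) (fun _ _ => rfl) t

/-- A jointly injective family of linear maps on `S` remains so after tensoring with `V'`. -/
lemma tensor_jointly_injective [FiniteDimensional ℂ V'] (E : ∀ p, S →ₗ[ℂ] V p)
    (hE : ∀ s t, (∀ p, E p s = E p t) → s = t) {t t' : S ⊗[ℂ] V'}
    (h : ∀ p, TensorProduct.map (E p) LinearMap.id t = TensorProduct.map (E p) LinearMap.id t') :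
    t = t' := by
  let e := Module.finBasis ℂ V'
  rw [← sum_contract e t, ← sum_contract e t']
  refine Finset.sum_congr rfl fun m _ => ?_
  rw [hE (contract (e.coord m) t) (contract (e.coord m) t') fun p => by
    rw [← contract_map, ← contract_map, h]]

/-- A family of tensors lies in the image of `S ⊗ V'` as soon as its contractions with functionals
on `V'` lie in the image of `S`. -/
lemma exists_tensor_of_contract [FiniteDimensional ℂ V'] (E : ∀ p, S →ₗ[ℂ] V p)
    (T : ∀ p, V p ⊗[ℂ] V') (h : ∀ l : V' →ₗ[ℂ] ℂ, ∃ s, ∀ p, E p s = contract l (T p)) :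
    ∃ t : S ⊗[ℂ] V', ∀ p, TensorProduct.map (E p) LinearMap.id t = T p := by
  let e := Module.finBasis ℂ V'
  choose s hs using h
  refine ⟨∑ m, s (e.coord m) ⊗ₜ e m, fun p => ?_⟩
  rw [map_sum]
  refine Eq.trans ?_ (sum_contract e (T p))
  exact Finset.sum_congr rfl fun m _ => by rw [TensorProduct.map_tmul, hs]; rfl

end TensorSection

/-! ### Disjoint unions of surfaces -/

section SurfSum

variable {Γ : Type} [Group Γ] {a b a' b' : Type} {B : Surface a b} {B' : Surface a' b'}
  {W : Surface (a ⊕ a') (b ⊕ b')}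

/-- Bundles on the parts of a disjoint union define a bundle on the whole. -/
lemma exists_bundle_of_disjoint {A B X : Type} [TopologicalSpace A] [TopologicalSpace B]
    [TopologicalSpace X] [T2Space A] [StronglyLocallyContractibleSpace A]
    [StronglyLocallyContractibleSpace B]
    {i : C(A, X)} {i' : C(B, X)} (hi : IsClosedEmbedding i) (hi' : IsClosedEmbedding i')
    (cover : range i ∪ range i' = univ) (disj : ∀ p q, i p ≠ i' q) (α : Bundle Γ A)
    (β : Bundle Γ B) : ∃ ρ : Bundle Γ X, pull i ρ = α ∧ pull i' ρ = β := by
  have _ : LocallyPathConnectedSpace Empty := ⟨fun x => x.elim⟩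
  refine exists_glued_bundle_of_eq (S := Empty) (j := ⟨Empty.elim, continuous_of_discreteTopology⟩)
    (j' := ⟨Empty.elim, continuous_of_discreteTopology⟩) hi hi'
    (Continuous.isClosedEmbedding continuous_of_discreteTopology (fun x => x.elim)) cover
    (fun x => x.elim) (fun p q h => (disj p q h).elim) (bundle_ext fun x => x.as.elim)

/-- The value of sections at a bundle. -/
noncomputable def Sect.eval {a b : Type} (B : Surface a b) (U : GrObj Γ a) (y : b → Γ)
    (p : Σ x : a → Γ, BunCat B x y) : Sect B U y →ₗ[ℂ] U.V p.1 where
  toFun u := u.1 p.1 p.2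
  map_add' _ _ := rfl
  map_smul' _ _ := rfl

lemma Sect.eval_injective {a b : Type} {B : Surface a b} {U : GrObj Γ a} {y : b → Γ}
    (u v : Sect B U y) (h : ∀ p, Sect.eval B U y p u = Sect.eval B U y p v) : u = v :=
  Subtype.ext (funext fun x => funext fun ρ => h ⟨x, ρ⟩)

namespace SurfSum

variable (s : SurfSum B B' W) {x : a ⊕ a' → Γ} {y : b ⊕ b' → Γ}

lemma exists_res (ρ : BunCat B (x ∘ Sum.inl) (y ∘ Sum.inl))
    (ρ' : BunCat B' (x ∘ Sum.inr) (y ∘ Sum.inr)) :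
    ∃ τ : BunCat W x y, s.res τ = ρ ∧ s.res' τ = ρ' := by
  obtain ⟨σ, h, h'⟩ := exists_bundle_of_disjoint s.emb.isClosedEmbedding s.emb'.isClosedEmbedding
    s.cover s.disjoint ρ.ρ ρ'.ρ
  obtain ⟨ρ, hρ, hρ'⟩ := ρ
  obtain ⟨ρ', hr, hr'⟩ := ρ'
  subst h h'
  refine ⟨⟨σ, fun i => ?_, fun j => ?_⟩, rfl, rfl⟩
  · cases i with
    | inl i =>
      rw [show W.inc (.inl i) = s.i.comp (B.inc i) from ContinuousMap.ext fun z => (s.inc i z).symm]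
      exact hρ i
    | inr i =>
      rw [show W.inc (.inr i) = s.i'.comp (B'.inc i) from
        ContinuousMap.ext fun z => (s.inc' i z).symm]
      exact hr i
  · cases j with
    | inl i =>
      rw [show W.out (.inl i) = s.i.comp (B.out i) from ContinuousMap.ext fun z => (s.out i z).symm]
      exact hρ' i
    | inr i =>
      rw [show W.out (.inr i) = s.i'.comp (B'.out i) from
        ContinuousMap.ext fun z => (s.out' i z).symm]
      exact hr' i

lemma exists_glued_gauge {ρ ρ' : Bundle Γ W.carrier} {ν : B.carrier → Γ} {ν' : B'.carrier → Γ}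
    (h : IsGauge ν (pull s.i ρ) (pull s.i ρ')) (h' : IsGauge ν' (pull s.i' ρ) (pull s.i' ρ')) :
    ∃ η : W.carrier → Γ, IsGauge η ρ ρ' ∧ (∀ p, η (s.i p) = ν p) ∧ ∀ q, η (s.i' q) = ν' q :=
  DW.exists_glued_gauge s.emb.isClosedEmbedding s.emb'.isClosedEmbedding s.cover h h'
    fun p q hpq => (s.disjoint p q hpq).elim

lemma moves_of_res {x₁ : a ⊕ a' → Γ} {y₁ : b ⊕ b' → Γ} {τ : BunCat W x y} {τ₁ : BunCat W x₁ y₁}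
    {g : a ⊕ a' → Γ} {h : b ⊕ b' → Γ}
    (m : Moves (g ∘ Sum.inl) (h ∘ Sum.inl) (s.res τ) (s.res τ₁))
    (m' : Moves (g ∘ Sum.inr) (h ∘ Sum.inr) (s.res' τ) (s.res' τ₁)) : Moves g h τ τ₁ := by
  obtain ⟨ν, n1, n2, n3⟩ := m
  obtain ⟨ν', n1', n2', n3'⟩ := m'
  obtain ⟨η, h1, h2, h3⟩ := s.exists_glued_gauge n1 n1'
  refine ⟨η, h1, fun i => ?_, fun j => ?_⟩
  · cases i with
    | inl i => rw [← s.inc, h2, n2]; rfl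
    | inr i => rw [← s.inc', h3, n2']; rfl
  · cases j with
    | inl i => rw [← s.out, h2, n3]; rfl
    | inr i => rw [← s.out', h3, n3']; rfl

lemma extLin_apply (U : GrObj Γ a) (U' : GrObj Γ a')
    (t : Sect B U (y ∘ Sum.inl) ⊗[ℂ] Sect B' U' (y ∘ Sum.inr)) (τ : BunCat W x y) :
    (s.extLin U U' y t).1 x τ = TensorProduct.map (Sect.eval B U _ ⟨_, s.res τ⟩)
      (Sect.eval B' U' _ ⟨_, s.res' τ⟩) t :=
  tensor_eq (V := Sect B U (y ∘ Sum.inl)) (W := Sect B' U' (y ∘ Sum.inr))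
    (Sect.eval W (extProd U U') y ⟨x, τ⟩ ∘ₗ s.extLin U U' y)
    (TensorProduct.map (Sect.eval B U _ ⟨_, s.res τ⟩) (Sect.eval B' U' _ ⟨_, s.res' τ⟩))
    (fun _ _ => rfl) t

variable [Finite Γ] [Finite a] [Finite b]

/-- An element of `Ẑ(W)(U ⊠ U')` is a family of tensors indexed by pairs of bundles on `B` and `B'`,
invariant in each of the two variables. Contraction of the second tensor factor with functionals
shows that in the first variable the family comes from `Ẑ(B)(U) ⊗ U'`, and contraction of the first
factor then shows that in the second variable it comes from `Ẑ(B)(U) ⊗ Ẑ(B')(U')`. -/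
lemma extLin_bijective (U : GrObj Γ a) (U' : GrObj Γ a') (y : b ⊕ b' → Γ) :
    Function.Bijective (s.extLin U U' y) := by
  choose τ hτ hτ' using fun (p : Σ x : a → Γ, BunCat B x (y ∘ Sum.inl))
    (q : Σ x : a' → Γ, BunCat B' x (y ∘ Sum.inr)) =>
    s.exists_res (x := Sum.elim p.1 q.1) (y := y) p.2 q.2
  have eval : ∀ t p q, (s.extLin U U' y t).1 _ (τ p q) =
      TensorProduct.map (Sect.eval B U _ p) LinearMap.id (TensorProduct.comm ℂ _ _
        (TensorProduct.map (Sect.eval B' U' _ q) LinearMap.id (TensorProduct.comm ℂ _ _ t))) :=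
    fun t p q => by
      rw [← tensor_map_eq_comm]
      refine (s.extLin_apply U U' t (τ p q)).trans ?_
      rw [hτ, hτ']
      rfl
  constructor
  · intro t t' h
    refine (TensorProduct.comm ℂ _ _).injective
      (tensor_jointly_injective (Sect.eval B' U' _) Sect.eval_injective fun q => ?_)
    refine (TensorProduct.comm ℂ _ _).injective
      (tensor_jointly_injective (Sect.eval B U _) Sect.eval_injective fun p => ?_)
    rw [← eval, ← eval, h]
  · intro w
    have ex : ∀ q : Σ x : a' → Γ, BunCat B' x (y ∘ Sum.inr), ∃ t : Sect B U (y ∘ Sum.inl) ⊗[ℂ]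
        U'.V q.1, ∀ p, TensorProduct.map (Sect.eval B U _ p) LinearMap.id t = w.1 _ (τ p q) := by
      intro q
      refine exists_tensor_of_contract _ _ fun l => ?_
      refine ⟨⟨fun x ρ => contract l (w.1 _ (τ ⟨x, ρ⟩ q)), fun g x x' hx ρ ρ' m => ?_⟩,
        fun p => rfl⟩
      have hq : q.1 = 1 * q.1 * 1⁻¹ := by simp
      have hxx : (Sum.elim x' q.1 : a ⊕ a' → Γ) = Sum.elim g 1 * Sum.elim x q.1 *
          (Sum.elim g 1)⁻¹ := by
        funext k
        cases k with
        | inl k => exact congrFun hx k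
        | inr k => exact congrFun hq k
      have hm : Moves (Sum.elim g 1) 1 (τ ⟨x, ρ⟩ q) (τ ⟨x', ρ'⟩ q) := by
        refine s.moves_of_res ?_ ?_
        · rw [hτ, hτ]; exact m
        · rw [hτ', hτ']; exact moves_one.2 ⟨𝟙 q.2⟩
      have h1 := w.2 (Sum.elim g 1) hxx _ _ hm
      refine (congrArg (contract l) h1).trans ?_
      exact tensor_eq (V := U.V x) (W := U'.V q.1) (contract l ∘ₗ TensorProduct.map (U.act g hx)
        (U'.act 1 hq)) (U.act g hx ∘ₗ contract l) (fun v v' => by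
          simp [contract_tmul, U'.act_one hq]) _
    choose T hT using ex
    -- The family `T` is again invariant, because the values of sections determine them.
    obtain ⟨t, ht⟩ := exists_tensor_of_contract (Sect.eval B' U' (y ∘ Sum.inr))
      (fun q => TensorProduct.comm ℂ _ _ (T q)) fun l => by
        refine ⟨⟨fun x ρ => contract l (TensorProduct.comm ℂ _ _ (T ⟨x, ρ⟩)),
          fun g x x' hx ρ ρ' m => ?_⟩, fun p => rfl⟩
        have h1 : T ⟨x', ρ'⟩ = TensorProduct.map LinearMap.id (U'.act g hx) (T ⟨x, ρ⟩) := by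
          refine tensor_jointly_injective (Sect.eval B U _) Sect.eval_injective fun p => ?_
          rw [hT]
          have hp : p.1 = 1 * p.1 * 1⁻¹ := by simp
          have hxx : (Sum.elim p.1 x' : a ⊕ a' → Γ) = Sum.elim (1 : a → Γ) g * Sum.elim p.1 x *
              (Sum.elim (1 : a → Γ) g)⁻¹ := by
            funext k
            cases k with
            | inl k => exact congrFun hp k
            | inr k => exact congrFun hx k
          have hm : Moves (Sum.elim (1 : a → Γ) g) 1 (τ p ⟨x, ρ⟩) (τ p ⟨x', ρ'⟩) := by
            refine s.moves_of_res ?_ ?_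
            · rw [hτ, hτ]; exact moves_one.2 ⟨𝟙 p.2⟩
            · rw [hτ', hτ']; exact m
          refine (w.2 (Sum.elim (1 : a → Γ) g) hxx _ _ hm).trans ((congrArg
            ((extProd U U').act (Sum.elim (1 : a → Γ) g) hxx) (hT ⟨x, ρ⟩ p).symm).trans ?_)
          exact tensor_eq (V := Sect B U (y ∘ Sum.inl)) (W := U'.V x)
            (TensorProduct.map (U.act 1 hp) (U'.act g hx) ∘ₗ
              TensorProduct.map (Sect.eval B U _ p) LinearMap.id)
            (TensorProduct.map (Sect.eval B U _ p) LinearMap.id ∘ₗ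
              TensorProduct.map LinearMap.id (U'.act g hx))
            (fun v v' => by simp [U.act_one hp]) _
        change contract l (TensorProduct.comm ℂ _ _ (T ⟨x', ρ'⟩)) = _
        rw [h1]
        exact tensor_eq (V := Sect B U (y ∘ Sum.inl)) (W := U'.V x)
          (contract l ∘ₗ (TensorProduct.comm ℂ _ _).toLinearMap ∘ₗ
            TensorProduct.map LinearMap.id (U'.act g hx))
          (U'.act g hx ∘ₗ contract l ∘ₗ (TensorProduct.comm ℂ _ _).toLinearMap)
          (fun v v' => by simp [contract_tmul]) _
    -- A bundle on `W` and the chosen one with the same restrictions are related by a trivial move.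
    refine ⟨TensorProduct.comm ℂ _ _ t, Subtype.ext ?_⟩
    funext x τ₁
    obtain ⟨x, x', rfl⟩ : ∃ x₁ x₂, x = Sum.elim x₁ x₂ := ⟨_, _, (Sum.elim_comp_inl_inr x).symm⟩
    have h1 : Moves 1 1 (τ ⟨x, s.res τ₁⟩ ⟨x', s.res' τ₁⟩) τ₁ := by
      refine s.moves_of_res ?_ ?_
      · rw [hτ]; exact moves_one.2 ⟨𝟙 _⟩
      · rw [hτ']; exact moves_one.2 ⟨𝟙 _⟩
    rw [extLin_apply, tensor_map_eq_comm]
    have h2 : TensorProduct.comm ℂ _ _ (TensorProduct.comm ℂ _ _ t) = t :=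
      (TensorProduct.comm ℂ _ _).symm_apply_apply t
    have e2 : (Sum.elim x x' : a ⊕ a' → Γ) = 1 * Sum.elim x x' * 1⁻¹ := by simp
    have h3 := (w.2 1 e2 _ _ h1).trans ((extProd U U').act_one e2 _)
    rw [h2, ht]
    have h4 := (TensorProduct.comm ℂ (Sect B U (y ∘ Sum.inl)) (U'.V x')).symm_apply_apply
      (T ⟨x', s.res' τ₁⟩)
    exact (congrArg (TensorProduct.map (Sect.eval B U (y ∘ Sum.inl) ⟨x, s.res τ₁⟩)
      LinearMap.id) h4).trans ((hT ⟨x', s.res' τ₁⟩ ⟨x, s.res τ₁⟩).trans h3.symm)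

variable [Finite a'] [Finite b']

lemma isIso_extMap (U : GrObj Γ a) (U' : GrObj Γ a') : IsIso (s.extMap U U') :=
  GrObj.isIso_of_bijective _ fun y => s.extLin_bijective U U' y

end SurfSum

end SurfSum

/-! ### Disjoint unions of 3-manifolds -/

section CornerSum

variable {Γ : Type} [Group Γ] {a b c d a' b' c' d' : Type} {h1 : Surface a b} {h2 : Surface c d}
    {v1 : Surface a c} {v2 : Surface b d} {h1' : Surface a' b'} {h2' : Surface c' d'}
    {v1' : Surface a' c'} {v2' : Surface b' d'} {wh1 : Surface (a ⊕ a') (b ⊕ b')}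
    {wh2 : Surface (c ⊕ c') (d ⊕ d')} {wv1 : Surface (a ⊕ a') (c ⊕ c')}
    {wv2 : Surface (b ⊕ b') (d ⊕ d')} {C : CornerMfd h1 h2 v1 v2}
    {C' : CornerMfd h1' h2' v1' v2'} {E : CornerMfd wh1 wh2 wv1 wv2}

lemma SurfSum.forall_iff {a b a' b' : Type} {B : Surface a b} {B' : Surface a' b'}
    {W : Surface (a ⊕ a') (b ⊕ b')} (s : SurfSum B B' W) {p : W.carrier → Prop} :
    (∀ w, p w) ↔ (∀ q, p (s.i q)) ∧ ∀ q, p (s.i' q) := by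
  refine ⟨fun h => ⟨fun q => h _, fun q => h _⟩, fun h w => ?_⟩
  rcases s.cover ▸ mem_univ w with ⟨q, rfl⟩ | ⟨q, rfl⟩
  exacts [h.1 q, h.2 q]

namespace CornerSum

variable (s : CornerSum C C' E) {x : a ⊕ a' → Γ} {y' : c ⊕ c' → Γ} {z : d ⊕ d' → Γ}
  {φ' : BunCat wv1 x y'} {ψ' : BunCat wh2 y' z}

/-- The restriction to `C`. -/
noncomputable def res (P : Tot E φ' ψ') : Tot C (s.sv1.res φ') (s.sh2.res ψ') where
  y := P.y ∘ Sum.inl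
  φ := s.sh1.res P.φ
  ψ := s.sv2.res P.ψ
  fill :=
    { ρ := pull s.i P.fill.ρ
      θh1 := fun p => P.fill.θh1 (s.sh1.i p)
      θv2 := fun p => P.fill.θv2 (s.sv2.i p)
      θv1 := fun p => P.fill.θv1 (s.sv1.i p)
      θh2 := fun p => P.fill.θh2 (s.sh2.i p)
      gh1 := by
        rw [pull_comp_eq (f' := s.sh1.i) (g' := E.ih1) s.ch1]; exact P.fill.gh1.pull _
      gv2 := by
        rw [pull_comp_eq (f' := s.sv2.i) (g' := E.iv2) s.cv2]; exact P.fill.gv2.pull _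
      gv1 := by
        rw [pull_comp_eq (f' := s.sv1.i) (g' := E.iv1) s.cv1]; exact P.fill.gv1.pull _
      gh2 := by
        rw [pull_comp_eq (f' := s.sh2.i) (g' := E.ih2) s.ch2]; exact P.fill.gh2.pull _
      d1 := fun i => by rw [s.sh1.inc, s.sv1.inc, P.fill.d1]
      d2 := fun i => by rw [s.sh1.out, s.sv2.inc, P.fill.d2]
      u1 := fun i => by rw [s.sh2.inc, s.sv1.out, P.fill.u1]
      u2 := fun i => by rw [s.sh2.out, s.sv2.out, P.fill.u2] }

/-- The restriction to `C'`. -/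
noncomputable def res' (P : Tot E φ' ψ') : Tot C' (s.sv1.res' φ') (s.sh2.res' ψ') where
  y := P.y ∘ Sum.inr
  φ := s.sh1.res' P.φ
  ψ := s.sv2.res' P.ψ
  fill :=
    { ρ := pull s.i' P.fill.ρ
      θh1 := fun p => P.fill.θh1 (s.sh1.i' p)
      θv2 := fun p => P.fill.θv2 (s.sv2.i' p)
      θv1 := fun p => P.fill.θv1 (s.sv1.i' p)
      θh2 := fun p => P.fill.θh2 (s.sh2.i' p)
      gh1 := by
        rw [pull_comp_eq (f' := s.sh1.i') (g' := E.ih1) s.ch1']; exact P.fill.gh1.pull _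
      gv2 := by
        rw [pull_comp_eq (f' := s.sv2.i') (g' := E.iv2) s.cv2']; exact P.fill.gv2.pull _
      gv1 := by
        rw [pull_comp_eq (f' := s.sv1.i') (g' := E.iv1) s.cv1']; exact P.fill.gv1.pull _
      gh2 := by
        rw [pull_comp_eq (f' := s.sh2.i') (g' := E.ih2) s.ch2']; exact P.fill.gh2.pull _
      d1 := fun i => by rw [s.sh1.inc', s.sv1.inc', P.fill.d1]
      d2 := fun i => by rw [s.sh1.out', s.sv2.inc', P.fill.d2]
      u1 := fun i => by rw [s.sh2.inc', s.sv1.out', P.fill.u1]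
      u2 := fun i => by rw [s.sh2.out', s.sv2.out', P.fill.u2] }

/-- Restriction to the two summands is fully faithful. -/
lemma hom_bijective (P Q : Tot E φ' ψ') : Function.Bijective
    (fun f : P ⟶ Q => ((⟨⟨fun p => f.η (s.i p), f.isGauge.pull s.i,
      fun p => (congrArg (fun q => Q.fill.θv1 (s.sv1.i p) * f.η q) (s.cv1 p)).trans (f.cv1 _),
      fun p => (congrArg (fun q => Q.fill.θh2 (s.sh2.i p) * f.η q) (s.ch2 p)).trans (f.ch2 _)⟩,
      ⟨fun p => f.η (s.i' p), f.isGauge.pull s.i',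
      fun p => (congrArg (fun q => Q.fill.θv1 (s.sv1.i' p) * f.η q) (s.cv1' p)).trans (f.cv1 _),
      fun p => (congrArg (fun q => Q.fill.θh2 (s.sh2.i' p) * f.η q) (s.ch2' p)).trans
        (f.ch2 _)⟩⟩ : ((s.res P, s.res' P) : Tot C _ _ × Tot C' _ _) ⟶ (s.res Q, s.res' Q)))) := by
  constructor
  · intro f f' h
    refine Tot.Hom.ext (funext fun w => ?_)
    rcases s.cover ▸ mem_univ w with ⟨q, rfl⟩ | ⟨q, rfl⟩
    · exact congrFun (congrArg (fun t => Tot.Hom.η t.1) h) q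
    · exact congrFun (congrArg (fun t => Tot.Hom.η t.2) h) q
  · rintro ⟨f, f'⟩
    obtain ⟨η, hη, e, e'⟩ := exists_glued_gauge s.emb.isClosedEmbedding s.emb'.isClosedEmbedding
      s.cover f.isGauge f'.isGauge fun p q h => (s.disjoint p q h).elim
    refine ⟨⟨η, hη, s.sv1.forall_iff.2 ⟨fun p => ?_, fun p => ?_⟩,
      s.sh2.forall_iff.2 ⟨fun p => ?_, fun p => ?_⟩⟩, ?_⟩
    · rw [← s.cv1, e]; exact f.cv1 p
    · rw [← s.cv1', e']; exact f'.cv1 p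
    · rw [← s.ch2, e]; exact f.ch2 p
    · rw [← s.ch2', e']; exact f'.ch2 p
    · exact Prod.ext (Tot.Hom.ext (funext e)) (Tot.Hom.ext (funext e'))

/-- Restriction to the two summands is essentially surjective. -/
lemma exists_res (P : Tot C (s.sv1.res φ') (s.sh2.res ψ'))
    (P' : Tot C' (s.sv1.res' φ') (s.sh2.res' ψ')) : ∃ Q : Tot E φ' ψ',
    Nonempty (((s.res Q, s.res' Q) : Tot C _ _ × Tot C' _ _) ⟶ (P, P')) := by
  obtain ⟨ρ, hρ, hρ'⟩ := exists_bundle_of_disjoint s.emb.isClosedEmbedding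
    s.emb'.isClosedEmbedding s.cover s.disjoint P.fill.ρ P'.fill.ρ
  obtain ⟨φ, hφ, hφ'⟩ := s.sh1.exists_res (x := x) (y := Sum.elim P.y P'.y) P.φ P'.φ
  obtain ⟨ψ, hψ, hψ'⟩ := s.sv2.exists_res (x := Sum.elim P.y P'.y) (y := z) P.ψ P'.ψ
  have g1 := P.fill.gh1
  have g2 := P.fill.gv2
  have g3 := P.fill.gv1
  have g4 := P.fill.gh2
  have g1' := P'.fill.gh1
  have g2' := P'.fill.gv2
  have g3' := P'.fill.gv1
  have g4' := P'.fill.gh2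
  rw [← hρ, pull_comp_eq (f' := s.sh1.i) (g' := E.ih1) s.ch1, ← congrArg BunCat.ρ hφ] at g1
  rw [← hρ, pull_comp_eq (f' := s.sv2.i) (g' := E.iv2) s.cv2, ← congrArg BunCat.ρ hψ] at g2
  rw [← hρ, pull_comp_eq (f' := s.sv1.i) (g' := E.iv1) s.cv1] at g3
  rw [← hρ, pull_comp_eq (f' := s.sh2.i) (g' := E.ih2) s.ch2] at g4
  rw [← hρ', pull_comp_eq (f' := s.sh1.i') (g' := E.ih1) s.ch1', ← congrArg BunCat.ρ hφ'] at g1'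
  rw [← hρ', pull_comp_eq (f' := s.sv2.i') (g' := E.iv2) s.cv2', ← congrArg BunCat.ρ hψ'] at g2'
  rw [← hρ', pull_comp_eq (f' := s.sv1.i') (g' := E.iv1) s.cv1'] at g3'
  rw [← hρ', pull_comp_eq (f' := s.sh2.i') (g' := E.ih2) s.ch2'] at g4'
  obtain ⟨θh1, k1, e1, e1'⟩ := s.sh1.exists_glued_gauge g1 g1'
  obtain ⟨θv2, k2, e2, e2'⟩ := s.sv2.exists_glued_gauge g2 g2'
  obtain ⟨θv1, k3, e3, e3'⟩ := s.sv1.exists_glued_gauge (ρ' := φ'.ρ) g3 g3'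
  obtain ⟨θh2, k4, e4, e4'⟩ := s.sh2.exists_glued_gauge (ρ' := ψ'.ρ) g4 g4'
  refine ⟨⟨Sum.elim P.y P'.y, φ, ψ,
    { ρ := ρ
      θh1 := θh1
      θv2 := θv2
      θv1 := θv1
      θh2 := θh2
      gh1 := k1
      gv2 := k2
      gv1 := k3
      gh2 := k4
      d1 := ?_
      d2 := ?_
      u1 := ?_
      u2 := ?_ }⟩, ⟨?_, ?_⟩⟩
  · rintro (i | i)
    · rw [← s.sh1.inc, ← s.sv1.inc, e1, e3, P.fill.d1]
    · rw [← s.sh1.inc', ← s.sv1.inc', e1', e3', P'.fill.d1]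
  · rintro (i | i)
    · rw [← s.sh1.out, ← s.sv2.inc, e1, e2, P.fill.d2]
    · rw [← s.sh1.out', ← s.sv2.inc', e1', e2', P'.fill.d2]
  · rintro (i | i)
    · rw [← s.sh2.inc, ← s.sv1.out, e4, e3, P.fill.u1]
    · rw [← s.sh2.inc', ← s.sv1.out', e4', e3', P'.fill.u1]
  · rintro (i | i)
    · rw [← s.sh2.out, ← s.sv2.out, e4, e2, P.fill.u2]
    · rw [← s.sh2.out', ← s.sv2.out', e4', e2', P'.fill.u2]
  · refine ⟨1, ?_, fun p => (mul_one _).trans (e3 p).symm, fun p => (mul_one _).trans (e4 p).symm⟩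
    change IsGauge 1 (pull s.i ρ) P.fill.ρ
    rw [hρ]
    exact .refl _
  · refine ⟨1, ?_, fun p => (mul_one _).trans (e3' p).symm, fun p => (mul_one _).trans (e4' p).symm⟩
    change IsGauge 1 (pull s.i' ρ) P'.fill.ρ
    rw [hρ']
    exact .refl _

/-- The groupoid of bundles on a disjoint union is equivalent to a product. -/
lemma gsum_tot [Finite Γ] [Finite a] [Finite b] [Finite c] [Finite d] [Finite a'] [Finite b']
    [Finite c'] [Finite d'] {M : Type*} [AddCommGroup M] [Module ℂ M]
    (G : Tot C (s.sv1.res φ') (s.sh2.res ψ') → Tot C' (s.sv1.res' φ') (s.sh2.res' ψ') → M)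
    (hG : ∀ P Q P' Q', Nonempty (P ⟶ Q) → Nonempty (P' ⟶ Q') → G P P' = G Q Q') :
    gsum (Tot E φ' ψ') (fun P => G (s.res P) (s.res' P)) =
      gsum _ fun P => gsum _ fun P' => G P P' := by
  have hG' : ∀ p q : Tot C (s.sv1.res φ') (s.sh2.res ψ') × Tot C' (s.sv1.res' φ') (s.sh2.res' ψ'),
      Nonempty (p ⟶ q) → G p.1 p.2 = G q.1 q.2 := fun p q ⟨f⟩ => hG _ _ _ _ ⟨f.1⟩ ⟨f.2⟩
  rw [← gsum_prod (fun p => G p.1 p.2) hG']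
  exact (gsum_congr (fun P : Tot E φ' ψ' => (s.res P, s.res' P))
    (fun P Q => Equiv.ofBijective _ (s.hom_bijective P Q)) (fun p => s.exists_res p.1 p.2) _ _
    fun P p h => (hG' _ _ h).symm).symm

end CornerSum

variable [Finite Γ] [Finite a] [Finite b] [Finite c] [Finite d] [Finite a'] [Finite b']
    [Finite c'] [Finite d']

lemma isIso_extMap₂ {e e' : Type} [Finite e] [Finite e'] {B : Surface a b} {B' : Surface a' b'}
    {W : Surface (a ⊕ a') (b ⊕ b')} {D : Surface b e} {D' : Surface b' e'}
    {X : Surface (b ⊕ b') (e ⊕ e')} (s : SurfSum B B' W) (t : SurfSum D D' X) (U : GrObj Γ a)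
    (U' : GrObj Γ a') : IsIso (extMap₂ s t U U') := by
  have := t.isIso_extMap ((Zhat Γ B).obj U) ((Zhat Γ B').obj U')
  have := s.isIso_extMap U U'
  exact IsIso.comp_isIso

/-- `Z` is multiplicative with respect to disjoint unions. -/
theorem extMap₂_dw (s : CornerSum C C' E) (U : GrObj Γ a) (U' : GrObj Γ a') :
    extMap₂ s.sh1 s.sv2 U U' ≫ (dw Γ E).app (extProd U U') =
      extProdMap ((dw Γ C).app U) ((dw Γ C').app U') ≫ extMap₂ s.sv1 s.sh2 U U' := by
  apply GrObj.Hom.ext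
  funext z
  refine TensorProduct.ext' fun (f : Sect v2 (ZhatObj h1 U) (z ∘ Sum.inl))
    (f' : Sect v2' (ZhatObj h1' U') (z ∘ Sum.inr)) => Subtype.ext ?_
  funext y' ψ'
  refine Subtype.ext ?_
  funext x φ'
  let F : Sect wv2 (ZhatObj wh1 (extProd U U')) z := (extMap₂ s.sh1 s.sv2 U U').app z (f ⊗ₜ f')
  change dwVal E F φ' ψ' = dwVal C f (s.sv1.res φ') (s.sh2.res ψ') ⊗ₜ[ℂ]
    dwVal C' f' (s.sv1.res' φ') (s.sh2.res' ψ')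
  have h := s.gsum_tot (φ' := φ') (ψ' := ψ') (fun P P' => ((f.1 P.y P.ψ).1 _ P.φ) ⊗ₜ[ℂ]
    ((f'.1 P'.y P'.ψ).1 _ P'.φ)) fun P Q P' Q' h h' =>
      congrArg₂ (fun v w => v ⊗ₜ[ℂ] w) (Tot.eval_eq f P Q h) (Tot.eval_eq f' P' Q' h')
  refine (dwVal_eq_gsum F).trans (h.trans ?_)
  rw [dwVal_eq_gsum f, dwVal_eq_gsum f']
  refine Eq.trans ?_ (map_gsum ((TensorProduct.mk ℂ (U.V (x ∘ Sum.inl)) (U'.V (x ∘ Sum.inr))).flip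
    (gsum _ fun P' : Tot C' (s.sv1.res' φ') (s.sh2.res' ψ') => (f'.1 P'.y P'.ψ).1 _ P'.φ)) _).symm
  congr 1
  funext P
  exact (map_gsum (TensorProduct.mk ℂ (U.V (x ∘ Sum.inl)) (U'.V (x ∘ Sum.inr)) _) _).symm

end CornerSum

/-! ### Gluing along a horizontal face -/

section VGluing

variable {Γ : Type} [Group Γ] {a b c d e f : Type} {h1 : Surface a b} {h2 : Surface c d}
  {v1 : Surface a c} {v2 : Surface b d} {h2' : Surface e f} {v1' : Surface c e}
  {v2' : Surface d f} {w1 : Surface a e} {w2 : Surface b f} {C : CornerMfd h1 h2 v1 v2}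
  {C' : CornerMfd h2 h2' v1' v2'} {E : CornerMfd h1 h2' w1 w2}

lemma loopHol_gauge {X Y : Type} [TopologicalSpace X] [TopologicalSpace Y] {σ : Bundle Γ X}
    {ρ ρ' : Bundle Γ Y} {θ : Y → Γ} (h : IsGauge θ ρ ρ') {η : X → Γ} {l : C(Circle, X)}
    {l' : C(Circle, Y)} (e : loopHol l σ = loopHol l' ρ) (hη : η (l 1) = θ (l' 1)) :
    loopHol l (gauge η σ) = loopHol l' ρ' := by
  rw [(isGauge_gauge η σ).loopHol, h.loopHol, e, hη]

lemma loopHol_pull_pull {X Y Y' Z : Type} [TopologicalSpace X] [TopologicalSpace Y]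
    [TopologicalSpace Y'] [TopologicalSpace Z] {l : C(Circle, X)} {l' : C(Circle, Y')} {f : C(X, Y)}
    {h : C(Y, Z)} {k : C(Y', Z)} (e : ∀ w, h (f (l w)) = k (l' w)) (ρ : Bundle Γ Z) :
    loopHol l (pull f (pull h ρ)) = loopHol l' (pull k ρ) := by
  rw [loopHol_pull, loopHol_pull, loopHol_pull, show h.comp (f.comp l) = k.comp l' from
    ContinuousMap.ext e]

lemma pull_eq_pull_pull {X Y Z : Type} [TopologicalSpace X] [TopologicalSpace Y]
    [TopologicalSpace Z] {f : C(X, Z)} {g : C(X, Y)} {h : C(Y, Z)} (e : ∀ p, h (g p) = f p)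
    (ρ : Bundle Γ Z) : pull f ρ = pull g (pull h ρ) := by
  rw [pull_pull, show h.comp g = f from ContinuousMap.ext e]

namespace VGluing

variable (g : VGluing C C' E) {x : a → Γ} {y' : e → Γ} {z : f → Γ} {φ' : BunCat w1 x y'}
  {ψ' : BunCat h2' y' z}

/-- The restriction to the common face `h2`, made to have the holonomies of `φ'` and `P.ψ`. -/
noncomputable def face (P : Tot E φ' ψ') : BunCat h2 (g.g1.mid φ') (g.g2.mid P.ψ) where
  ρ := gauge (bdryGauge h2 (fun j => P.fill.θv1 (g.g1.i₁ (v1.out j 1)))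
    fun j => P.fill.θv2 (g.g2.i₁ (v2.out j 1))) (pull C'.ih1 (pull g.i' P.fill.ρ))
  hol_inc j := loopHol_gauge (l' := g.g1.i₁.comp (v1.out j)) P.fill.gv1
    (loopHol_pull_pull (fun w =>
      (g.glue _).symm.trans ((congrArg g.i (C.u1 j w)).trans (g.cv1 _))) _)
    (bdryGauge_apply _ _ (.inl j))
  hol_out j := loopHol_gauge (l' := g.g2.i₁.comp (v2.out j)) P.fill.gv2
    (loopHol_pull_pull (fun w =>
      (g.glue _).symm.trans ((congrArg g.i (C.u2 j w)).trans (g.cv2 _))) _)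
    (bdryGauge_apply _ _ (.inr j))

/-- The restriction to `C'`. On the common face, the bundle that belongs to it is `face`. -/
noncomputable def res (φ' : BunCat w1 x y') (ψ' : BunCat h2' y' z) :
    Tot E φ' ψ' ⥤ Tot C' (g.g1.res₂ φ') ψ' where
  obj P :=
    { y := g.g2.mid P.ψ
      φ := g.face P
      ψ := g.g2.res₂ P.ψ
      fill :=
        { ρ := pull g.i' P.fill.ρ
          θh1 := bdryGauge h2 (fun j => P.fill.θv1 (g.g1.i₁ (v1.out j 1)))
            fun j => P.fill.θv2 (g.g2.i₁ (v2.out j 1))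
          θv2 := fun p => P.fill.θv2 (g.g2.i₂ p)
          θv1 := fun p => P.fill.θv1 (g.g1.i₂ p)
          θh2 := P.fill.θh2
          gh1 := isGauge_gauge _ _
          gv2 := by
            rw [pull_comp_eq (f' := g.g2.i₂) (g' := E.iv2) g.cv2']; exact P.fill.gv2.pull _
          gv1 := by
            rw [pull_comp_eq (f' := g.g1.i₂) (g' := E.iv1) g.cv1']; exact P.fill.gv1.pull _
          gh2 := by
            rw [← pull_eq_pull_pull g.ch2]; exact P.fill.gh2
          d1 := fun i => (bdryGauge_apply _ _ (.inl i)).trans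
            (congrArg P.fill.θv1 (g.g1.glue i 1))
          d2 := fun i => (bdryGauge_apply _ _ (.inr i)).trans
            (congrArg P.fill.θv2 (g.g2.glue i 1))
          u1 := fun i => by rw [g.g1.out, P.fill.u1]
          u2 := fun i => by rw [g.g2.out, P.fill.u2] } }
  map {P Q} k :=
    { η := fun p => k.η (g.i' p)
      isGauge := k.isGauge.pull g.i'
      cv1 := fun p => (congrArg (fun q => Q.fill.θv1 (g.g1.i₂ p) * k.η q) (g.cv1' p)).trans
        (k.cv1 _)
      ch2 := fun p => (congrArg (fun q => Q.fill.θh2 p * k.η q) (g.ch2 p)).trans (k.ch2 _) }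
  map_id _ := rfl
  map_comp _ _ := rfl

variable (P' : Tot C' (g.g1.res₂ φ') ψ')

/-- The restriction to `C` of a bundle on `E` whose restriction to `C'` is identified with `P'`. -/
noncomputable def fibRes (w : Fib (g.res φ' ψ') P') : Tot C (g.g1.res₁ φ') P'.φ where
  y := w.pt.y
  φ := w.pt.φ
  ψ := (g.g2.res₁ w.pt.ψ).shift 1
    (fun j => ((Tot.toPair C' _ _).map w.arr).η₁ (h2.out j 1))
    (show w.pt.y = 1 * w.pt.y * 1⁻¹ by simp)
    ((Tot.toPair C' _ _).map w.arr).moves₁.out_eq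
  fill :=
    { ρ := pull g.i w.pt.fill.ρ
      θh1 := w.pt.fill.θh1
      θv2 := bdryGauge v2 1 (fun j => ((Tot.toPair C' _ _).map w.arr).η₁ (h2.out j 1)) *
        fun p => w.pt.fill.θv2 (g.g2.i₁ p)
      θv1 := fun p => w.pt.fill.θv1 (g.g1.i₁ p)
      θh2 := P'.fill.θh1 * fun p => w.arr.η (C'.ih1 p)
      gh1 := by
        rw [← pull_eq_pull_pull g.ch1]; exact w.pt.fill.gh1
      gv2 := by
        rw [pull_comp_eq (f' := g.g2.i₁) (g' := E.iv2) g.cv2]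
        exact (w.pt.fill.gv2.pull _).trans (isGauge_gauge _ _)
      gv1 := by
        rw [pull_comp_eq (f' := g.g1.i₁) (g' := E.iv1) g.cv1]; exact w.pt.fill.gv1.pull _
      gh2 := by
        rw [pull_comp_eq (f' := C'.ih1) (g' := g.i') g.glue]
        exact (w.arr.isGauge.pull _).trans P'.fill.gh1
      d1 := fun i => by rw [g.g1.inc, w.pt.fill.d1]
      d2 := fun i => by
        rw [Pi.mul_apply, bdryGauge_apply, g.g2.inc, w.pt.fill.d2]
        exact (one_mul _).symm
      u1 := fun i => by
        rw [Pi.mul_apply, P'.fill.d1, C'.d1, w.arr.cv1, g.g1.glue]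
        rfl
      u2 := fun i => by
        rw [Pi.mul_apply, Pi.mul_apply, bdryGauge_apply]
        have h : ((g.res φ' ψ').obj w.pt).fill.θh1 (h2.out i 1) =
          w.pt.fill.θv2 (g.g2.i₁ (v2.out i 1)) := bdryGauge_apply _ _ (.inr i)
        change _ = P'.fill.θh1 (h2.out i 1) * w.arr.η (C'.ih1 (h2.out i 1)) *
          (((g.res φ' ψ').obj w.pt).fill.θh1 (h2.out i 1))⁻¹ * _
        rw [h, inv_mul_cancel_right] }

/-- `fibRes` is fully faithful: over `C'` a morphism of the homotopy fibre is determined by the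
identifications with `P'`. -/
lemma fib_hom_bijective (w w₁ : Fib (g.res φ' ψ') P') : Function.Bijective
    (fun k : w ⟶ w₁ => (⟨fun p => k.1.η (g.i p), k.1.isGauge.pull g.i,
      fun p => (congrArg (fun q => w₁.pt.fill.θv1 (g.g1.i₁ p) * k.1.η q) (g.cv1 p)).trans
        (k.1.cv1 _), fun p => by
          have h : w₁.arr.η (C'.ih1 p) * k.1.η (g.i' (C'.ih1 p)) = w.arr.η (C'.ih1 p) :=
            congrFun (congrArg Tot.Hom.η k.2) (C'.ih1 p)
          change P'.fill.θh1 p * w₁.arr.η (C'.ih1 p) * k.1.η (g.i (C.ih2 p)) =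
            P'.fill.θh1 p * w.arr.η (C'.ih1 p)
          rw [g.glue, mul_assoc, h]⟩ : g.fibRes P' w ⟶ g.fibRes P' w₁)) := by
  constructor
  · intro k k' h
    refine Subtype.ext (Tot.Hom.ext (funext fun q => ?_))
    rcases g.cover ▸ mem_univ q with ⟨p, rfl⟩ | ⟨p, rfl⟩
    · exact congrFun (congrArg Tot.Hom.η h) p
    · have h1 : w₁.arr.η p * k.1.η (g.i' p) = w₁.arr.η p * k'.1.η (g.i' p) :=
        congrFun (congrArg Tot.Hom.η (k.2.trans k'.2.symm)) p
      exact mul_left_cancel h1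
  · intro k
    let m := w.arr ≫ Groupoid.inv w₁.arr
    obtain ⟨η, hη, e, e'⟩ := exists_glued_gauge g.emb.isClosedEmbedding g.emb'.isClosedEmbedding
      g.cover k.isGauge m.isGauge fun p q h => by
        obtain ⟨s, rfl, rfl⟩ := g.glue_only p q h
        have h1 : P'.fill.θh1 s * w₁.arr.η (C'.ih1 s) * k.η (C.ih2 s) =
          P'.fill.θh1 s * w.arr.η (C'.ih1 s) := k.ch2 s
        rw [mul_assoc, mul_right_inj] at h1
        change _ = (w₁.arr.η (C'.ih1 s))⁻¹ * w.arr.η (C'.ih1 s)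
        rw [← h1, inv_mul_cancel_left]
    refine ⟨⟨⟨η, hη, fun p => ?_, fun p => ?_⟩, Tot.Hom.ext (funext fun p => ?_)⟩,
      Tot.Hom.ext (funext e)⟩
    · rcases g.g1.cover ▸ mem_univ p with ⟨q, rfl⟩ | ⟨q, rfl⟩
      · rw [← g.cv1, e]; exact k.cv1 q
      · rw [← g.cv1', e']; exact m.cv1 q
    · rw [← g.ch2, e']; exact m.ch2 p
    · change w₁.arr.η p * η (g.i' p) = w.arr.η p
      rw [e']
      exact mul_inv_cancel_left _ _

/-- `fibRes` is essentially surjective: a bundle on `C` that restricts to `P'.φ` on the common face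
can be glued to `P'`, and so can the bundles on the vertical faces. -/
lemma exists_fibRes [Finite d] (N : Tot C (g.g1.res₁ φ') P'.φ) :
    ∃ w : Fib (g.res φ' ψ') P', Nonempty (g.fibRes P' w ⟶ N) := by
  obtain ⟨ρ, μ, μ', hμ, hμ', hθ⟩ := exists_glued_bundle g.emb.isClosedEmbedding
    g.emb'.isClosedEmbedding (C.ih2_emb.isClosedEmbedding) g.cover g.glue g.glue_only
    (N.fill.gh2.trans P'.fill.gh1.symm)
  have hθ' : ∀ s, P'.fill.θh1 s * μ' (C'.ih1 s) = N.fill.θh2 s * μ (C.ih2 s) := fun s => by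
    rw [← hθ, Pi.mul_apply, Pi.inv_apply, mul_assoc, mul_inv_cancel_left]
  obtain ⟨τ, k, ⟨n, n1, n2, n3⟩, ⟨n', n1', n2', n3'⟩⟩ := g.g2.exists_glue N.ψ P'.ψ
  have k1 := (hμ.pull C.iv1).trans N.fill.gv1
  have k1' := (hμ'.pull C'.iv1).trans P'.fill.gv1
  rw [pull_comp_eq (f' := g.g1.i₁) (g' := E.iv1) g.cv1] at k1
  rw [pull_comp_eq (f' := g.g1.i₂) (g' := E.iv1) g.cv1'] at k1'
  have k2 := ((hμ.pull C.iv2).trans N.fill.gv2).trans n1.symm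
  have k2' := ((hμ'.pull C'.iv2).trans P'.fill.gv2).trans n1'.symm
  rw [pull_comp_eq (f' := g.g2.i₁) (g' := E.iv2) g.cv2] at k2
  rw [pull_comp_eq (f' := g.g2.i₂) (g' := E.iv2) g.cv2'] at k2'
  obtain ⟨θv1, t1, e1, e1'⟩ := g.g1.exists_glued_gauge (ρ' := φ'.ρ) k1 k1' fun j => by
    simp only [Pi.mul_apply]
    rw [← N.fill.u1, ← C.u1, ← P'.fill.d1, ← C'.d1, hθ']
  obtain ⟨θv2, t2, e2, e2'⟩ := g.g2.exists_glued_gauge (ρ' := τ.ρ) k2 k2' fun j => by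
    simp only [Pi.mul_apply, Pi.inv_apply]
    rw [← N.fill.u2, ← C.u2, ← P'.fill.d2, ← C'.d2, hθ', n3, n2']
  have k3 := (hμ.pull C.ih1).trans N.fill.gh1
  have k4 := (hμ'.pull C'.ih2).trans P'.fill.gh2
  rw [← pull_eq_pull_pull g.ch1] at k3
  rw [← pull_eq_pull_pull g.ch2] at k4
  let P : Tot E φ' ψ' := ⟨N.y, N.φ, τ,
    { ρ := ρ
      θh1 := _
      θv2 := θv2
      θv1 := θv1
      θh2 := _
      gh1 := k3
      gv2 := t2
      gv1 := t1
      gh2 := k4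
      d1 := fun i => by
        rw [← g.g1.inc, e1]
        simp only [Pi.mul_apply]
        rw [N.fill.d1, C.d1]
      d2 := fun i => by
        rw [← g.g2.inc, e2]
        simp only [Pi.mul_apply, Pi.inv_apply]
        rw [N.fill.d2, C.d2, n2]
        simp
      u1 := fun i => by
        rw [← g.g1.out, e1']
        simp only [Pi.mul_apply]
        rw [P'.fill.u1, C'.u1]
      u2 := fun i => by
        rw [← g.g2.out, e2']
        simp only [Pi.mul_apply, Pi.inv_apply]
        rw [P'.fill.u2, C'.u2, n3']
        simp }⟩
  let w : Fib (g.res φ' ψ') P' := ⟨P, ⟨μ', hμ', fun p => (e1' p).symm, fun p => rfl⟩⟩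
  exact ⟨w, ⟨⟨μ, hμ, fun p => (e1 p).symm, fun s => (hθ' s).symm⟩⟩⟩

end VGluing

variable [Finite Γ] [Finite a] [Finite b] [Finite c] [Finite d] [Finite e] [Finite f]

/-- `Z` is compatible with gluing along a horizontal face: the integral over bundles on `E` is
computed along the restriction to `C'`, whose homotopy fibre over `P'` is the groupoid of bundles on
`C` that restrict to `P'.φ` on the common face. -/
theorem VGluing.glueMap_dw (g : VGluing C C' E) (U : GrObj Γ a) :
    (g.g2.glueMap Γ).app ((Zhat Γ h1).obj U) ≫ (dw Γ E).app U =
      (Zhat Γ v2').map ((dw Γ C).app U) ≫ (dw Γ C').app ((Zhat Γ v1).obj U) ≫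
        (Zhat Γ h2').map ((g.g1.glueMap Γ).app U) := by
  apply GrObj.Hom.ext
  funext z
  refine LinearMap.ext fun (F : Sect v2' (ZhatObj v2 (ZhatObj h1 U)) z) => Subtype.ext ?_
  funext y' ψ'
  refine Subtype.ext ?_
  funext x φ'
  let F₁ : Sect w2 (ZhatObj h1 U) z := ((g.g2.glueMap Γ).app ((Zhat Γ h1).obj U)).app z F
  let F₂ : Sect v2' (ZhatObj h2 (ZhatObj v1 U)) z := ((Zhat Γ v2').map ((dw Γ C).app U)).app z F
  let D : Sect v1 U (g.g1.mid φ') := dwVal C' F₂ (g.g1.res₂ φ') ψ'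
  change dwVal E F₁ φ' ψ' = D.1 x (g.g1.res₁ φ')
  have hD : D.1 x (g.g1.res₁ φ') = gsum (Tot C' (g.g1.res₂ φ') ψ') fun P' =>
      gsum (Tot C (g.g1.res₁ φ') P'.φ) fun Q =>
        ((F.1 P'.y P'.ψ).1 Q.y Q.ψ).1 x Q.φ := by
    have h := congrArg (Sect.eval v1 U _ ⟨x, g.g1.res₁ φ'⟩)
      (dwVal_eq_gsum (C := C') (φ' := g.g1.res₂ φ') (ψ' := ψ') F₂)
    refine h.trans ((map_gsum (Sect.eval v1 U _ ⟨x, g.g1.res₁ φ'⟩) _).trans ?_)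
    congr 1
    funext P'
    exact dwVal_eq_gsum (C := C) (φ' := g.g1.res₁ φ') (ψ' := P'.φ) (F.1 P'.y P'.ψ)
  refine (dwVal_eq_gsum F₁).trans (Eq.trans ?_ hD.symm)
  refine (gsum_fubini (g.res φ' ψ') _ (Tot.eval_eq F₁)).trans ?_
  congr 1
  funext P'
  refine (gsum_congr (g.fibRes P') (fun w w₁ => Equiv.ofBijective _ (g.fib_hom_bijective P' w w₁))
    (g.exists_fibRes P') _ _ fun w Q hQ => ?_).symm
  refine (Tot.eval_eq (F.1 P'.y P'.ψ) _ _ hQ).symm.trans ?_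
  exact congrArg (fun s : Sect h1 U w.pt.y => s.1 x w.pt.φ)
    (Sect.eq_of_moves F (moves_shift 1 _ (by simp) ((Tot.toPair C' _ _).map w.arr).moves₁.out_eq _)
      ((Tot.toPair C' _ _).map w.arr).moves₂)

end VGluing

/-! ### Gluing along a vertical face -/

section HGluing

variable {Γ : Type} [Group Γ] {a b c d e f : Type} {h1 : Surface a b} {h2 : Surface c d}
  {v1 : Surface a c} {v2 : Surface b d} {h1' : Surface b e} {h2' : Surface d f}
  {v2' : Surface e f} {w1 : Surface a e} {w2 : Surface c f} {C : CornerMfd h1 h2 v1 v2}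
  {C' : CornerMfd h1' h2' v2 v2'} {E : CornerMfd w1 w2 v1 v2'}

namespace HGluing

variable (g : HGluing C C' E) {x : a → Γ} {y' : c → Γ} {z : f → Γ} {φ' : BunCat v1 x y'}
  {ψ' : BunCat w2 y' z}

/-- The restriction to the common face `v2`, made to have the holonomies of `P.φ` and `ψ'`. -/
noncomputable def face (P : Tot E φ' ψ') : BunCat v2 (g.g1.mid P.φ) (g.g2.mid ψ') where
  ρ := gauge (bdryGauge v2 (fun j => P.fill.θh1 (g.g1.i₁ (h1.out j 1)))
    fun j => P.fill.θh2 (g.g2.i₁ (h2.out j 1))) (pull C.iv2 (pull g.i P.fill.ρ))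
  hol_inc j := loopHol_gauge (l' := g.g1.i₁.comp (h1.out j)) P.fill.gh1
    (loopHol_pull_pull (fun w => (congrArg g.i (C.d2 j w).symm).trans (g.ch1 _)) _)
    (bdryGauge_apply _ _ (.inl j))
  hol_out j := loopHol_gauge (l' := g.g2.i₁.comp (h2.out j)) P.fill.gh2
    (loopHol_pull_pull (fun w => (congrArg g.i (C.u2 j w).symm).trans (g.ch2 _)) _)
    (bdryGauge_apply _ _ (.inr j))

/-- The restriction to `C`. On the common face, the bundle that belongs to it is `face`. -/
noncomputable def res (φ' : BunCat v1 x y') (ψ' : BunCat w2 y' z) :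
    Tot E φ' ψ' ⥤ Tot C φ' (g.g2.res₁ ψ') where
  obj P :=
    { y := g.g1.mid P.φ
      φ := g.g1.res₁ P.φ
      ψ := g.face P
      fill :=
        { ρ := pull g.i P.fill.ρ
          θh1 := fun p => P.fill.θh1 (g.g1.i₁ p)
          θv2 := bdryGauge v2 (fun j => P.fill.θh1 (g.g1.i₁ (h1.out j 1)))
            fun j => P.fill.θh2 (g.g2.i₁ (h2.out j 1))
          θv1 := P.fill.θv1
          θh2 := fun p => P.fill.θh2 (g.g2.i₁ p)
          gh1 := by
            rw [pull_comp_eq (f' := g.g1.i₁) (g' := E.ih1) g.ch1]; exact P.fill.gh1.pull _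
          gv2 := isGauge_gauge _ _
          gv1 := by
            rw [← pull_eq_pull_pull g.cv1]; exact P.fill.gv1
          gh2 := by
            rw [pull_comp_eq (f' := g.g2.i₁) (g' := E.ih2) g.ch2]; exact P.fill.gh2.pull _
          d1 := fun i => by rw [g.g1.inc, P.fill.d1]
          d2 := fun i => Eq.symm (by exact bdryGauge_apply _ _ (.inl i))
          u1 := fun i => by rw [g.g2.inc, P.fill.u1]
          u2 := fun i => Eq.symm (by exact bdryGauge_apply _ _ (.inr i)) } }
  map {P Q} k :=
    { η := fun p => k.η (g.i p)
      isGauge := k.isGauge.pull g.i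
      cv1 := fun p => (congrArg (fun q => Q.fill.θv1 p * k.η q) (g.cv1 p)).trans (k.cv1 _)
      ch2 := fun p => (congrArg (fun q => Q.fill.θh2 (g.g2.i₁ p) * k.η q) (g.ch2 p)).trans
        (k.ch2 _) }
  map_id _ := rfl
  map_comp _ _ := rfl

variable (P' : Tot C φ' (g.g2.res₁ ψ'))

/-- The restriction to `C'` of a bundle on `E` whose restriction to `C` is identified with `P'`. -/
noncomputable def fibRes (w : Fib (g.res φ' ψ') P') : Tot C' P'.ψ (g.g2.res₂ ψ') where
  y := w.pt.y
  φ := (g.g1.res₂ w.pt.φ).shift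
    (fun j => ((Tot.toPair C _ _).map w.arr).η₁ (h1.out j 1)) 1
    ((Tot.toPair C _ _).map w.arr).moves₁.out_eq (show w.pt.y = 1 * w.pt.y * 1⁻¹ by simp)
  ψ := w.pt.ψ
  fill :=
    { ρ := pull g.i' w.pt.fill.ρ
      θh1 := bdryGauge h1' (fun j => ((Tot.toPair C _ _).map w.arr).η₁ (h1.out j 1)) 1 *
        fun p => w.pt.fill.θh1 (g.g1.i₂ p)
      θv2 := w.pt.fill.θv2
      θv1 := P'.fill.θv2 * fun p => w.arr.η (C.iv2 p)
      θh2 := fun p => w.pt.fill.θh2 (g.g2.i₂ p)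
      gh1 := by
        rw [pull_comp_eq (f' := g.g1.i₂) (g' := E.ih1) g.ch1']
        exact (w.pt.fill.gh1.pull _).trans (isGauge_gauge _ _)
      gv2 := by
        rw [← pull_eq_pull_pull g.cv2]; exact w.pt.fill.gv2
      gv1 := by
        rw [← pull_comp_eq (f := C.iv2) (g := g.i) g.glue]
        exact (w.arr.isGauge.pull _).trans P'.fill.gv2
      gh2 := by
        rw [pull_comp_eq (f' := g.g2.i₂) (g' := E.ih2) g.ch2']; exact w.pt.fill.gh2.pull _
      d1 := fun i => by
        rw [Pi.mul_apply, Pi.mul_apply, bdryGauge_apply, ← g.g1.glue, ← P'.fill.d2, ← C.d2]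
        change P'.fill.θh1 (h1.out i 1) * w.arr.η (C.ih1 (h1.out i 1)) *
          (w.pt.fill.θh1 (g.g1.i₁ (h1.out i 1)))⁻¹ * _ = _
        rw [inv_mul_cancel_right]
      d2 := fun i => by
        rw [Pi.mul_apply, bdryGauge_apply, g.g1.out, w.pt.fill.d2]
        exact one_mul _
      u1 := fun i => by
        rw [Pi.mul_apply, ← P'.fill.u2, ← C.u2, w.arr.ch2, ← g.g2.glue]
        rfl
      u2 := fun i => by rw [g.g2.out, w.pt.fill.u2] }

/-- `fibRes` is fully faithful: over `C` a morphism of the homotopy fibre is determined by the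
identifications with `P'`. -/
lemma fib_hom_bijective (w w₁ : Fib (g.res φ' ψ') P') : Function.Bijective
    (fun k : w ⟶ w₁ => (⟨fun p => k.1.η (g.i' p), k.1.isGauge.pull g.i', fun p => by
        have h : w₁.arr.η (C.iv2 p) * k.1.η (g.i (C.iv2 p)) = w.arr.η (C.iv2 p) :=
          congrFun (congrArg Tot.Hom.η k.2) (C.iv2 p)
        change P'.fill.θv2 p * w₁.arr.η (C.iv2 p) * k.1.η (g.i' (C'.iv1 p)) =
          P'.fill.θv2 p * w.arr.η (C.iv2 p)
        rw [← g.glue, mul_assoc, h],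
      fun p => (congrArg (fun q => w₁.pt.fill.θh2 (g.g2.i₂ p) * k.1.η q) (g.ch2' p)).trans
        (k.1.ch2 _)⟩ : g.fibRes P' w ⟶ g.fibRes P' w₁)) := by
  constructor
  · intro k k' h
    refine Subtype.ext (Tot.Hom.ext (funext fun q => ?_))
    rcases g.cover ▸ mem_univ q with ⟨p, rfl⟩ | ⟨p, rfl⟩
    · have h1 : w₁.arr.η p * k.1.η (g.i p) = w₁.arr.η p * k'.1.η (g.i p) :=
        congrFun (congrArg Tot.Hom.η (k.2.trans k'.2.symm)) p
      exact mul_left_cancel h1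
    · exact congrFun (congrArg Tot.Hom.η h) p
  · intro k
    let m := w.arr ≫ Groupoid.inv w₁.arr
    obtain ⟨η, hη, e, e'⟩ := exists_glued_gauge g.emb.isClosedEmbedding g.emb'.isClosedEmbedding
      g.cover m.isGauge k.isGauge fun p q h => by
        obtain ⟨s, rfl, rfl⟩ := g.glue_only p q h
        have h1 : P'.fill.θv2 s * w₁.arr.η (C.iv2 s) * k.η (C'.iv1 s) =
          P'.fill.θv2 s * w.arr.η (C.iv2 s) := k.cv1 s
        rw [mul_assoc, mul_right_inj] at h1
        change (w₁.arr.η (C.iv2 s))⁻¹ * w.arr.η (C.iv2 s) = _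
        rw [← h1, inv_mul_cancel_left]
    refine ⟨⟨⟨η, hη, fun p => ?_, fun p => ?_⟩, Tot.Hom.ext (funext fun p => ?_)⟩,
      Tot.Hom.ext (funext e')⟩
    · rw [← g.cv1, e]; exact m.cv1 p
    · rcases g.g2.cover ▸ mem_univ p with ⟨q, rfl⟩ | ⟨q, rfl⟩
      · rw [← g.ch2, e]; exact m.ch2 q
      · rw [← g.ch2', e']; exact k.ch2 q
    · change w₁.arr.η p * η (g.i p) = w.arr.η p
      rw [e]
      exact mul_inv_cancel_left _ _

/-- `fibRes` is essentially surjective: a bundle on `C'` that restricts to `P'.ψ` on the common face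
can be glued to `P'`, and so can the bundles on the horizontal faces. -/
lemma exists_fibRes [Finite b] (N : Tot C' P'.ψ (g.g2.res₂ ψ')) :
    ∃ w : Fib (g.res φ' ψ') P', Nonempty (g.fibRes P' w ⟶ N) := by
  obtain ⟨ρ, μ, μ', hμ, hμ', hθ⟩ := exists_glued_bundle g.emb.isClosedEmbedding
    g.emb'.isClosedEmbedding (C.iv2_emb.isClosedEmbedding) g.cover g.glue g.glue_only
    (P'.fill.gv2.trans N.fill.gv1.symm)
  have hθ' : ∀ s, N.fill.θv1 s * μ' (C'.iv1 s) = P'.fill.θv2 s * μ (C.iv2 s) := fun s => by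
    rw [← hθ, Pi.mul_apply, Pi.inv_apply, mul_assoc, mul_inv_cancel_left]
  obtain ⟨τ, k, ⟨n, n1, n2, n3⟩, ⟨n', n1', n2', n3'⟩⟩ := g.g1.exists_glue P'.φ N.φ
  have k1 := (hμ.pull C.ih2).trans P'.fill.gh2
  have k1' := (hμ'.pull C'.ih2).trans N.fill.gh2
  rw [pull_comp_eq (f' := g.g2.i₁) (g' := E.ih2) g.ch2] at k1
  rw [pull_comp_eq (f' := g.g2.i₂) (g' := E.ih2) g.ch2'] at k1'
  have k2 := ((hμ.pull C.ih1).trans P'.fill.gh1).trans n1.symm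
  have k2' := ((hμ'.pull C'.ih1).trans N.fill.gh1).trans n1'.symm
  rw [pull_comp_eq (f' := g.g1.i₁) (g' := E.ih1) g.ch1] at k2
  rw [pull_comp_eq (f' := g.g1.i₂) (g' := E.ih1) g.ch1'] at k2'
  obtain ⟨θh2, t1, e1, e1'⟩ := g.g2.exists_glued_gauge (ρ' := ψ'.ρ) k1 k1' fun j => by
    simp only [Pi.mul_apply]
    rw [P'.fill.u2, C.u2, N.fill.u1, C'.u1, hθ']
  obtain ⟨θh1, t2, e2, e2'⟩ := g.g1.exists_glued_gauge (ρ' := τ.ρ) k2 k2' fun j => by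
    simp only [Pi.mul_apply, Pi.inv_apply]
    rw [P'.fill.d2, C.d2, N.fill.d1, C'.d1, hθ', n3, n2']
  have k3 := (hμ.pull C.iv1).trans P'.fill.gv1
  have k4 := (hμ'.pull C'.iv2).trans N.fill.gv2
  rw [← pull_eq_pull_pull g.cv1] at k3
  rw [← pull_eq_pull_pull g.cv2] at k4
  let P : Tot E φ' ψ' := ⟨N.y, τ, N.ψ,
    { ρ := ρ
      θh1 := θh1
      θv2 := _
      θv1 := _
      θh2 := θh2
      gh1 := t2
      gv2 := k4
      gv1 := k3
      gh2 := t1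
      d1 := fun i => by
        rw [← g.g1.inc, e2]
        simp only [Pi.mul_apply, Pi.inv_apply]
        rw [P'.fill.d1, C.d1, n2]
        simp
      d2 := fun i => by
        rw [← g.g1.out, e2']
        simp only [Pi.mul_apply, Pi.inv_apply]
        rw [N.fill.d2, C'.d2, n3']
        simp
      u1 := fun i => by
        rw [← g.g2.inc, e1]
        simp only [Pi.mul_apply]
        rw [P'.fill.u1, C.u1]
      u2 := fun i => by
        rw [← g.g2.out, e1']
        simp only [Pi.mul_apply]
        rw [N.fill.u2, C'.u2] }⟩
  let w : Fib (g.res φ' ψ') P' := ⟨P, ⟨μ, hμ, fun p => rfl, fun p => (e1 p).symm⟩⟩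
  exact ⟨w, ⟨⟨μ', hμ', fun s => hθ' s, fun p => (e1' p).symm⟩⟩⟩

end HGluing

variable [Finite Γ] [Finite a] [Finite b] [Finite c] [Finite d] [Finite e] [Finite f]

/-- `Z` is compatible with gluing along a vertical face: the integral over bundles on `E` is
computed along the restriction to `C`, whose homotopy fibre over `P'` is the groupoid of bundles on
`C'` that restrict to `P'.ψ` on the common face. -/
theorem HGluing.glueMap_dw (g : HGluing C C' E) (U : GrObj Γ a) :
    (Zhat Γ v2').map ((g.g1.glueMap Γ).app U) ≫ (dw Γ E).app U =
      (dw Γ C').app ((Zhat Γ h1).obj U) ≫ (Zhat Γ h2').map ((dw Γ C).app U) ≫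
        (g.g2.glueMap Γ).app ((Zhat Γ v1).obj U) := by
  apply GrObj.Hom.ext
  funext z
  refine LinearMap.ext fun (F : Sect v2' (ZhatObj h1' (ZhatObj h1 U)) z) => Subtype.ext ?_
  funext y' ψ'
  refine Subtype.ext ?_
  funext x φ'
  let F₁ : Sect v2' (ZhatObj w1 U) z := ((Zhat Γ v2').map ((g.g1.glueMap Γ).app U)).app z F
  let F₂ : Sect h2' (ZhatObj v2 (ZhatObj h1 U)) z := ((dw Γ C').app ((Zhat Γ h1).obj U)).app z F
  let F₃ : Sect v2 (ZhatObj h1 U) (g.g2.mid ψ') := F₂.1 (g.g2.mid ψ') (g.g2.res₂ ψ')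
  change dwVal E F₁ φ' ψ' = dwVal C F₃ φ' (g.g2.res₁ ψ')
  refine (dwVal_eq_gsum F₁).trans (Eq.trans ?_ (dwVal_eq_gsum F₃).symm)
  refine (gsum_fubini (g.res φ' ψ') _ (Tot.eval_eq F₁)).trans ?_
  congr 1
  funext P'
  have hF : (F₃.1 P'.y P'.ψ).1 x P'.φ = gsum (Tot C' P'.ψ (g.g2.res₂ ψ')) fun Q =>
      ((F.1 Q.y Q.ψ).1 P'.y Q.φ).1 x P'.φ := by
    have h := congrArg (Sect.eval h1 U _ ⟨x, P'.φ⟩)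
      (dwVal_eq_gsum (C := C') (φ' := P'.ψ) (ψ' := g.g2.res₂ ψ') F)
    exact h.trans (map_gsum (Sect.eval h1 U _ ⟨x, P'.φ⟩) _)
  refine Eq.trans ?_ hF.symm
  refine (gsum_congr (g.fibRes P') (fun w w₁ => Equiv.ofBijective _ (g.fib_hom_bijective P' w w₁))
    (g.exists_fibRes P') _ _ fun w Q hQ => ?_).symm
  refine (congrArg (fun s : Sect h1 U P'.y => s.1 x P'.φ) (Tot.eval_eq F _ _ hQ)).symm.trans ?_
  exact Sect.eq_of_moves (F.1 w.pt.y w.pt.ψ) ((Tot.toPair C _ _).map w.arr).moves₁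
    (moves_shift _ 1 ((Tot.toPair C _ _).map w.arr).moves₁.out_eq (by simp) _)

end HGluing

end DW

theorem theorem3 (Γ : Type) [Group Γ] [Finite Γ] :
    -- (a) functoriality
    (∀ (a b c d : Type) [Finite a] [Finite b] [Finite c] [Finite d]
      (h1 h1' : DW.Surface a b) (h2 h2' : DW.Surface c d) (v1 v1' : DW.Surface a c)
      (v2 v2' : DW.Surface b d) (C : DW.CornerMfd h1 h2 v1 v2) (C' : DW.CornerMfd h1' h2' v1' v2')
      (F : DW.CornerDiffeo C C'),
      DW.dw Γ C ≫ (DW.SurfDiffeo.push Γ F.fv1 ◫ DW.SurfDiffeo.push Γ F.fh2) =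
        (DW.SurfDiffeo.push Γ F.fh1 ◫ DW.SurfDiffeo.push Γ F.fv2) ≫ DW.dw Γ C') ∧
    -- (b) multiplicativity
    (∀ (a b c d a' b' c' d' : Type) [Finite a] [Finite b] [Finite c] [Finite d] [Finite a']
      [Finite b'] [Finite c'] [Finite d']
      (h1 : DW.Surface a b) (h2 : DW.Surface c d) (v1 : DW.Surface a c) (v2 : DW.Surface b d)
      (h1' : DW.Surface a' b') (h2' : DW.Surface c' d') (v1' : DW.Surface a' c')
      (v2' : DW.Surface b' d') (wh1 : DW.Surface (a ⊕ a') (b ⊕ b'))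
      (wh2 : DW.Surface (c ⊕ c') (d ⊕ d')) (wv1 : DW.Surface (a ⊕ a') (c ⊕ c'))
      (wv2 : DW.Surface (b ⊕ b') (d ⊕ d')) (C : DW.CornerMfd h1 h2 v1 v2)
      (C' : DW.CornerMfd h1' h2' v1' v2') (E : DW.CornerMfd wh1 wh2 wv1 wv2)
      (s : DW.CornerSum C C' E) (U : DW.GrObj Γ a) (U' : DW.GrObj Γ a'),
      IsIso (DW.extMap₂ s.sh1 s.sv2 U U') ∧ IsIso (DW.extMap₂ s.sv1 s.sh2 U U') ∧
      DW.extMap₂ s.sh1 s.sv2 U U' ≫ (DW.dw Γ E).app (DW.extProd U U') =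
        DW.extProdMap ((DW.dw Γ C).app U) ((DW.dw Γ C').app U') ≫
          DW.extMap₂ s.sv1 s.sh2 U U') ∧
    -- (c)(i) gluing along a horizontal face
    (∀ (a b c d e f : Type) [Finite a] [Finite b] [Finite c] [Finite d] [Finite e] [Finite f]
      (h1 : DW.Surface a b) (h2 : DW.Surface c d) (v1 : DW.Surface a c) (v2 : DW.Surface b d)
      (h2' : DW.Surface e f) (v1' : DW.Surface c e) (v2' : DW.Surface d f)
      (w1 : DW.Surface a e) (w2 : DW.Surface b f) (C : DW.CornerMfd h1 h2 v1 v2)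
      (C' : DW.CornerMfd h2 h2' v1' v2') (E : DW.CornerMfd h1 h2' w1 w2)
      (g : DW.VGluing C C' E),
      IsIso (DW.SurfGluing.glueMap Γ g.g1) ∧ IsIso (DW.SurfGluing.glueMap Γ g.g2) ∧
      ∀ U : DW.GrObj Γ a,
        (DW.SurfGluing.glueMap Γ g.g2).app ((DW.Zhat Γ h1).obj U) ≫ (DW.dw Γ E).app U =
          (DW.Zhat Γ v2').map ((DW.dw Γ C).app U) ≫
            (DW.dw Γ C').app ((DW.Zhat Γ v1).obj U) ≫
              (DW.Zhat Γ h2').map ((DW.SurfGluing.glueMap Γ g.g1).app U)) ∧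
    -- (c)(ii) gluing along a vertical face
    (∀ (a b c d e f : Type) [Finite a] [Finite b] [Finite c] [Finite d] [Finite e] [Finite f]
      (h1 : DW.Surface a b) (h2 : DW.Surface c d) (v1 : DW.Surface a c) (v2 : DW.Surface b d)
      (h1' : DW.Surface b e) (h2' : DW.Surface d f) (v2' : DW.Surface e f)
      (w1 : DW.Surface a e) (w2 : DW.Surface c f) (C : DW.CornerMfd h1 h2 v1 v2)
      (C' : DW.CornerMfd h1' h2' v2 v2') (E : DW.CornerMfd w1 w2 v1 v2')
      (g : DW.HGluing C C' E),
      IsIso (DW.SurfGluing.glueMap Γ g.g1) ∧ IsIso (DW.SurfGluing.glueMap Γ g.g2) ∧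
      ∀ U : DW.GrObj Γ a,
        (DW.Zhat Γ v2').map ((DW.SurfGluing.glueMap Γ g.g1).app U) ≫ (DW.dw Γ E).app U =
          (DW.dw Γ C').app ((DW.Zhat Γ h1).obj U) ≫
            (DW.Zhat Γ h2').map ((DW.dw Γ C).app U) ≫
              (DW.SurfGluing.glueMap Γ g.g2).app ((DW.Zhat Γ v1).obj U)) := by
  refine ⟨?_, ?_, ?_, ?_⟩
  · intro a b c d _ _ _ _ h1 h1' h2 h2' v1 v1' v2 v2' C C' F
    exact DW.dw_naturality F
  · intro a b c d a' b' c' d' _ _ _ _ _ _ _ _ h1 h2 v1 v2 h1' h2' v1' v2' wh1 wh2 wv1 wv2 C C' E s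
      U U'
    exact ⟨DW.isIso_extMap₂ s.sh1 s.sv2 U U', DW.isIso_extMap₂ s.sv1 s.sh2 U U',
      DW.extMap₂_dw s U U'⟩
  · intro a b c d e f _ _ _ _ _ _ h1 h2 v1 v2 h2' v1' v2' w1 w2 C C' E g
    exact ⟨g.g1.isIso_glueMap, g.g2.isIso_glueMap, g.glueMap_dw⟩
  · intro a b c d e f _ _ _ _ _ _ h1 h2 v1 v2 h1' h2' v2' w1 w2 C C' E g
    exact ⟨g.g1.isIso_glueMap, g.g2.isIso_glueMap, g.glueMap_dw⟩
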